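/- A graph $G$ is called $K_s$-saturated if $G$ contains no copy of $K_s$, but adding to $G$ any edge between two distinct non-adjacent vertices creates a copy of $K_s$. Let $K_{s-2} \ast \overline{K}_{n-s+2}$ denote the join of a clique on $s-2$ vertices and an independent set on $n-s+2$ vertices, that is, their disjoint union together with all edges between them. A copy of the cycle $C_r$ in $G$ is a (not necessarily induced) subgraph of $G$ isomorphic to $C_r$. Theorem. Let $s \ge 4$ be an integer, and let $r$ be an integer that is either odd with $r \ge 7$, or even with $r \ge 4\sqrt{s-2}$. Then there exists a constant $n_{r,s}$ such that for all $n \ge n_{r,s}$ the graph $K_{s-2} \ast \overline{K}_{n-s+2}$ is $K_s$-saturated and has the minimum number of copies of $C_r$ among all $n$-vertex $K_s$-saturated graphs. Moreover, if in addition $r \le 2s-4$, then it is, up to isomorphism, the unique $n$-vertex $K_s$-saturated graph with the minimum number of copies of $C_r$. -/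

import Mathlib

namespace SatCycle

open SimpleGraph

/-- `G` is `F`-saturated: `G` contains no (not necessarily induced) copy of `F`, but adding to `G`
any edge joining two distinct nonadjacent vertices creates a copy of `F`. -/
def IsSaturated {V W : Type*} (F : SimpleGraph W) (G : SimpleGraph V) : Prop :=
  F.Free G ∧ ∀ u v : V, u ≠ v → ¬ G.Adj u v → F.IsContained (G ⊔ edge u v)

/-- The join of two graphs: their disjoint union together with all edges between them. -/
def join {V W : Type*} (G : SimpleGraph V) (H : SimpleGraph W) : SimpleGraph (V ⊕ W) :=
  SimpleGraph.sum G H ⊔ completeBipartiteGraph V W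

/-- The join of a clique on `s - 2` vertices and an independent set on `n - (s - 2)` vertices. -/
def extremalGraph (n s : ℕ) : SimpleGraph (Fin (s - 2) ⊕ Fin (n - (s - 2))) :=
  join (completeGraph (Fin (s - 2))) (emptyGraph (Fin (n - (s - 2))))

/-- `G` is an `n`-vertex `F`-saturated graph that has the minimum number of copies of `H`
(subgraphs isomorphic to `H`) among all `n`-vertex `F`-saturated graphs. -/
def IsMinimizer {V W U : Type*} [Fintype V] (n : ℕ) (H : SimpleGraph U) (F : SimpleGraph W)
    (G : SimpleGraph V) : Prop :=
  Fintype.card V = n ∧ IsSaturated F G ∧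
    ∀ G' : SimpleGraph (Fin n), IsSaturated F G' → G.copyCount H ≤ G'.copyCount H

end SatCycle

/-! Put k = s - 2 and m = ⌊r/2⌋, and call the k vertices of the clique of the extremal graph its
hub. Every edge of that graph meets the hub. If r > 2k there are no r-cycles at all
(`cop_eq_empty`), so minimality is trivial and the uniqueness claim is vacuous. Otherwise r ≤ 2k,
the hypotheses force m ≥ 3, and both claims follow from `nonempty_iso_of_card_cop_le`: for large n,
a saturated graph with at most as many r-cycles as the extremal one is isomorphic to it.

Let P be the number of independent m-sets of C_r, and D the descending factorial of k of length r -
m. Cycles in the extremal graph are classified by the independent set of positions outside the hub,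
so there are at most P·D·n^m + O(n^(m-1)) labelled ones (`card_cop_le`). For a lower bound in a
saturated G, each nonadjacent pair u, v has a k-clique S(u, v) of common neighbours
(`exists_common_clique`). Fix an independent m-set I of positions, map it to an independent m-tuple
of G, and fill the gaps of the cycle by distinct vertices from the cliques selected by the ends of
the gaps. There are at least D fillings, and strictly more unless all selected cliques coincide
(`descFactorial_lt_card_sdr_of_ne`).

This needs almost all tuples to be independent, and control on cycles counted for several I. Let B
be the set of vertices of degree at least εn. If B is large, bicliques already give too many cycles
(`exists_card_cop_gt_of_many_big`); so B is bounded and G is sparse. For odd r, few vertices can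
have many neighbours outside B, since such edges would close too many odd cycles
(`mul_card_le_card_cop`). Hence the selected cliques lie mostly inside B, and I is recovered as the
set of positions mapped outside B. For even r there are at most two choices of I. Cycles that meet B
determine theirs; cycles that miss B get weight 1/2. The weighted count of fillings is still at
least D, because off B the cliques are mostly disjoint and 2D < k^m. This last inequality is where r
≥ 4√(s-2) enters (`two_mul_descFactorial_lt`, `descFactorial_le_weight_sdr`).

Near-equality therefore makes the selected cliques agree for most tuples, which yields a k-clique A
with (1-δ)n common neighbours (`exists_clique_of_weights`). If some vertices lie neither in A nor
among its common neighbours, the cycles through them in G outnumber those through the same vertices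
in the graph of all pairs meeting A, while the remaining cycles are no fewer
(`exists_card_cop_hubGraph_lt`). So there are none, and saturation identifies G
(`eq_hubGraph_of_restSet_eq_empty`). -/

namespace SatCycle

open Finset Function SimpleGraph

/-! ### Systems of distinct representatives and the greedy bound. -/

open scoped Classical in
/-- Systems of distinct representatives of a finite family of finite sets. -/
noncomputable def sdr {ι V : Type*} [Fintype ι] (T : ι → Finset V) : Finset (ι → V) :=
  (Fintype.piFinset T).filter Injective

lemma mem_sdr {ι V : Type*} [Fintype ι] {T : ι → Finset V} {g : ι → V} :
    g ∈ sdr T ↔ (∀ i, g i ∈ T i) ∧ Injective g := by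
  simp [sdr]

open scoped Classical in
/-- Restricting a system with prescribed value `b` at `i`. -/
lemma card_sdr_filter_apply {ι V : Type*} [Fintype ι] [DecidableEq ι] (T : ι → Finset V)
    (i : ι) {b : V} (hb : b ∈ T i) (Q : ({j // j ≠ i} → V) → Prop) [DecidablePred Q] :
    #{g ∈ sdr T | g i = b ∧ Q (fun j => g j)} =
      #{g ∈ sdr (fun j : {j // j ≠ i} => (T j).erase b) | Q g} := by
  refine card_bij' (fun g _ j => g j) (fun g _ j => if h : j = i then b else g ⟨j, h⟩) ?_ ?_ ?_ ?_
  · intro g hg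
    simp only [mem_filter, mem_sdr, mem_erase] at hg ⊢
    obtain ⟨⟨h1, h2⟩, h3, h4⟩ := hg
    refine ⟨⟨fun j => ⟨fun h => j.2 (h2 (h.trans h3.symm)), h1 j⟩, fun x y h => ?_⟩, h4⟩
    exact Subtype.ext (h2 h)
  · intro g hg
    simp only [mem_filter, mem_sdr, mem_erase] at hg ⊢
    obtain ⟨⟨h1, h2⟩, h4⟩ := hg
    refine ⟨⟨fun j => ?_, fun x y h => ?_⟩, by simp, ?_⟩
    · by_cases h : j = i
      · subst h; simpa using hb
      · simpa [h] using (h1 ⟨j, h⟩).2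
    · by_cases hx : x = i <;> by_cases hy : y = i
      · rw [hx, hy]
      · simp only [hx, hy, dite_true, dite_false] at h
        exact absurd h.symm (h1 ⟨y, hy⟩).1
      · simp only [hx, hy, dite_true, dite_false] at h
        exact absurd h (h1 ⟨x, hx⟩).1
      · simp only [hx, hy, dite_false] at h
        exact congrArg Subtype.val (h2 h)
    · convert h4 using 2 with j
      simp [j.2]
  · intro g hg
    simp only [mem_filter, mem_sdr] at hg
    funext j
    by_cases h : j = i
    · simp [h, hg.2.1]
    · simp [h]
  · intro g hg
    funext j
    simp [j.2]

open scoped Classical in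
lemma card_sdr_filter_eq_sum {ι V : Type*} [Fintype ι] (T : ι → Finset V) (i : ι)
    (Q : (ι → V) → Prop) [DecidablePred Q] :
    #{g ∈ sdr T | Q g} = ∑ b ∈ T i, #{g ∈ sdr T | g i = b ∧ Q g} := by
  rw [card_eq_sum_card_fiberwise (f := fun g => g i) (t := T i)]
  · refine sum_congr rfl fun b _ => ?_
    rw [filter_filter]
    congr 1
    ext g
    simp [and_comm]
  · intro g hg
    simp only [coe_filter, Set.mem_ofPred_eq, mem_sdr] at hg
    exact hg.1.1 i

open scoped Classical in
lemma card_sdr_eq_sum {ι V : Type*} [Fintype ι] [DecidableEq ι] (T : ι → Finset V) (i : ι) :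
    #(sdr T) = ∑ b ∈ T i, #(sdr (fun j : {j // j ≠ i} => (T j).erase b)) := by
  have h := card_sdr_filter_eq_sum T i (fun _ => True)
  simp only [filter_true, and_true] at h
  rw [h]
  refine sum_congr rfl fun b hb => ?_
  simpa using card_sdr_filter_apply T i hb (fun _ => True)

lemma card_subtype_ne {ι : Type*} [Fintype ι] (i : ι) [Fintype {j // j ≠ i}] :
    Fintype.card {j // j ≠ i} = Fintype.card ι - 1 := by
  classical
  rw [Fintype.card_subtype_compl, Fintype.card_subtype_eq]

-- Greedy choice: once one representative is fixed, every other set loses at most one element. Both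
-- `k` and the index type shrink in the induction, so they are quantified inside it.
open scoped Classical in
lemma descFactorial_le_card_sdr {V : Type*} (M : ℕ) : ∀ (k : ℕ) {ι : Type} [Fintype ι]
    (T : ι → Finset V), Fintype.card ι = M → M ≤ k → (∀ i, k ≤ #(T i)) →
    k.descFactorial M ≤ #(sdr T) := by
  induction M with
  | zero =>
    intro k ι _ T h0 _ _
    have : IsEmpty ι := Fintype.card_eq_zero_iff.1 h0
    simp only [Nat.descFactorial_zero]
    refine Nat.one_le_iff_ne_zero.2 (card_ne_zero_of_mem (a := isEmptyElim) ?_)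
    rw [mem_sdr]
    exact ⟨fun i => isEmptyElim i, fun i => isEmptyElim i⟩
  | succ M ih =>
    intro k ι _ T hc hk hT
    obtain ⟨k, rfl⟩ : ∃ k', k = k' + 1 := ⟨k - 1, by omega⟩
    obtain ⟨i⟩ : Nonempty ι := Fintype.card_pos_iff.1 (by omega)
    rw [card_sdr_eq_sum T i, Nat.succ_descFactorial_succ]
    calc (k + 1) * k.descFactorial M ≤ #(T i) * k.descFactorial M :=
          Nat.mul_le_mul_right _ (hT i)
      _ = ∑ b ∈ T i, k.descFactorial M := by rw [sum_const, smul_eq_mul]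
      _ ≤ _ := sum_le_sum fun b _ => ih k _ (by rw [card_subtype_ne]; omega) (by omega)
          fun j => by
            have := hT j
            have := pred_card_le_card_erase (s := T j) (a := b)
            omega

-- The large set is expanded first: it offers `k + 1` choices, each completed greedily.
open scoped Classical in
lemma descFactorial_lt_card_sdr {V : Type*} {k : ℕ} {ι : Type} [Fintype ι]
    (T : ι → Finset V) (hk : Fintype.card ι ≤ k) (hT : ∀ i, k ≤ #(T i)) (j : ι)
    (hj : k + 1 ≤ #(T j)) : k.descFactorial (Fintype.card ι) < #(sdr T) := by
  have hpos : 0 < Fintype.card ι := Fintype.card_pos_iff.2 ⟨j⟩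
  obtain ⟨M, hM⟩ : ∃ M, Fintype.card ι = M + 1 := ⟨Fintype.card ι - 1, by omega⟩
  obtain ⟨k, rfl⟩ : ∃ k', k = k' + 1 := ⟨k - 1, by omega⟩
  rw [card_sdr_eq_sum T j, hM, Nat.succ_descFactorial_succ]
  have hd : 0 < k.descFactorial M := Nat.descFactorial_pos.2 (by omega)
  calc (k + 1) * k.descFactorial M < #(T j) * k.descFactorial M :=
        Nat.mul_lt_mul_of_pos_right (by omega) hd
    _ = ∑ b ∈ T j, k.descFactorial M := by rw [sum_const, smul_eq_mul]
    _ ≤ _ := sum_le_sum fun b _ => descFactorial_le_card_sdr M k _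
        (by rw [card_subtype_ne]; omega) (by omega) fun l => by
          have := hT l
          have := pred_card_le_card_erase (s := T l) (a := b)
          omega

open scoped Classical in
/-- If two of the sets differ, there is one more system than the greedy bound guarantees. -/
lemma descFactorial_lt_card_sdr_of_ne {V : Type*} {k : ℕ} {ι : Type} [Fintype ι]
    (T : ι → Finset V) (hk : Fintype.card ι ≤ k) (hT : ∀ i, #(T i) = k) {i j : ι}
    (hij : T i ≠ T j) : k.descFactorial (Fintype.card ι) < #(sdr T) := by
  have hne : j ≠ i := fun h => hij (by rw [h])
  obtain ⟨a, hai, haj⟩ : ∃ a ∈ T i, a ∉ T j := by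
    by_contra! h
    exact hij (eq_of_subset_of_card_le h (by rw [hT, hT]))
  have hpos : 0 < Fintype.card ι := Fintype.card_pos_iff.2 ⟨j⟩
  obtain ⟨M, hM⟩ : ∃ M, Fintype.card ι = M + 1 := ⟨Fintype.card ι - 1, by omega⟩
  obtain ⟨k, rfl⟩ : ∃ k', k = k' + 1 := ⟨k - 1, by omega⟩
  rw [card_sdr_eq_sum T i, hM, Nat.succ_descFactorial_succ, ← hT i, ← smul_eq_mul, ← sum_const]
  have hcard : Fintype.card {j // j ≠ i} = M := by rw [card_subtype_ne]; omega
  have hle : ∀ (b : V) (l : {j // j ≠ i}), k ≤ #((T l).erase b) := fun b l => by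
    have := hT l
    have := pred_card_le_card_erase (s := T l) (a := b)
    omega
  -- The gain comes from `b = a`: since `a ∉ T j`, the set `T j` loses nothing and exceeds the size
  -- that the greedy bound allows for.
  refine sum_lt_sum (fun b _ => descFactorial_le_card_sdr M k _ hcard (by omega) (hle b))
    ⟨a, hai, ?_⟩
  rw [← hcard]
  refine descFactorial_lt_card_sdr _ (by omega) (hle a) ⟨j, hne⟩ ?_
  rw [erase_eq_of_notMem haj, hT]

/-! ### Families that are disjoint outside `B`. -/

open scoped Classical in
/-- Systems meeting `B`, when the parts of the sets outside `B` are pairwise disjoint. -/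
lemma descFactorial_mul_le_of_disjoint {V : Type*} (B : Finset V) (k M : ℕ) : ∀ {ι : Type}
    [Fintype ι] (T : ι → Finset V), Fintype.card ι = M → M ≤ k → (∀ i, #(T i) = k) →
    (∀ i j, i ≠ j → T i ∩ T j ⊆ B) →
    k.descFactorial M * k ^ M ≤
      k ^ M * #{g ∈ sdr T | ∃ i, g i ∈ B} + k.descFactorial M * ∏ i, #(T i \ B) := by
  induction M with
  | zero =>
    intro ι _ T h0 _ _ _
    have : IsEmpty ι := Fintype.card_eq_zero_iff.1 h0
    simp
  | succ M ih =>
    intro ι _ T hc hk hT hd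
    obtain ⟨i⟩ : Nonempty ι := Fintype.card_pos_iff.1 (by omega)
    have hcard : Fintype.card {j // j ≠ i} = M := by rw [card_subtype_ne]; omega
    set ρ : ℕ := ∏ j : {j // j ≠ i}, #(T j \ B) with hρ
    have hprod : ∏ j, #(T j \ B) = #(T i \ B) * ρ := by
      rw [hρ, Fintype.prod_eq_mul_prod_compl i]
      congr 1
      exact prod_subtype _ (by simp) _
    set N : ℕ := #{g ∈ sdr (fun j : {j // j ≠ i} => T j) | ∃ l, g l ∈ B} with hN
    have ihN := ih (fun j : {j // j ≠ i} => T j) hcard (by omega) (fun j => hT j)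
      (fun a b hab => hd a b (fun h => hab (Subtype.ext h)))
    rw [← hρ, ← hN] at ihN
    set q := (k - 1).descFactorial M with hq
    have hk1 : k.descFactorial (M + 1) = k * q := by
      obtain ⟨k, rfl⟩ : ∃ k', k = k' + 1 := ⟨k - 1, by omega⟩
      rw [Nat.succ_descFactorial_succ, hq]; simp
    have hqk : q ≤ k.descFactorial M := Nat.descFactorial_le _ (Nat.sub_le k 1)
    -- A representative of `T i` inside `B` may be completed arbitrarily. One outside `B` belongs to
    -- no other set, so nothing needs erasing, but the rest must still meet `B`.
    have hsum : #(T i ∩ B) * q + #(T i \ B) * N ≤ #{g ∈ sdr T | ∃ i, g i ∈ B} := by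
      rw [card_sdr_filter_eq_sum T i, ← sum_inter_add_sum_sdiff (T i) B, ← smul_eq_mul,
        ← smul_eq_mul, ← sum_const, ← sum_const]
      refine add_le_add (sum_le_sum fun b hb => ?_) (sum_le_sum fun b hb => ?_)
      · rw [mem_inter] at hb
        have h1 := card_sdr_filter_apply T i hb.1 (fun _ => True)
        simp only [and_true, filter_true] at h1
        calc q ≤ #(sdr fun j : {j // j ≠ i} => (T j).erase b) :=
              descFactorial_le_card_sdr M (k - 1) _ hcard (by omega) fun l => by
                have := hT l
                have := pred_card_le_card_erase (s := T l) (a := b)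
                omega
          _ ≤ _ := by
            rw [← h1]
            refine card_le_card fun g hg => ?_
            simp only [mem_filter] at hg ⊢
            exact ⟨hg.1, hg.2, i, hg.2 ▸ hb.2⟩
      · rw [mem_sdiff] at hb
        have h1 := card_sdr_filter_apply T i hb.1 (fun g => ∃ l, g l ∈ B)
        have h2 : (fun j : {j // j ≠ i} => (T j).erase b) = fun j : {j // j ≠ i} => T j := by
          funext j
          refine erase_eq_of_notMem fun h => hb.2 (hd i j (Ne.symm j.2) ?_)
          exact mem_inter.2 ⟨hb.1, h⟩
        rw [h2] at h1
        rw [hN, ← h1]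
        refine card_le_card fun g hg => ?_
        simp only [mem_filter] at hg ⊢
        obtain ⟨h3, h4, l, hl⟩ := hg
        exact ⟨h3, h4, l, hl⟩
    have hTi : #(T i ∩ B) + #(T i \ B) = k := by rw [card_inter_add_card_sdiff, hT]
    rw [hprod, hk1, pow_succ]
    set t := #(T i \ B)
    set a := #(T i ∩ B)
    set W := #{g ∈ sdr T | ∃ i, g i ∈ B}
    set D := k.descFactorial M
    have hρle : ρ ≤ k ^ M := by
      rw [hρ, ← hcard]
      refine (prod_le_pow_card _ _ k fun j _ => ?_)
      rw [← hT j]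
      exact card_le_card sdiff_subset
    -- The induction hypothesis says D(k^M - ρ) ≤ k^M N. As ρ ≤ k^M, D may be replaced by the
    -- smaller q.
    have key : q * k ^ M ≤ k ^ M * N + q * ρ := by
      obtain ⟨d, hd⟩ := Nat.exists_eq_add_of_le hqk
      obtain ⟨e, he⟩ := Nat.exists_eq_add_of_le hρle
      rw [hd, he] at ihN
      rw [he]
      nlinarith [Nat.zero_le (d * e)]
    calc k * q * (k ^ M * k) = k * k ^ M * (a * q) + k * t * (q * k ^ M) := by
          rw [← hTi]; ring
      _ ≤ k * k ^ M * (a * q) + k * t * (k ^ M * N + q * ρ) := by gcongr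
      _ = k ^ M * k * (a * q + t * N) + k * q * (t * ρ) := by ring
      _ ≤ _ := by gcongr

/-- The ratio of the two sides is a product of factors 1 - i/k, at most 1/(1 + j(j-1)/(2k)) after j
factors. For j = m this is below 1/2 once 2k < m(m-1), which follows from 4k ≤ m² and m ≥ 3. -/
lemma two_mul_descFactorial_lt {k m : ℕ} (hm : 3 ≤ m) (hmk : m ≤ k) (h : 4 * k ≤ m ^ 2) :
    2 * k.descFactorial m < k ^ m := by
  have key : ∀ j ≤ k, k.descFactorial j * (2 * k + j * (j - 1)) ≤ 2 * k * k ^ j := by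
    intro j
    induction j with
    | zero => simp
    | succ j ih =>
      intro hj
      have := ih (by omega)
      obtain ⟨e, he⟩ := Nat.exists_eq_add_of_le (show j ≤ k by omega)
      rw [Nat.descFactorial_succ]
      have h1 : k - j = e := by omega
      rw [h1]
      have h2 : e * (2 * k + (j + 1) * (j + 1 - 1)) ≤ k * (2 * k + j * (j - 1)) := by
        rcases j with _ | j
        · simp; nlinarith
        · simp only [Nat.add_sub_cancel]
          subst he
          nlinarith [Nat.zero_le (j * e), Nat.zero_le (j * j), Nat.zero_le (j * j * j)]
      calc e * k.descFactorial j * (2 * k + (j + 1) * (j + 1 - 1))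
          = k.descFactorial j * (e * (2 * k + (j + 1) * (j + 1 - 1))) := by ring
        _ ≤ k.descFactorial j * (k * (2 * k + j * (j - 1))) := by gcongr
        _ = k * (k.descFactorial j * (2 * k + j * (j - 1))) := by ring
        _ ≤ k * (2 * k * k ^ j) := by gcongr
        _ = _ := by ring
  have h1 := key m hmk
  have h2 : 2 * k < m * (m - 1) := by
    obtain ⟨j, rfl⟩ : ∃ j, m = j + 3 := ⟨m - 3, by omega⟩
    have : j + 3 - 1 = j + 2 := by omega
    rw [this]
    nlinarith
  have hd : 0 < k.descFactorial m := Nat.descFactorial_pos.2 (by omega)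
  have h3 : 2 * k * (2 * k.descFactorial m) < 2 * k * k ^ m := by
    nlinarith
  exact Nat.lt_of_mul_lt_mul_left h3

open scoped Classical in
/-- Systems missing `B` count half; still the greedy bound holds, with a gain if the sets are not
all equal. -/
lemma descFactorial_le_weight_sdr {V : Type*} {ι : Type} [Fintype ι] (B : Finset V) {k : ℕ}
    (T : ι → Finset V) (hk : Fintype.card ι ≤ k) (hT : ∀ i, #(T i) = k)
    (hd : ∀ i j, i ≠ j → T i ∩ T j ⊆ B)
    (h2 : 2 * k.descFactorial (Fintype.card ι) < k ^ Fintype.card ι) (c : ℕ)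
    (hc : c = 0 ∨ c = 1 ∧ ∃ i j, T i ≠ T j) :
    2 * k ^ Fintype.card ι * k.descFactorial (Fintype.card ι) + c ≤ k ^ Fintype.card ι *
      (2 * #{g ∈ sdr T | ∃ i, g i ∈ B} + #{g ∈ sdr T | ¬ ∃ i, g i ∈ B}) := by
  set M := Fintype.card ι with hM
  -- Off `B` the sets are disjoint, so every choice function avoiding `B` is automatically
  -- injective.
  have hsmall : #{g ∈ sdr T | ¬ ∃ i, g i ∈ B} = ∏ i, #(T i \ B) := by
    rw [← Fintype.card_piFinset]
    congr 1
    ext g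
    simp only [mem_filter, mem_sdr, Fintype.mem_piFinset, mem_sdiff, not_exists]
    refine ⟨fun h i => ⟨h.1.1 i, h.2 i⟩, fun h => ⟨⟨fun i => (h i).1, fun i j hij => ?_⟩,
      fun i => (h i).2⟩⟩
    by_contra hne
    exact (h i).2 (hd i j hne (mem_inter.2 ⟨(h i).1, hij ▸ (h j).1⟩))
  have hsplit : #{g ∈ sdr T | ∃ i, g i ∈ B} + #{g ∈ sdr T | ¬ ∃ i, g i ∈ B} = #(sdr T) := by
    rw [card_filter_add_card_filter_not]
  have hD := descFactorial_le_card_sdr M k T hM.symm hk (fun i => (hT i).ge)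
  have hkpos : 0 < k ^ M := by omega
  rw [hsmall] at hsplit ⊢
  set P := ∏ i, #(T i \ B)
  set N := #{g ∈ sdr T | ∃ i, g i ∈ B}
  set D := k.descFactorial M
  have hdis : D * k ^ M ≤ k ^ M * N + D * P :=
    descFactorial_mul_le_of_disjoint B k M T hM.symm hk hT hd
  -- If no system misses `B`, all count fully and the unweighted bound applies, with its gain.
  -- Otherwise `hdis` loses at most 2DP, while the P systems contribute k^M P, which is larger by at
  -- least P ≥ 1.
  rcases Nat.eq_zero_or_pos P with hP | hP
  · have hDc : D + c ≤ N := by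
      rcases hc with rfl | ⟨rfl, i, j, hij⟩
      · omega
      · have := descFactorial_lt_card_sdr_of_ne T hk hT hij
        change D < _ at this
        omega
    have : c ≤ k ^ M * c := Nat.le_mul_of_pos_left _ hkpos
    nlinarith
  · have hc1 : c ≤ 1 := by omega
    have : P * (2 * D + 1) ≤ P * k ^ M := Nat.mul_le_mul_left _ h2
    nlinarith

end SatCycle

namespace SatCycle

open Finset Function SimpleGraph
open scoped Classical

/-! ### Counting tuples of vertices. -/

/-- Sum over tuples, one coordinate first. -/
lemma sum_tuple_split {α V : Type*} [Fintype α] [DecidableEq α] [Fintype V] (i : α)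
    (Φ : V → ({j // j ≠ i} → V) → ℕ) :
    ∑ f : α → V, Φ (f i) (fun j => f j) = ∑ a : V, ∑ g : {j // j ≠ i} → V, Φ a g := by
  rw [← Fintype.sum_prod_type' (f := Φ)]
  exact Fintype.sum_equiv (Equiv.funSplitAt i V) _ _ fun f => rfl

lemma sum_tuple_one {α V : Type*} [Fintype α] [DecidableEq α] [Fintype V] (i : α) (φ : V → ℕ) :
    ∑ f : α → V, φ (f i) = Fintype.card V ^ (Fintype.card α - 1) * ∑ a, φ a := by
  rw [sum_tuple_split i (fun a _ => φ a), mul_sum]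
  refine sum_congr rfl fun a _ => ?_
  rw [sum_const, card_univ, Fintype.card_fun, card_subtype_ne, smul_eq_mul]

lemma sum_tuple_two {α V : Type*} [Fintype α] [DecidableEq α] [Fintype V] {i j : α} (hij : i ≠ j)
    (φ : V → V → ℕ) :
    ∑ f : α → V, φ (f i) (f j) = Fintype.card V ^ (Fintype.card α - 2) * ∑ a, ∑ b, φ a b := by
  rw [sum_tuple_split i (fun a g => φ a (g ⟨j, hij.symm⟩)), mul_sum]
  refine sum_congr rfl fun a _ => ?_
  have h := sum_tuple_one (V := V) (⟨j, hij.symm⟩ : {x // x ≠ i}) (φ a)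
  rw [card_subtype_ne] at h
  exact h

lemma sum_tuple_three {α V : Type*} [Fintype α] [DecidableEq α] [Fintype V]
    {i j l : α} (hij : i ≠ j)
    (hil : i ≠ l) (hjl : j ≠ l) (φ : V → V → V → ℕ) :
    ∑ f : α → V, φ (f i) (f j) (f l) =
      Fintype.card V ^ (Fintype.card α - 3) * ∑ a, ∑ b, ∑ c, φ a b c := by
  rw [sum_tuple_split i (fun a g => φ a (g ⟨j, hij.symm⟩) (g ⟨l, hil.symm⟩)), mul_sum]
  refine sum_congr rfl fun a _ => ?_
  have h := sum_tuple_two (V := V) (i := (⟨j, hij.symm⟩ : {x // x ≠ i}))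
    (j := ⟨l, hil.symm⟩) (by simpa using hjl) (φ a)
  rw [card_subtype_ne] at h
  exact h

lemma card_tuple_one {α V : Type*} [Fintype α] [DecidableEq α] [Fintype V] (i : α)
    (P : V → Prop) [DecidablePred P] :
    #{f : α → V | P (f i)} = Fintype.card V ^ (Fintype.card α - 1) * #{a | P a} := by
  rw [card_filter, card_filter]
  exact sum_tuple_one i fun a => if P a then 1 else 0

lemma card_tuple_two {α V : Type*} [Fintype α] [DecidableEq α] [Fintype V] {i j : α} (hij : i ≠ j)
    (P : V → V → Prop) [∀ a b, Decidable (P a b)] :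
    #{f : α → V | P (f i) (f j)} =
      Fintype.card V ^ (Fintype.card α - 2) * ∑ a, #{b | P a b} := by
  rw [card_filter]
  simp_rw [card_filter]
  exact sum_tuple_two hij fun a b => if P a b then 1 else 0

lemma card_tuple_three {α V : Type*} [Fintype α] [DecidableEq α] [Fintype V]
    {i j l : α} (hij : i ≠ j)
    (hil : i ≠ l) (hjl : j ≠ l) (P : V → V → V → Prop) [∀ a b c, Decidable (P a b c)] :
    #{f : α → V | P (f i) (f j) (f l)} =
      Fintype.card V ^ (Fintype.card α - 3) * ∑ a, ∑ b, #{c | P a b c} := by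
  rw [card_filter]
  simp_rw [card_filter]
  exact sum_tuple_three hij hil hjl fun a b c => if P a b c then 1 else 0

/-- Tuples of pairwise distinct and pairwise nonadjacent vertices. -/
def IsIndepTuple {α V : Type*} (G : SimpleGraph V) (f : α → V) : Prop :=
  ∀ i j, i ≠ j → f i ≠ f j ∧ ¬ G.Adj (f i) (f j)

/-- The number of ordered adjacent pairs. -/
noncomputable def adjPairs {V : Type*} [Fintype V] (G : SimpleGraph V) : ℕ :=
  ∑ a, #{b | G.Adj a b}

/-- Union bound over ordered pairs of coordinates; the summand `Fintype.card V` pays for coinciding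
coordinates. -/
lemma card_not_isIndepTuple_le {α V : Type*} [Fintype α] [DecidableEq α] [Fintype V]
    (G : SimpleGraph V) :
    #{f : α → V | ¬ IsIndepTuple G f} ≤ Fintype.card α ^ 2 *
      (Fintype.card V ^ (Fintype.card α - 2) * (adjPairs G + Fintype.card V)) := by
  calc #{f : α → V | ¬ IsIndepTuple G f}
      ≤ #((univ.filter fun p : α × α => p.1 ≠ p.2).biUnion fun p =>
          {f : α → V | f p.2 = f p.1 ∨ G.Adj (f p.1) (f p.2)}) := by
        refine card_le_card fun f hf => ?_
        rw [mem_filter, IsIndepTuple] at hf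
        simp only [mem_filter, mem_univ, true_and, mem_biUnion]
        obtain ⟨-, hf⟩ := hf
        push Not at hf
        obtain ⟨i, j, hij, h⟩ := hf
        refine ⟨(i, j), hij, ?_⟩
        by_cases h1 : f i = f j
        · exact Or.inl h1.symm
        · exact Or.inr (h h1)
    _ ≤ ∑ p ∈ univ.filter fun p : α × α => p.1 ≠ p.2,
          #{f : α → V | f p.2 = f p.1 ∨ G.Adj (f p.1) (f p.2)} := card_biUnion_le
    _ ≤ ∑ p ∈ univ.filter fun p : α × α => p.1 ≠ p.2,
          (Fintype.card V ^ (Fintype.card α - 2) * (adjPairs G + Fintype.card V)) := by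
        refine sum_le_sum fun p hp => ?_
        simp only [mem_filter, mem_univ, true_and] at hp
        rw [card_tuple_two hp (fun a b => b = a ∨ G.Adj a b)]
        refine Nat.mul_le_mul_left _ ?_
        rw [adjPairs, ← card_univ, card_eq_sum_ones, ← sum_add_distrib]
        refine sum_le_sum fun a _ => ?_
        rw [filter_or, add_comm]
        refine (card_union_le _ _).trans ?_
        have : ({b | b = a} : Finset V) = {a} := by ext; simp
        rw [this]
        simp
    _ ≤ _ := by
        rw [sum_const, smul_eq_mul]
        refine Nat.mul_le_mul_right _ ((card_filter_le _ _).trans ?_)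
        rw [card_univ, Fintype.card_prod, sq]

/-- Counting functions by their restrictions to `J` and to its complement. -/
lemma card_filter_glue {W V : Type*} [Fintype W] [DecidableEq W] [Fintype V] (J : Finset W)
    (F : Finset ({x // x ∈ J} → V)) (Q : ({x // x ∈ J} → V) → Finset ({x // x ∉ J} → V)) :
    #{ψ : W → V | (fun x : {x // x ∈ J} => ψ x) ∈ F ∧
        (fun x : {x // x ∉ J} => ψ x) ∈ Q (fun x : {x // x ∈ J} => ψ x)} = ∑ f ∈ F, #(Q f) := by
  rw [← card_sigma]
  refine card_bij' (fun ψ _ => ⟨fun x => ψ x, fun x => ψ x⟩)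
    (fun p _ x => if h : x ∈ J then p.1 ⟨x, h⟩ else p.2 ⟨x, h⟩) ?_ ?_ ?_ ?_
  · intro ψ hψ
    simpa using hψ
  · rintro ⟨f, g⟩ hp
    simp only [mem_sigma] at hp
    have h1 : (fun x : {x // x ∈ J} => if h : x.1 ∈ J then f ⟨x, h⟩ else g ⟨x, h⟩) = f := by
      funext x; simp [x.2]
    have h2 : (fun x : {x // x ∉ J} => if h : x.1 ∈ J then f ⟨x, h⟩ else g ⟨x, h⟩) = g := by
      funext x; simp [x.2]
    simp only [mem_filter, mem_univ, true_and]
    rw [h1, h2]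
    exact hp
  · intro ψ _
    funext x
    by_cases h : x ∈ J <;> simp [h]
  · rintro ⟨f, g⟩ _
    have h1 : (fun x : {x // x ∈ J} => if h : x.1 ∈ J then f ⟨x, h⟩ else g ⟨x, h⟩) = f := by
      funext x; simp [x.2]
    have h2 : (fun x : {x // x ∉ J} => if h : x.1 ∈ J then f ⟨x, h⟩ else g ⟨x, h⟩) = g := by
      funext x; simp [x.2]
    simp only [h1, h2]

/-! ### Building copies by filling gaps with selected cliques. -/

/-- Every vertex outside `J` sits between two designated vertices of `J`, which comprise all its
neighbours in `J`; adjacent vertices outside `J` sit between the same two vertices. -/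
structure GapMaps {W : Type*} (H : SimpleGraph W) (J : Finset W) where
  l : {x // x ∉ J} → {x // x ∈ J}
  r : {x // x ∉ J} → {x // x ∈ J}
  ne : ∀ x, l x ≠ r x
  nbr : ∀ (x : {x // x ∉ J}) (y : {x // x ∈ J}), H.Adj x.1 y.1 → y = l x ∨ y = r x
  same : ∀ x y : {x // x ∉ J}, H.Adj x.1 y.1 → l x = l y ∧ r x = r y

/-- The labelled copies of `H` in `G`, as functions. -/
noncomputable def cop {W V : Type*} [Fintype W] [DecidableEq W] [Fintype V] (H : SimpleGraph W)
    (G : SimpleGraph V) : Finset (W → V) :=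
  {ψ | Injective ψ ∧ ∀ x y, H.Adj x y → G.Adj (ψ x) (ψ y)}

lemma mem_cop {W V : Type*} [Fintype W] [DecidableEq W] [Fintype V] {H : SimpleGraph W}
    {G : SimpleGraph V} {ψ : W → V} :
    ψ ∈ cop H G ↔ Injective ψ ∧ ∀ x y, H.Adj x y → G.Adj (ψ x) (ψ y) := by
  simp [cop]

/-- `S` assigns to nonadjacent distinct vertices a `k`-clique of common neighbours. -/
def IsSelector {V : Type*} (G : SimpleGraph V) (k : ℕ) (S : V → V → Finset V) : Prop :=
  ∀ u v, u ≠ v → ¬ G.Adj u v → #(S u v) = k ∧ (∀ x ∈ S u v, G.Adj u x ∧ G.Adj v x) ∧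
    ∀ x ∈ S u v, ∀ y ∈ S u v, x ≠ y → G.Adj x y

/-- The sets of candidates for the images of the vertices outside `J`. -/
def slots {W V : Type*} {H : SimpleGraph W} {J : Finset W} (D : GapMaps H J)
    (S : V → V → Finset V) (f : {x // x ∈ J} → V) : {x // x ∉ J} → Finset V :=
  fun x => S (f (D.l x)) (f (D.r x))

/-- Edges inside `J` are assumed. An edge leaving `J` ends at an end of its gap, to which all of the
selected clique is adjacent. An edge outside `J` lies in a single gap, so its ends go to distinct
vertices of one clique. -/
lemma mem_cop_of_gapMaps {W V : Type*} [Fintype W] [DecidableEq W] [Fintype V]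
    {H : SimpleGraph W} {G : SimpleGraph V} {J : Finset W} (D : GapMaps H J) {k : ℕ}
    {S : V → V → Finset V} (hS : IsSelector G k S) {ψ : W → V}
    (hinj : ∀ x y : {x // x ∈ J}, x ≠ y → ψ x ≠ ψ y)
    (hedge : ∀ x y : {x // x ∈ J}, H.Adj x.1 y.1 → G.Adj (ψ x) (ψ y))
    (hgap : ∀ x, ¬ G.Adj (ψ (D.l x)) (ψ (D.r x)))
    (hg : (fun x : {x // x ∉ J} => ψ x) ∈ sdr (slots D S fun x => ψ x))
    (hav : ∀ (x : {x // x ∉ J}) (y : {x // x ∈ J}), ψ x ≠ ψ y) : ψ ∈ cop H G := by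
  rw [mem_sdr] at hg
  obtain ⟨hg1, hg2⟩ := hg
  have hS' : ∀ x, _ := fun x => hS _ _ (hinj _ _ (D.ne x)) (hgap x)
  have hmix : ∀ (x : {x // x ∉ J}) (y : {x // x ∈ J}), H.Adj x.1 y.1 → G.Adj (ψ x) (ψ y) := by
    intro x y h
    have h1 := (hS' x).2.1 _ (hg1 x)
    rcases D.nbr x y h with rfl | rfl
    · exact h1.1.symm
    · exact h1.2.symm
  rw [mem_cop]
  constructor
  · intro x y hxy
    by_cases hx : x ∈ J <;> by_cases hy : y ∈ J
    · by_contra hne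
      exact hinj ⟨x, hx⟩ ⟨y, hy⟩ (by simpa using hne) hxy
    · exact absurd hxy.symm (hav ⟨y, hy⟩ ⟨x, hx⟩)
    · exact absurd hxy (hav ⟨x, hx⟩ ⟨y, hy⟩)
    · exact congrArg Subtype.val (@hg2 ⟨x, hx⟩ ⟨y, hy⟩ hxy)
  · intro x y hxy
    by_cases hx : x ∈ J <;> by_cases hy : y ∈ J
    · exact hedge ⟨x, hx⟩ ⟨y, hy⟩ hxy
    · exact (hmix ⟨y, hy⟩ ⟨x, hx⟩ hxy.symm).symm
    · exact hmix ⟨x, hx⟩ ⟨y, hy⟩ hxy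
    · have h1 := D.same ⟨x, hx⟩ ⟨y, hy⟩ hxy
      have h2 := hg1 ⟨y, hy⟩
      rw [slots, ← h1.1, ← h1.2] at h2
      refine (hS' ⟨x, hx⟩).2.2 _ (hg1 ⟨x, hx⟩) _ h2 fun h => hxy.ne ?_
      exact congrArg Subtype.val (@hg2 ⟨x, hx⟩ ⟨y, hy⟩ h)

/-- A selected vertex cannot repeat a value of the tuple: it is adjacent to the ends of its gap,
whereas tuple values are pairwise nonadjacent. -/
lemma mem_cop_of_isIndepTuple {W V : Type*} [Fintype W] [DecidableEq W] [Fintype V]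
    {H : SimpleGraph W} {G : SimpleGraph V} {J : Finset W} (D : GapMaps H J)
    (hJ : ∀ x ∈ J, ∀ y ∈ J, ¬ H.Adj x y) {k : ℕ}
    {S : V → V → Finset V} (hS : IsSelector G k S) {ψ : W → V}
    (hf : IsIndepTuple G (fun x : {x // x ∈ J} => ψ x))
    (hg : (fun x : {x // x ∉ J} => ψ x) ∈ sdr (slots D S fun x => ψ x)) : ψ ∈ cop H G := by
  refine mem_cop_of_gapMaps D hS (fun x y h => (hf x y h).1)
    (fun x y h => absurd h (hJ _ x.2 _ y.2)) (fun x => (hf _ _ (D.ne x)).2) hg fun x y h => ?_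
  have h1 := (hS _ _ (hf _ _ (D.ne x)).1 (hf _ _ (D.ne x)).2).2.1 _ ((mem_sdr.1 hg).1 x)
  by_cases hy : D.l x = y
  · rw [hy] at h1
    exact h1.1.ne h.symm
  · refine (hf _ _ hy).2 ?_
    change G.Adj _ (ψ y)
    rw [← h]
    exact h1.1

/-! ### The cycle -/

/-- The next vertex on the cycle. -/
def cnext {r : ℕ} (x : Fin r) : Fin r := ⟨(x.val + 1) % r, Nat.mod_lt _ x.pos⟩

/-- The previous vertex on the cycle. -/
def cprev {r : ℕ} (x : Fin r) : Fin r := ⟨(x.val + (r - 1)) % r, Nat.mod_lt _ x.pos⟩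

lemma cnext_val {r : ℕ} (x : Fin r) :
    (x.val + 1 = r ∧ (cnext x).val = 0) ∨ (x.val + 1 < r ∧ (cnext x).val = x.val + 1) := by
  have hx := x.2
  rcases Nat.lt_or_ge (x.val + 1) r with h | h
  · exact Or.inr ⟨h, Nat.mod_eq_of_lt h⟩
  · have h : x.val + 1 = r := by omega
    exact Or.inl ⟨h, by simp [cnext, h]⟩

lemma cprev_val {r : ℕ} (x : Fin r) :
    (x.val = 0 ∧ (cprev x).val = r - 1) ∨ (0 < x.val ∧ (cprev x).val = x.val - 1) := by
  have hx := x.2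
  rcases Nat.eq_zero_or_pos x.val with h | h
  · refine Or.inl ⟨h, ?_⟩
    simp only [cprev, h, zero_add]
    exact Nat.mod_eq_of_lt (by omega)
  · refine Or.inr ⟨h, ?_⟩
    have : x.val + (r - 1) = (x.val - 1) + r := by omega
    simp only [cprev, this, Nat.add_mod_right]
    exact Nat.mod_eq_of_lt (by omega)

lemma cprev_cnext {r : ℕ} (x : Fin r) : cprev (cnext x) = x := by
  have h1 := cnext_val x
  have h2 := cprev_val (cnext x)
  have := x.2
  ext; omega

lemma cnext_cprev {r : ℕ} (x : Fin r) : cnext (cprev x) = x := by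
  have h1 := cprev_val x
  have h2 := cnext_val (cprev x)
  have := x.2
  ext; omega

lemma cnext_injective {r : ℕ} : Injective (cnext : Fin r → Fin r) :=
  LeftInverse.injective cprev_cnext

lemma cycleGraph_adj_iff {r : ℕ} (hr : 3 ≤ r) {x y : Fin r} :
    (cycleGraph r).Adj x y ↔ y = cnext x ∨ x = cnext y := by
  have key : ∀ a b : Fin r, (a - b).val = 1 ↔ a = cnext b := by
    intro a b
    have h1 := cnext_val b
    have ha := a.2
    have hb := b.2
    rw [Fin.val_sub, Fin.ext_iff]
    rcases Nat.lt_or_ge (r - b.val + a.val) r with h | h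
    · rw [Nat.mod_eq_of_lt h]; omega
    · rw [Nat.mod_eq_sub_mod h, Nat.mod_eq_of_lt (by omega)]; omega
  rw [cycleGraph_adj', key, key, or_comm]

lemma cnext_induction {r : ℕ} {P : Fin r → Prop} {x : Fin r} (hx : P x)
    (h : ∀ y, P y → P (cnext y)) (y : Fin r) : P y := by
  have h1 : ∀ n (z : Fin r), z.val = (x.val + n) % r → P z := by
    intro n
    induction n with
    | zero =>
      intro z hz
      rw [add_zero, Nat.mod_eq_of_lt x.2] at hz
      rwa [Fin.ext hz]
    | succ n ih =>
      intro z hz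
      have : z = cnext ⟨(x.val + n) % r, Nat.mod_lt _ x.pos⟩ := by
        ext
        rw [hz]
        simp [cnext, add_assoc]
      rw [this]
      exact h _ (ih _ rfl)
  refine h1 (y.val + (r - x.val)) y ?_
  have : x.val + (y.val + (r - x.val)) = y.val + r := by have := x.2; omega
  rw [this, Nat.add_mod_right, Nat.mod_eq_of_lt y.2]

/-- The independent sets of size `m` of the cycle of length `r`. -/
noncomputable def indepSets (r m : ℕ) : Finset (Finset (Fin r)) :=
  {I | #I = m ∧ ∀ x ∈ I, cnext x ∉ I}

lemma mem_indepSets {r m : ℕ} {I : Finset (Fin r)} :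
    I ∈ indepSets r m ↔ #I = m ∧ ∀ x ∈ I, cnext x ∉ I := by
  simp [indepSets]

/-- `I`, its shift by one, and `T` are pairwise disjoint. The set `T` records the positions wasted
by `I`, which is how maximum independent sets are shown to have short gaps. -/
lemma two_mul_card_le_of_indep {r : ℕ} {I : Finset (Fin r)} (hI : ∀ x ∈ I, cnext x ∉ I)
    (T : Finset (Fin r)) (hT : ∀ y ∈ T, y ∉ I ∧ cprev y ∉ I) : 2 * #I + #T ≤ r := by
  have h1 : Disjoint I (I.image cnext) := by
    rw [Finset.disjoint_left]
    intro x hx hx'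
    obtain ⟨y, hy, rfl⟩ := mem_image.1 hx'
    exact hI y hy hx
  have h2 : Disjoint (I ∪ I.image cnext) T := by
    rw [Finset.disjoint_left]
    intro x hx hxT
    rcases mem_union.1 hx with h | h
    · exact (hT x hxT).1 h
    · obtain ⟨y, hy, rfl⟩ := mem_image.1 h
      exact (hT _ hxT).2 (by rwa [cprev_cnext])
  have h3 := card_le_univ ((I ∪ I.image cnext) ∪ T)
  rw [card_union_of_disjoint h2, card_union_of_disjoint h1,
    card_image_of_injective _ cnext_injective, Fintype.card_fin] at h3
  omega

lemma cnext_ne {r : ℕ} (hr : 2 ≤ r) (x : Fin r) : cnext x ≠ x := by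
  have := cnext_val x
  rw [Ne, Fin.ext_iff]
  omega

/-- Three consecutive positions outside `I` would waste two positions, and the cycle has only one to
spare. -/
lemma cnext_cnext_mem {r m : ℕ} (hr : 2 ≤ r) (hrm : r ≤ 2 * m + 1) {I : Finset (Fin r)}
    (hI : I ∈ indepSets r m) {x : Fin r} (hx : x ∉ I) (hx' : cnext x ∉ I) :
    cnext (cnext x) ∈ I := by
  rw [mem_indepSets] at hI
  by_contra h
  have h1 := two_mul_card_le_of_indep hI.2 {cnext x, cnext (cnext x)} (by
    intro y hy
    rcases mem_insert.1 hy with rfl | hy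
    · exact ⟨hx', by rwa [cprev_cnext]⟩
    · rw [mem_singleton.1 hy]
      exact ⟨h, by rwa [cprev_cnext]⟩)
  rw [card_pair (cnext_ne hr _).symm] at h1
  omega

lemma cnext_mem_of_even {r m : ℕ} (hrm : r ≤ 2 * m) {I : Finset (Fin r)}
    (hI : I ∈ indepSets r m) {x : Fin r} (hx : x ∉ I) : cnext x ∈ I := by
  rw [mem_indepSets] at hI
  by_contra h
  have h1 := two_mul_card_le_of_indep hI.2 {cnext x} (by
    intro y hy
    rw [mem_singleton.1 hy]
    exact ⟨h, by rwa [cprev_cnext]⟩)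
  rw [card_singleton] at h1
  omega

/-- Without a spare position membership alternates around the cycle, so a single position decides it
everywhere. -/
lemma eq_of_mem_indepSets {r m : ℕ} (hrm : r ≤ 2 * m) {I J : Finset (Fin r)}
    (hI : I ∈ indepSets r m) (hJ : J ∈ indepSets r m) {x : Fin r} (hx : x ∈ I ↔ x ∈ J) :
    I = J := by
  ext y
  refine cnext_induction (P := fun y => y ∈ I ↔ y ∈ J) hx (fun y hy => ?_) y
  have h1 : ∀ K ∈ indepSets r m, (cnext y ∈ K ↔ y ∉ K) := fun K hK =>
    ⟨fun h h' => (mem_indepSets.1 hK).2 y h' h, cnext_mem_of_even hrm hK⟩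
  rw [h1 I hI, h1 J hJ, hy]

lemma card_indepSets_le_two {r m : ℕ} (hr : 0 < r) (hrm : r ≤ 2 * m) :
    #(indepSets r m) ≤ 2 := by
  have h : Set.InjOn (fun I : Finset (Fin r) => decide (⟨0, hr⟩ ∈ I)) (indepSets r m) := by
    intro I hI J hJ hIJ
    exact eq_of_mem_indepSets hrm hI hJ (by simpa using hIJ)
  rw [← card_image_of_injOn h]
  exact (card_le_univ _).trans (by simp)

/-- The last vertex of `I` before `x`, for `I` meeting all triples of consecutive vertices. -/
noncomputable def gapLeft {r : ℕ} (I : Finset (Fin r)) (x : Fin r) : Fin r :=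
  if cprev x ∈ I then cprev x else cprev (cprev x)

/-- The first vertex of `I` after `x`, for `I` meeting all triples of consecutive vertices. -/
noncomputable def gapRight {r : ℕ} (I : Finset (Fin r)) (x : Fin r) : Fin r :=
  if cnext x ∈ I then cnext x else cnext (cnext x)

lemma not_adj_of_mem_indepSets {r m : ℕ} (hr : 3 ≤ r) {I : Finset (Fin r)}
    (hI : I ∈ indepSets r m) : ∀ x ∈ I, ∀ y ∈ I, ¬ (cycleGraph r).Adj x y := by
  intro x hx y hy h
  rcases (cycleGraph_adj_iff hr).1 h with rfl | rfl
  · exact (mem_indepSets.1 hI).2 _ hx hy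
  · exact (mem_indepSets.1 hI).2 _ hy hx

/-- The gaps of a maximum independent set of the cycle. -/
noncomputable def cycleGaps {r m : ℕ} (hr : 6 ≤ r) (hrm : r ≤ 2 * m + 1) {I : Finset (Fin r)}
    (hI : I ∈ indepSets r m) : GapMaps (cycleGraph r) I where
  l x := ⟨gapLeft I x, by
    unfold gapLeft
    split_ifs with h
    · exact h
    · by_contra h'
      have := cnext_cnext_mem (by omega) hrm hI h' (by rwa [cnext_cprev])
      rw [cnext_cprev, cnext_cprev] at this
      exact x.2 this⟩
  r x := ⟨gapRight I x, by
    unfold gapRight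
    split_ifs with h
    · exact h
    · exact cnext_cnext_mem (by omega) hrm hI x.2 h⟩
  -- Each end is one or two steps away from `x`, so the ends are at most four steps apart on a cycle
  -- of length at least six.
  ne x := by
    rw [Ne, Subtype.mk.injEq, gapLeft, gapRight]
    have h1 := cprev_val x.1
    have h2 := cprev_val (cprev x.1)
    have h3 := cnext_val x.1
    have h4 := cnext_val (cnext x.1)
    split_ifs <;> rw [Fin.ext_iff] <;> omega
  nbr x y h := by
    rcases (cycleGraph_adj_iff (by omega)).1 h with h | h
    · right
      ext1
      simp only [gapRight, ← h, y.2, if_true]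
    · left
      ext1
      have h' : cprev x.1 = y := by rw [h, cprev_cnext]
      simp only [gapLeft, h', y.2, if_true]
  same x y h := by
    have key : ∀ a b : Fin r, a ∉ I → b ∉ I → b = cnext a →
        gapLeft I a = gapLeft I b ∧ gapRight I a = gapRight I b := by
      rintro a _ ha hb rfl
      have h1 := cnext_cnext_mem (by omega) hrm hI ha hb
      have h2 : cprev a ∈ I := by
        by_contra h2
        have := cnext_cnext_mem (by omega) hrm hI h2 (by rwa [cnext_cprev])
        rw [cnext_cprev] at this
        exact hb this
      simp [gapLeft, gapRight, cprev_cnext, ha, hb, h1, h2]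
    rcases (cycleGraph_adj_iff (by omega)).1 h with h | h
    · have := key _ _ x.2 y.2 h
      simp [this.1, this.2]
    · have := key _ _ y.2 x.2 h
      simp [this.1, this.2]

lemma exists_gap_left {r m : ℕ} (hr : 6 ≤ r) (hrm : r ≤ 2 * m + 1) {I : Finset (Fin r)}
    (hI : I ∈ indepSets r m) (i : {x // x ∈ I}) : ∃ x, (cycleGaps hr hrm hI).l x = i := by
  refine ⟨⟨cnext i, (mem_indepSets.1 hI).2 _ i.2⟩, ?_⟩
  ext1
  simp [cycleGaps, gapLeft, cprev_cnext]

/-- Otherwise the gap after every `i ≠ p` would end at `p`. The right end of a gap determines the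
vertex of `I` before it, so `I` would have at most two elements. -/
lemma exists_gap_avoiding {r m : ℕ} (hr : 6 ≤ r) (hm : 3 ≤ m) (hrm : r ≤ 2 * m + 1)
    {I : Finset (Fin r)} (hI : I ∈ indepSets r m) (p : {x // x ∈ I}) :
    ∃ x, (cycleGaps hr hrm hI).l x ≠ p ∧ (cycleGaps hr hrm hI).r x ≠ p := by
  set D := cycleGaps hr hrm hI
  have hnx : ∀ i : {x // x ∈ I}, cnext i.1 ∉ I := fun i => (mem_indepSets.1 hI).2 _ i.2
  have hl : ∀ i : {x // x ∈ I}, D.l ⟨cnext i, hnx i⟩ = i := fun i => by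
    ext1
    simp [D, cycleGaps, gapLeft, cprev_cnext]
  have hr' : ∀ i : {x // x ∈ I}, (D.r ⟨cnext i, hnx i⟩).1 = gapRight I (cnext i) := fun i => rfl
  by_contra! hall
  have hinj : ∀ i j : {x // x ∈ I}, i ≠ p → j ≠ p → i = j := by
    intro i j hi hj
    have h1 := hall ⟨cnext i, hnx i⟩ (by rwa [hl])
    have h2 := hall ⟨cnext j, hnx j⟩ (by rwa [hl])
    have h3 : gapRight I (cnext i) = gapRight I (cnext j) := by
      rw [← hr', ← hr', h1, h2]
    unfold gapRight at h3
    split_ifs at h3 with ha hb hb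
    · exact Subtype.ext (cnext_injective (cnext_injective h3))
    · exact absurd i.2 (by rw [cnext_injective (cnext_injective h3)]; exact hnx j)
    · exact absurd j.2 (by rw [← cnext_injective (cnext_injective h3)]; exact hnx i)
    · exact Subtype.ext (cnext_injective (cnext_injective (cnext_injective h3)))
  have h2 : #(I.erase p) ≤ 1 := card_le_one.2 fun a ha b hb => by
    rw [mem_erase] at ha hb
    exact congrArg Subtype.val (hinj ⟨a, ha.2⟩ ⟨b, hb.2⟩ (fun h => ha.1 (congrArg Subtype.val h))
      (fun h => hb.1 (congrArg Subtype.val h)))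
  rw [card_erase_of_mem p.2, (mem_indepSets.1 hI).1] at h2
  omega

/-- In the even case gap ends are the two cyclic neighbours, and distinct positions share both of
them only on a 4-cycle. The resulting third coordinate of the tuple is what makes overlaps of two
slots rare in `le_card_evenTuples`. -/
lemma gap_ends_differ {r m : ℕ} (hr : 6 ≤ r) (hrm : r ≤ 2 * m) {I : Finset (Fin r)}
    (hI : I ∈ indepSets r m) {x y : {x // x ∉ I}} (hxy : x ≠ y) :
    ∃ q, (q = (cycleGaps hr (by omega) hI).l y ∨ q = (cycleGaps hr (by omega) hI).r y) ∧
      q ≠ (cycleGaps hr (by omega) hI).l x ∧ q ≠ (cycleGaps hr (by omega) hI).r x := by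
  have hn : ∀ z : {x // x ∉ I}, cnext z.1 ∈ I := fun z => cnext_mem_of_even hrm hI z.2
  have hp : ∀ z : {x // x ∉ I}, cprev z.1 ∈ I := fun z => by
    by_contra h
    have := cnext_mem_of_even hrm hI h
    rw [cnext_cprev] at this
    exact z.2 this
  have hl : ∀ z, (cycleGaps hr (by omega) hI).l z = ⟨cprev z.1, hp z⟩ := fun z => by
    ext1; simp [cycleGaps, gapLeft, hp z]
  have hr' : ∀ z, (cycleGaps hr (by omega) hI).r z = ⟨cnext z.1, hn z⟩ := fun z => by
    ext1; simp [cycleGaps, gapRight, hn z]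
  simp only [hl, hr']
  have h1 := cprev_val x.1
  have h2 := cnext_val x.1
  have h3 := cprev_val y.1
  have h4 := cnext_val y.1
  have hne : x.1.val ≠ y.1.val := fun h => hxy (Subtype.ext (Fin.ext h))
  have := x.1.2
  have := y.1.2
  by_cases h : cprev y.1 = cprev x.1 ∨ cprev y.1 = cnext x.1
  · refine ⟨_, Or.inr rfl, ?_, ?_⟩ <;> rw [Ne, Subtype.mk.injEq, Fin.ext_iff] <;>
      simp only [Fin.ext_iff] at h <;> omega
  · push Not at h
    exact ⟨_, Or.inl rfl, by simpa using h.1, by simpa using h.2⟩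

/-- The even positions below `2 * m`. -/
noncomputable def evens (r m : ℕ) : Finset (Fin r) := {x | x.val % 2 = 0 ∧ x.val < 2 * m}

lemma mem_evens {r m : ℕ} {x : Fin r} : x ∈ evens r m ↔ x.val % 2 = 0 ∧ x.val < 2 * m := by
  simp [evens]

lemma evens_mem_indepSets {r m : ℕ} (hrm : 2 * m ≤ r) : evens r m ∈ indepSets r m := by
  rw [mem_indepSets]
  constructor
  · have : evens r m = (univ : Finset (Fin m)).image fun i => ⟨2 * i.val, by omega⟩ := by
      ext x
      simp only [mem_evens, mem_image, mem_univ, true_and, Fin.ext_iff]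
      constructor
      · rintro ⟨h1, h2⟩
        exact ⟨⟨x.val / 2, by omega⟩, by simp only; omega⟩
      · rintro ⟨i, hi⟩
        have := i.2
        omega
    rw [this, card_image_of_injective, card_univ, Fintype.card_fin]
    intro a b h
    simp only [Fin.mk.injEq] at h
    ext; omega
  · intro x hx
    rw [mem_evens] at hx ⊢
    have := cnext_val x
    omega

/-! ### Labelled and unlabelled copies -/

lemma finite_graphIso {W : Type*} [Finite W] (H : SimpleGraph W) : Finite (H ≃g H) :=
  Finite.of_injective (fun e : H ≃g H => (e : W → W)) DFunLike.coe_injective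

/-- Labelled copies with the same image subgraph differ by a unique automorphism of `H`. The factor
depends on `H` only, so minimising subgraph copies is the same as minimising labelled ones. -/
lemma card_cop_eq {W V : Type*} [Fintype W] [DecidableEq W] [Fintype V] (H : SimpleGraph W)
    (G : SimpleGraph V) : #(cop H G) = Nat.card (H ≃g H) * G.copyCount H := by
  have h1 : #(cop H G) = #(univ : Finset (Copy H G)) := by
    symm
    refine card_bij' (fun φ _ => ⇑φ) (fun ψ hψ => ⟨⟨ψ, fun {a b} h => (mem_cop.1 hψ).2 a b h⟩,
      (mem_cop.1 hψ).1⟩) ?_ ?_ ?_ ?_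
    · intro φ _
      exact mem_cop.2 ⟨φ.injective, fun x y h => φ.toHom.map_adj h⟩
    · intro ψ _; exact mem_univ _
    · intro φ _; rfl
    · intro ψ _; rfl
  have := finite_graphIso H
  have := Fintype.ofFinite (H ≃g H)
  rw [h1, copyCount_eq_card_image_copyToSubgraph, card_eq_sum_card_image Copy.toSubgraph,
    mul_comm, ← smul_eq_mul, ← sum_const]
  refine sum_congr rfl fun G' hG' => ?_
  obtain ⟨φ₀, -, rfl⟩ := mem_image.1 hG'
  rw [Nat.card_eq_fintype_card, ← card_univ]
  symm
  refine card_bij (fun α _ => φ₀.comp α.toCopy) ?_ ?_ ?_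
  · intro α _
    rw [mem_filter]
    refine ⟨mem_univ _, ?_⟩
    ext a b
    · simp only [Copy.toSubgraph, Subgraph.map_verts, Subgraph.verts_top, Set.image_univ,
        Set.mem_range, Copy.coe_toHom, Copy.comp_apply]
      constructor
      · rintro ⟨x, rfl⟩; exact ⟨_, rfl⟩
      · rintro ⟨x, rfl⟩; exact ⟨α.symm x, by simp⟩
    · simp only [Copy.toSubgraph, Subgraph.map_adj, Relation.Map, Subgraph.top_adj,
        Copy.coe_toHom, Copy.comp_apply]
      constructor
      · rintro ⟨x, y, h, rfl, rfl⟩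
        exact ⟨_, _, α.map_rel_iff.2 h, rfl, rfl⟩
      · rintro ⟨x, y, h, rfl, rfl⟩
        exact ⟨α.symm x, α.symm y, α.symm.map_rel_iff.2 h, by simp, by simp⟩
  · intro α _ β _ h
    ext x
    have := congrArg (fun φ : Copy H G => φ x) h
    exact φ₀.injective (by simpa using this)
  · intro φ hφ
    rw [mem_filter] at hφ
    have hadj : ∀ (χ : Copy H G) (a b : V), χ.toSubgraph.Adj a b ↔
        ∃ x y, H.Adj x y ∧ χ x = a ∧ χ y = b := by
      intro χ a b
      simp [Copy.toSubgraph, Subgraph.map_adj, Relation.Map]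
    have hvert : ∀ (χ : Copy H G) (a : V), a ∈ χ.toSubgraph.verts ↔ ∃ x, χ x = a := by
      intro χ a
      simp [Copy.toSubgraph]
    have hex : ∀ x, ∃ y, φ₀ y = φ x := fun x =>
      (hvert φ₀ _).1 (hφ.2 ▸ (hvert φ _).2 ⟨x, rfl⟩)
    choose a ha using hex
    have hinj : Injective a := fun x y h => by
      have h' : φ x = φ y := by rw [← ha, ← ha, h]
      exact φ.injective h'
    have hsur : Surjective a := Finite.surjective_of_injective hinj
    refine ⟨⟨Equiv.ofBijective a ⟨hinj, hsur⟩, fun {x y} => ?_⟩, mem_univ _, ?_⟩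
    · change H.Adj (a x) (a y) ↔ H.Adj x y
      constructor
      · intro h
        have h2 := (hadj φ₀ (φ x) (φ y)).2 ⟨_, _, h, ha x, ha y⟩
        rw [← hφ.2, hadj] at h2
        obtain ⟨x', y', h3, h4, h5⟩ := h2
        rwa [φ.injective h4, φ.injective h5] at h3
      · intro h
        have h2 := (hadj φ (φ x) (φ y)).2 ⟨_, _, h, rfl, rfl⟩
        rw [hφ.2, hadj] at h2
        obtain ⟨x', y', h3, h4, h5⟩ := h2
        rw [← ha x] at h4
        rw [← ha y] at h5
        rwa [φ₀.injective h4, φ₀.injective h5] at h3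
    · ext x
      exact ha x

lemma copyCount_le_iff {W V V' : Type*} [Fintype W] [DecidableEq W] [Fintype V] [Fintype V']
    (H : SimpleGraph W) (G : SimpleGraph V) (G' : SimpleGraph V') :
    G.copyCount H ≤ G'.copyCount H ↔ #(cop H G) ≤ #(cop H G') := by
  rw [card_cop_eq, card_cop_eq]
  have := finite_graphIso H
  have : 0 < Nat.card (H ≃g H) := Nat.card_pos_iff.2 ⟨⟨Iso.refl⟩, inferInstance⟩
  exact (Nat.mul_le_mul_left_iff this).symm

lemma card_cop_congr {W V V' : Type*} [Fintype W] [DecidableEq W] [Fintype V] [Fintype V']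
    (H : SimpleGraph W) {G : SimpleGraph V} {G' : SimpleGraph V'} (e : G ≃g G') :
    #(cop H G) = #(cop H G') := by
  refine card_bij' (fun ψ _ => e ∘ ψ) (fun ψ _ => e.symm ∘ ψ) ?_ ?_ ?_ ?_
  · intro ψ hψ
    rw [mem_cop] at hψ ⊢
    exact ⟨e.injective.comp hψ.1, fun x y h => e.map_rel_iff.2 (hψ.2 x y h)⟩
  · intro ψ hψ
    rw [mem_cop] at hψ ⊢
    exact ⟨e.symm.injective.comp hψ.1, fun x y h => e.symm.map_rel_iff.2 (hψ.2 x y h)⟩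
  · intro ψ _; funext x; simp
  · intro ψ _; funext x; simp

/-! ### Saturated graphs -/

/-- The copy of K_s created by the edge `uv` must use both `u` and `v`, since otherwise it would
already lie in `G`; removing them leaves the clique. -/
lemma exists_common_clique {V : Type*} {G : SimpleGraph V} {s : ℕ}
    (hG : IsSaturated (completeGraph (Fin s)) G) {u v : V} (huv : u ≠ v) (hadj : ¬ G.Adj u v) :
    ∃ S : Finset V, #S = s - 2 ∧ (∀ x ∈ S, G.Adj u x ∧ G.Adj v x) ∧
      ∀ x ∈ S, ∀ y ∈ S, x ≠ y → G.Adj x y := by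
  obtain ⟨φ⟩ := hG.2 u v huv hadj
  set C : Finset V := univ.image φ with hC
  have hCcard : #C = s := by
    have hφ : Injective φ := φ.injective
    rw [hC, card_image_of_injective _ hφ, card_univ, Fintype.card_fin]
  have hCadj : ∀ x ∈ C, ∀ y ∈ C, x ≠ y → G.Adj x y ∨ (x = u ∧ y = v) ∨ (x = v ∧ y = u) := by
    intro x hx y hy hxy
    obtain ⟨a, -, rfl⟩ := mem_image.1 hx
    obtain ⟨b, -, rfl⟩ := mem_image.1 hy
    have hab : (completeGraph (Fin s)).Adj a b := by
      rw [top_adj]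
      rintro rfl
      exact hxy rfl
    have h := φ.toHom.map_adj hab
    rw [sup_adj, edge_adj] at h
    rcases h with h | h
    · exact Or.inl h
    · exact Or.inr (by simpa [eq_comm] using h.1)
  have hfree : ∀ w, (∀ x ∈ C, ∀ y ∈ C, x ≠ y → x ≠ w → y ≠ w → G.Adj x y) →
      w ∈ C ∨ ∀ x ∈ C, ∀ y ∈ C, x ≠ y → G.Adj x y := by
    intro w hw
    by_cases h : w ∈ C
    · exact Or.inl h
    · exact Or.inr fun x hx y hy hxy =>
        hw x hx y hy hxy (fun h' => h (h' ▸ hx)) (fun h' => h (h' ▸ hy))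
  have hno : ¬ ∀ x ∈ C, ∀ y ∈ C, x ≠ y → G.Adj x y := by
    intro h
    refine hG.1 ⟨⟨⟨φ, fun {a b} hab => ?_⟩, φ.injective⟩⟩
    exact h _ (mem_image_of_mem _ (mem_univ a)) _ (mem_image_of_mem _ (mem_univ b))
      fun h' => hab.ne (φ.injective h')
  have hu : u ∈ C := (hfree u fun x hx y hy hxy h1 h2 => by
    rcases hCadj x hx y hy hxy with h | h | h
    · exact h
    · exact absurd h.1 h1
    · exact absurd h.2 h2).resolve_right hno
  have hv : v ∈ C := (hfree v fun x hx y hy hxy h1 h2 => by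
    rcases hCadj x hx y hy hxy with h | h | h
    · exact h
    · exact absurd h.2 h2
    · exact absurd h.1 h1).resolve_right hno
  refine ⟨(C.erase u).erase v, ?_, ?_, ?_⟩
  · rw [card_erase_of_mem (mem_erase.2 ⟨huv.symm, hv⟩), card_erase_of_mem hu, hCcard]
    omega
  · intro x hx
    simp only [mem_erase] at hx
    refine ⟨(hCadj u hu x hx.2.2 (Ne.symm hx.2.1)).resolve_right ?_,
      (hCadj v hv x hx.2.2 (Ne.symm hx.1)).resolve_right ?_⟩
    · rintro (h | h)
      · exact hx.1 h.2
      · exact huv h.1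
    · rintro (h | h)
      · exact huv h.1.symm
      · exact hx.2.1 h.2
  · intro x hx y hy hxy
    simp only [mem_erase] at hx hy
    refine (hCadj x hx.2.2 y hy.2.2 hxy).resolve_right ?_
    rintro (h | h)
    · exact hx.2.1 h.1
    · exact hx.1 h.1

/-- A selector which prefers the clique `A`. -/
lemma exists_isSelector {V : Type*} {G : SimpleGraph V} {s : ℕ}
    (hG : IsSaturated (completeGraph (Fin s)) G) {A : Finset V} (hA : #A = s - 2)
    (hclique : ∀ x ∈ A, ∀ y ∈ A, x ≠ y → G.Adj x y) :
    ∃ S, IsSelector G (s - 2) S ∧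
      ∀ u v, (∀ x ∈ A, G.Adj u x) → (∀ x ∈ A, G.Adj v x) → S u v = A := by
  have : ∀ u v, ∃ S : Finset V, (u ≠ v → ¬ G.Adj u v → #S = s - 2 ∧
      (∀ x ∈ S, G.Adj u x ∧ G.Adj v x) ∧ ∀ x ∈ S, ∀ y ∈ S, x ≠ y → G.Adj x y) ∧
      ((∀ x ∈ A, G.Adj u x) → (∀ x ∈ A, G.Adj v x) → S = A) := by
    intro u v
    by_cases h : (∀ x ∈ A, G.Adj u x) ∧ ∀ x ∈ A, G.Adj v x
    · exact ⟨A, fun _ _ => ⟨hA, fun x hx => ⟨h.1 x hx, h.2 x hx⟩, hclique⟩, fun _ _ => rfl⟩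
    · by_cases h1 : u ≠ v ∧ ¬ G.Adj u v
      · obtain ⟨S, hS⟩ := exists_common_clique hG h1.1 h1.2
        exact ⟨S, fun _ _ => hS, fun h2 h3 => absurd ⟨h2, h3⟩ h⟩
      · exact ⟨∅, fun h2 h3 => absurd ⟨h2, h3⟩ h1, fun h2 h3 => absurd ⟨h2, h3⟩ h⟩
  choose S hS using this
  exact ⟨S, fun u v => (hS u v).1, fun u v => (hS u v).2⟩

lemma exists_isSelector' {V : Type*} {G : SimpleGraph V} {s : ℕ}
    (hG : IsSaturated (completeGraph (Fin s)) G) : ∃ S, IsSelector G (s - 2) S := by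
  have : ∀ u v, ∃ S : Finset V, (u ≠ v → ¬ G.Adj u v → #S = s - 2 ∧
      (∀ x ∈ S, G.Adj u x ∧ G.Adj v x) ∧ ∀ x ∈ S, ∀ y ∈ S, x ≠ y → G.Adj x y) := by
    intro u v
    by_cases h1 : u ≠ v ∧ ¬ G.Adj u v
    · obtain ⟨S, hS⟩ := exists_common_clique hG h1.1 h1.2
      exact ⟨S, fun _ _ => hS⟩
    · exact ⟨∅, fun h2 h3 => absurd ⟨h2, h3⟩ h1⟩
  choose S hS using this
  exact ⟨S, hS⟩

/-- The common neighbours of a set of vertices. -/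
noncomputable def commonNbrs {V : Type*} [Fintype V] (G : SimpleGraph V) (A : Finset V) :
    Finset V := {v | ∀ a ∈ A, G.Adj v a}

lemma mem_commonNbrs {V : Type*} [Fintype V] {G : SimpleGraph V} {A : Finset V} {v : V} :
    v ∈ commonNbrs G A ↔ ∀ a ∈ A, G.Adj v a := by
  simp [commonNbrs]

/-- Two adjacent common neighbours would complete `A` to a K_s. -/
lemma not_adj_of_mem_commonNbrs {V : Type*} [Fintype V] {G : SimpleGraph V} {s : ℕ} (hs : 2 ≤ s)
    (hG : IsSaturated (completeGraph (Fin s)) G) {A : Finset V} (hA : #A = s - 2)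
    (hclique : ∀ x ∈ A, ∀ y ∈ A, x ≠ y → G.Adj x y) {u v : V} (hu : u ∈ commonNbrs G A)
    (hv : v ∈ commonNbrs G A) : ¬ G.Adj u v := by
  intro h
  rw [mem_commonNbrs] at hu hv
  have hcl : G.IsNClique s (insert u (insert v A)) := by
    have h1 : G.IsNClique (s - 2) A :=
      ⟨fun x hx y hy hxy => hclique x hx y hy hxy, hA⟩
    have h2 := (h1.insert hv).insert (a := u) (by
      intro b hb
      rcases mem_insert.1 hb with rfl | hb
      · exact h
      · exact hu b hb)
    convert h2 using 1
    omega
  have h3 : ¬ G.CliqueFree s := fun h4 => h4 _ hcl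
  rw [not_cliqueFree_iff_top_isContained] at h3
  exact hG.1 h3

/-! ### Upper bounds when all edges meet `A`. -/

lemma card_sdr_const {ι V : Type*} [Fintype ι] (A : Finset V) :
    #(sdr fun _ : ι => A) = (#A).descFactorial (Fintype.card ι) := by
  have h1 : Fintype.card (ι ↪ {x // x ∈ A}) = (#A).descFactorial (Fintype.card ι) := by
    rw [Fintype.card_embedding_eq, Fintype.card_coe]
  rw [← h1, ← card_univ]
  symm
  refine card_bij (fun e _ i => (e i : V)) ?_ ?_ ?_
  · intro e _
    exact mem_sdr.2 ⟨fun i => (e i).2, fun i j h => e.injective (Subtype.ext h)⟩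
  · intro e _ e' _ h
    ext i
    exact congrFun h i
  · intro g hg
    rw [mem_sdr] at hg
    exact ⟨⟨fun i => ⟨g i, hg.1 i⟩, fun i j h => hg.2 (congrArg Subtype.val h)⟩, mem_univ _, rfl⟩

lemma card_notMem_subtype {r : ℕ} (I : Finset (Fin r)) :
    Fintype.card {x // x ∉ I} = r - #I := by
  rw [Fintype.card_subtype_compl, Fintype.card_coe, Fintype.card_fin]

/-- Injective functions on the cycle mapping exactly `I` outside of `A`. -/
lemma card_pattern_le {r : ℕ} {V : Type*} [Fintype V] (A : Finset V) (I : Finset (Fin r))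
    (F : Finset ({x // x ∈ I} → V)) :
    #{ψ : Fin r → V | Injective ψ ∧ (∀ x, x ∈ I ↔ ψ x ∉ A) ∧
      (fun x : {x // x ∈ I} => ψ x) ∈ F} ≤ #F * (#A).descFactorial (r - #I) := by
  have h := card_filter_glue I F fun _ => sdr fun _ => A
  rw [sum_const, smul_eq_mul, card_sdr_const, card_notMem_subtype] at h
  rw [← h]
  refine card_le_card fun ψ hψ => ?_
  rw [mem_filter] at hψ ⊢
  obtain ⟨-, h1, h2, h3⟩ := hψ
  refine ⟨mem_univ _, h3, mem_sdr.2 ⟨fun x => ?_, fun x y hxy => Subtype.ext (h1 hxy)⟩⟩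
  have := (h2 x).not.1 x.2
  simpa using this

lemma indep_of_mem_cop {r : ℕ} (hr : 3 ≤ r) {V : Type*} [Fintype V] {E : SimpleGraph V}
    {A : Finset V} (hE : ∀ x y, E.Adj x y → x ∈ A ∨ y ∈ A) {ψ : Fin r → V}
    (hψ : ψ ∈ cop (cycleGraph r) E) {I : Finset (Fin r)} (hI : ∀ x, x ∈ I ↔ ψ x ∉ A) :
    ∀ x ∈ I, cnext x ∉ I := by
  intro x hx hx'
  have h := (mem_cop.1 hψ).2 x (cnext x) ((cycleGraph_adj_iff hr).2 (Or.inl rfl))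
  rw [hI] at hx hx'
  exact (hE _ _ h).elim hx hx'

/-- The positions outside `A` are independent, so they are at most half of the cycle, and the other
half does not fit injectively into `A`. -/
lemma cop_eq_empty {r k : ℕ} (hr : 3 ≤ r) (hrk : 2 * k < r) {V : Type*} [Fintype V]
    {E : SimpleGraph V} {A : Finset V} (hA : #A = k) (hE : ∀ x y, E.Adj x y → x ∈ A ∨ y ∈ A) :
    cop (cycleGraph r) E = ∅ := by
  refine eq_empty_of_forall_notMem fun ψ hψ => ?_
  set I : Finset (Fin r) := {x | ψ x ∉ A} with hI
  have hI' : ∀ x, x ∈ I ↔ ψ x ∉ A := fun x => by simp [hI]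
  have h1 := two_mul_card_le_of_indep (indep_of_mem_cop hr hE hψ hI') ∅ (by simp)
  have h2 : #Iᶜ ≤ #A := card_le_card_of_injOn ψ
    (fun x hx => by simpa [hI'] using hx) ((mem_cop.1 hψ).1.injOn)
  rw [card_compl, Fintype.card_fin] at h2
  simp at h1
  omega

lemma card_indep_le {r m : ℕ} (hrm : r ≤ 2 * m + 1) {I : Finset (Fin r)}
    (hI : ∀ x ∈ I, cnext x ∉ I) : #I ≤ m := by
  have := two_mul_card_le_of_indep hI ∅ (by simp)
  simp at this
  omega

lemma descFactorial_le_pow_of_le {k r j : ℕ} (hk : 1 ≤ k) (hj : j ≤ r) :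
    k.descFactorial j ≤ k ^ r :=
  (Nat.descFactorial_le_pow k j).trans (Nat.pow_le_pow_right hk hj)

/-- Copies are classified by the set `I` of positions sent outside `A`, which is independent. Sets
of size `m` give the main term; smaller ones lose a factor of the order of the graph. -/
lemma card_cop_le {r m k : ℕ} (hr : 3 ≤ r) (hrm : r ≤ 2 * m + 1) (hk : 1 ≤ k)
    {V : Type*} [Fintype V] [Nonempty V] {E : SimpleGraph V} {A : Finset V} (hA : #A = k)
    (hE : ∀ x y, E.Adj x y → x ∈ A ∨ y ∈ A) :
    #(cop (cycleGraph r) E) ≤ #(indepSets r m) * (Fintype.card V ^ m * k.descFactorial (r - m)) +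
      2 ^ r * (Fintype.card V ^ (m - 1) * k ^ r) := by
  have hn : 1 ≤ Fintype.card V := Fintype.card_pos
  set low : Finset (Finset (Fin r)) := univ.filter fun I => #I < m
  set B : Finset (Fin r) → Finset (Fin r → V) := fun I =>
    {ψ | Injective ψ ∧ (∀ x, x ∈ I ↔ ψ x ∉ A) ∧ (fun x : {x // x ∈ I} => ψ x) ∈ univ} with hB
  have hBle : ∀ I, #(B I) ≤ Fintype.card V ^ #I * k.descFactorial (r - #I) := fun I => by
    have := card_pattern_le A I univ
    rwa [card_univ, Fintype.card_fun, Fintype.card_coe, hA] at this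
  have hsub : cop (cycleGraph r) E ⊆ (indepSets r m).biUnion B ∪ low.biUnion B := by
    intro ψ hψ
    set I : Finset (Fin r) := {x | ψ x ∉ A} with hI
    have hI' : ∀ x, x ∈ I ↔ ψ x ∉ A := fun x => by simp [hI]
    have h1 := indep_of_mem_cop hr hE hψ hI'
    have h2 := card_indep_le hrm h1
    have h3 : ψ ∈ B I := by
      rw [hB, mem_filter]
      exact ⟨mem_univ _, (mem_cop.1 hψ).1, hI', mem_univ _⟩
    rw [mem_union, mem_biUnion, mem_biUnion]
    rcases h2.eq_or_lt with h4 | h4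
    · exact Or.inl ⟨I, mem_indepSets.2 ⟨h4, h1⟩, h3⟩
    · exact Or.inr ⟨I, by simpa [low] using h4, h3⟩
  calc #(cop (cycleGraph r) E) ≤ #((indepSets r m).biUnion B) + #(low.biUnion B) :=
        (card_le_card hsub).trans (card_union_le _ _)
    _ ≤ (∑ I ∈ indepSets r m, #(B I)) + ∑ I ∈ low, #(B I) :=
        add_le_add card_biUnion_le card_biUnion_le
    _ ≤ (∑ I ∈ indepSets r m, Fintype.card V ^ m * k.descFactorial (r - m)) +
        ∑ I ∈ low, Fintype.card V ^ (m - 1) * k ^ r := by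
      refine add_le_add (sum_le_sum fun I hI => ?_) (sum_le_sum fun I hI => ?_)
      · have := hBle I
        rwa [(mem_indepSets.1 hI).1] at this
      · simp only [low, mem_filter] at hI
        exact (hBle I).trans (Nat.mul_le_mul (Nat.pow_le_pow_right hn (by omega))
          (descFactorial_le_pow_of_le hk (by omega)))
    _ ≤ _ := by
      rw [sum_const, sum_const, smul_eq_mul, smul_eq_mul]
      refine Nat.add_le_add_left (Nat.mul_le_mul_right _ ((card_le_univ _).trans ?_)) _
      simp

/-- Same classification, with one position of `I` forced into `R`: this trades one factor of the
order of the graph for `#R`, at the price of the choice of that position. -/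
lemma card_cop_meeting_le {r m k : ℕ} (hr : 3 ≤ r) (hrm : r ≤ 2 * m + 1) (hk : 1 ≤ k)
    {V : Type*} [Fintype V] [Nonempty V] {E : SimpleGraph V} {A R : Finset V} (hA : #A = k)
    (hE : ∀ x y, E.Adj x y → x ∈ A ∨ y ∈ A) (hR : ∀ x ∈ R, x ∉ A) :
    #{ψ ∈ cop (cycleGraph r) E | ∃ x, ψ x ∈ R} ≤
      #(indepSets r m) * (m * (#R * Fintype.card V ^ (m - 1) * k.descFactorial (r - m))) +
      2 ^ r * (m * (#R * Fintype.card V ^ (m - 2) * k ^ r)) := by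
  have hn : 1 ≤ Fintype.card V := Fintype.card_pos
  set low : Finset (Finset (Fin r)) := univ.filter fun I => #I < m
  set B : (I : Finset (Fin r)) → {x // x ∈ I} → Finset (Fin r → V) := fun I p =>
    {ψ | Injective ψ ∧ (∀ x, x ∈ I ↔ ψ x ∉ A) ∧
      (fun x : {x // x ∈ I} => ψ x) ∈ ({f | f p ∈ R} : Finset ({x // x ∈ I} → V))} with hB
  have hBle : ∀ I p, #(B I p) ≤ #R * Fintype.card V ^ (#I - 1) * k.descFactorial (r - #I) :=
    fun I p => by
      have := card_pattern_le A I {f | f p ∈ R}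
      have h2 := card_tuple_one (V := V) p (fun a => a ∈ R)
      rw [Fintype.card_coe] at h2
      have h3 : ({a | a ∈ R} : Finset V) = R := by ext; simp
      rw [h2, hA, h3] at this
      rw [mul_comm (#R)]
      exact this
  have hsub : {ψ ∈ cop (cycleGraph r) E | ∃ x, ψ x ∈ R} ⊆
      ((indepSets r m).biUnion fun I => univ.biUnion (B I)) ∪
        low.biUnion fun I => univ.biUnion (B I) := by
    intro ψ hψ
    rw [mem_filter] at hψ
    obtain ⟨hψ, p, hp⟩ := hψ
    set I : Finset (Fin r) := {x | ψ x ∉ A} with hI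
    have hI' : ∀ x, x ∈ I ↔ ψ x ∉ A := fun x => by simp [hI]
    have h1 := indep_of_mem_cop hr hE hψ hI'
    have h2 := card_indep_le hrm h1
    have hpI : p ∈ I := (hI' p).2 (hR _ hp)
    have h3 : ψ ∈ univ.biUnion (B I) := by
      rw [mem_biUnion]
      refine ⟨⟨p, hpI⟩, mem_univ _, ?_⟩
      rw [hB, mem_filter]
      refine ⟨mem_univ _, (mem_cop.1 hψ).1, hI', ?_⟩
      rw [mem_filter]
      exact ⟨mem_univ _, hp⟩
    rw [mem_union, mem_biUnion, mem_biUnion]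
    rcases h2.eq_or_lt with h4 | h4
    · exact Or.inl ⟨I, mem_indepSets.2 ⟨h4, h1⟩, h3⟩
    · exact Or.inr ⟨I, by simpa [low] using h4, h3⟩
  have hsum : ∀ I, #(univ.biUnion (B I)) ≤
      #I * (#R * Fintype.card V ^ (#I - 1) * k.descFactorial (r - #I)) := fun I => by
    refine card_biUnion_le.trans ((sum_le_sum fun p _ => hBle I p).trans ?_)
    rw [sum_const, smul_eq_mul, card_univ, Fintype.card_coe]
  calc #{ψ ∈ cop (cycleGraph r) E | ∃ x, ψ x ∈ R}
      ≤ (∑ I ∈ indepSets r m, #(univ.biUnion (B I))) + ∑ I ∈ low, #(univ.biUnion (B I)) :=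
        ((card_le_card hsub).trans (card_union_le _ _)).trans
          (add_le_add card_biUnion_le card_biUnion_le)
    _ ≤ (∑ I ∈ indepSets r m, m * (#R * Fintype.card V ^ (m - 1) * k.descFactorial (r - m))) +
        ∑ I ∈ low, m * (#R * Fintype.card V ^ (m - 2) * k ^ r) := by
      refine add_le_add (sum_le_sum fun I hI => ?_) (sum_le_sum fun I hI => ?_)
      · have := hsum I
        rwa [(mem_indepSets.1 hI).1] at this
      · simp only [low, mem_filter] at hI
        exact (hsum I).trans (Nat.mul_le_mul hI.2.le (Nat.mul_le_mul
          (Nat.mul_le_mul_left _ (Nat.pow_le_pow_right hn (by omega)))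
          (descFactorial_le_pow_of_le hk (by omega))))
    _ ≤ _ := by
      rw [sum_const, sum_const, smul_eq_mul, smul_eq_mul]
      refine Nat.add_le_add_left (Nat.mul_le_mul_right _ ((card_le_univ _).trans ?_)) _
      simp

/-! ### Graphs close to the extremal one. -/

/-- All edges meeting `A`. -/
def hubGraph {V : Type*} (A : Finset V) : SimpleGraph V where
  Adj x y := x ≠ y ∧ (x ∈ A ∨ y ∈ A)
  symm := ⟨fun _ _ h => ⟨h.1.symm, h.2.symm⟩⟩
  loopless := ⟨fun _ h => h.1 rfl⟩

/-- The vertices outside `A` not adjacent to all of `A`. -/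
noncomputable def restSet {V : Type*} [Fintype V] (G : SimpleGraph V) (A : Finset V) : Finset V :=
  {v | v ∉ A ∧ v ∉ commonNbrs G A}

lemma mem_restSet {V : Type*} [Fintype V] {G : SimpleGraph V} {A : Finset V} {v : V} :
    v ∈ restSet G A ↔ v ∉ A ∧ v ∉ commonNbrs G A := by
  simp [restSet]

lemma sub_pow_le_descFactorial {t : ℝ} {q m : ℕ} (hm : (m : ℝ) ≤ t) (htq : t ≤ q) :
    (t - m) ^ m ≤ (q.descFactorial m : ℝ) := by
  have h1 : ((q + 1 - m : ℕ) : ℝ) ^ m ≤ (q.descFactorial m : ℝ) := by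
    exact_mod_cast Nat.pow_sub_le_descFactorial q m
  refine le_trans (pow_le_pow_left₀ (by linarith) ?_ m) h1
  have hmq : m ≤ q := by exact_mod_cast hm.trans htq
  rw [Nat.cast_sub (by omega)]
  push_cast
  linarith

/-- Cycles through `w` and two of its neighbours in `U`. -/
lemma descFactorial_le_card_cop_meeting {r m k : ℕ} (hr : 6 ≤ r) (hm : 3 ≤ m)
    (hrm : r ≤ 2 * m + 1) (hrm' : 2 * m ≤ r) (hk : r - m ≤ k) {V : Type*} [Fintype V]
    {G : SimpleGraph V} {A : Finset V} (hA : #A = k)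
    (hclique : ∀ x ∈ A, ∀ y ∈ A, x ≠ y → G.Adj x y) {w : V} (hw : w ∈ restSet G A)
    {q : ℕ} (hq : q ≤ #{u ∈ commonNbrs G A | G.Adj w u}) :
    q.descFactorial m ≤ #{ψ ∈ cop (cycleGraph r) G | ∃ x, ψ x ∈ restSet G A} := by
  set U := commonNbrs G A with hU
  set J := evens r m with hJ
  have hJm := evens_mem_indepSets hrm'
  rw [← hJ] at hJm
  have hwA := (mem_restSet.1 hw).1
  have hwU := (mem_restSet.1 hw).2
  have hUA : ∀ u ∈ U, u ∉ A := fun u hu hA' => (mem_commonNbrs.1 hu u hA').ne rfl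
  let e : Fin r := ⟨1, by omega⟩
  have heJ : e ∉ J := by simp [hJ, mem_evens, e]
  -- Position 1 receives `w`, so its cyclic neighbours 0 and 2 must go to neighbours of `w`. All
  -- other even positions go anywhere in `U`, and the remaining positions go to `A`; for odd `r` two
  -- of these are consecutive, which is where `hclique` is needed.
  set X : {x // x ∈ J} → Finset V := fun i =>
    if i.1.val = 0 ∨ i.1.val = 2 then {u ∈ U | G.Adj w u} else U with hX
  have hXU : ∀ i, X i ⊆ U := fun i => by
    simp only [hX]
    split_ifs
    · exact filter_subset _ _
    · exact Subset.rfl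
  have hXq : ∀ i, q ≤ #(X i) := fun i => by
    simp only [hX]
    split_ifs
    · exact hq
    · exact hq.trans (card_le_card (filter_subset _ _))
  have hcardJ : Fintype.card {x // x ∈ J} = m := by
    rw [Fintype.card_coe, (mem_indepSets.1 hJm).1]
  rcases Nat.lt_or_ge q m with hqm | hqm
  · rw [Nat.descFactorial_of_lt hqm]; exact Nat.zero_le _
  have h1 : q.descFactorial m ≤ #(sdr X) := descFactorial_le_card_sdr m q X hcardJ hqm hXq
  set T : {x // x ∉ J} → Finset V := fun x => if x.1 = e then {w} else A with hT
  have h2 : 1 ≤ #(sdr T) := by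
    rw [card_sdr_eq_sum T ⟨e, heJ⟩]
    have hTe : T ⟨e, heJ⟩ = {w} := by simp [hT]
    rw [hTe, sum_singleton]
    refine le_trans (Nat.one_le_iff_ne_zero.2 (Nat.descFactorial_pos.2 ?_).ne')
      (descFactorial_le_card_sdr _ k _ rfl ?_ fun j => ?_)
    · rw [card_subtype_ne, card_notMem_subtype, (mem_indepSets.1 hJm).1]; omega
    · rw [card_subtype_ne, card_notMem_subtype, (mem_indepSets.1 hJm).1]; omega
    · have hj : j.1.1 ≠ e := fun h => j.2 (Subtype.ext h)
      simp only [hT, hj, if_false]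
      rw [erase_eq_of_notMem hwA, hA]
  have h3 := card_filter_glue J (sdr X) fun _ => sdr T
  rw [sum_const, smul_eq_mul] at h3
  calc q.descFactorial m ≤ #(sdr X) * #(sdr T) := by nlinarith
    _ = _ := h3.symm
    _ ≤ _ := card_le_card fun ψ hψ => ?_
  rw [mem_filter, mem_sdr, mem_sdr] at hψ
  obtain ⟨-, ⟨hX1, hX2⟩, hT1, hT2⟩ := hψ
  have hψe : ψ e = w := by simpa [hT] using hT1 ⟨e, heJ⟩
  have hψJ : ∀ x ∈ J, ψ x ∈ U := fun x hx => hXU _ (hX1 ⟨x, hx⟩)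
  have hψA : ∀ x, x ∉ J → x ≠ e → ψ x ∈ A := fun x hx hxe => by
    simpa [hT, hxe] using hT1 ⟨x, hx⟩
  have hJind := not_adj_of_mem_indepSets (by omega) hJm
  have hedge : ∀ x y, (cycleGraph r).Adj x y → x ∉ J → G.Adj (ψ x) (ψ y) := by
    intro x y hxy hx
    by_cases hxe : x = e
    · subst hxe
      have hy : y.val = 0 ∨ y.val = 2 := by
        have h1 := cnext_val e
        have h2 := cnext_val y
        have he : e.val = 1 := rfl
        rcases (cycleGraph_adj_iff (by omega)).1 hxy with h | h
        · rw [← h] at h1; omega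
        · rw [← h] at h2; omega
      have hyJ : y ∈ J := by rw [hJ, mem_evens]; omega
      have := hX1 ⟨y, hyJ⟩
      simp only [hX, hy, if_true, mem_filter] at this
      rw [hψe]
      exact this.2
    · have hxA := hψA x hx hxe
      by_cases hy : y ∈ J
      · exact (mem_commonNbrs.1 (hψJ y hy) _ hxA).symm
      · by_cases hye : y = e
        · subst hye
          exfalso
          have h1 := cnext_val e
          have h2 := cnext_val x
          have he : e.val = 1 := rfl
          rw [hJ, mem_evens] at hx
          rcases (cycleGraph_adj_iff (by omega)).1 hxy with h | h
          · rw [← h] at h2; omega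
          · rw [← h] at h1; omega
        · refine hclique _ hxA _ (hψA y hy hye) fun h => hxy.ne ?_
          exact congrArg Subtype.val (@hT2 ⟨x, hx⟩ ⟨y, hy⟩ h)
  rw [mem_filter, mem_cop]
  refine ⟨⟨fun x y hxy => ?_, fun x y hxy => ?_⟩, e, hψe ▸ hw⟩
  · have key : ∀ a b, a ∈ J → b ∉ J → ψ a ≠ ψ b := by
      intro a b ha hb h
      by_cases hbe : b = e
      · rw [hbe, hψe] at h
        exact hwU (h ▸ hψJ a ha)
      · exact hUA _ (hψJ a ha) (h ▸ hψA b hb hbe)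
    by_cases hx : x ∈ J <;> by_cases hy : y ∈ J
    · exact congrArg Subtype.val (@hX2 ⟨x, hx⟩ ⟨y, hy⟩ hxy)
    · exact absurd hxy (key _ _ hx hy)
    · exact absurd hxy.symm (key _ _ hy hx)
    · exact congrArg Subtype.val (@hT2 ⟨x, hx⟩ ⟨y, hy⟩ hxy)
  · by_cases hx : x ∈ J
    · by_cases hy : y ∈ J
      · exact absurd hxy (hJind x hx y hy)
      · exact (hedge y x hxy.symm hy).symm
    · exact hedge x y hxy hx

/-- The copies of the cycle with `p` mapped to the remainder and the other vertices of `I` mapped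
to nonneighbours of the image of `p` among the common neighbours of `A`. -/
noncomputable def restCopies {r : ℕ} {V : Type*} [Fintype V] (G : SimpleGraph V) (A : Finset V)
    (P : Σ _ : Finset (Fin r), Fin r) : Finset (Fin r → V) :=
  {ψ | ψ ∈ cop (cycleGraph r) G ∧ (∀ x, (x ∈ P.1 ∧ x ≠ P.2) ↔ ψ x ∈ commonNbrs G A) ∧
    ψ P.2 ∈ restSet G A ∧ (∀ i ∈ P.1, i ≠ P.2 → ¬ G.Adj (ψ P.2) (ψ i)) ∧
    ∀ x ∉ P.1, ∃ i ∈ P.1, i ≠ P.2 ∧ G.Adj (ψ x) (ψ i)}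

/-- The last two clauses of `restCopies` recover the pair. If `p ≠ q`, then `q ∉ I`, so the image of
`q` is adjacent to some image from `I` lying in the common neighbourhood. That image also comes from
`J`, where it has to be a nonneighbour. -/
lemma restCopies_disjoint {r : ℕ} {V : Type*} [Fintype V] (G : SimpleGraph V) (A : Finset V)
    {P Q : Σ _ : Finset (Fin r), Fin r} (hP : P.2 ∈ P.1) (hQ : Q.2 ∈ Q.1) (hPQ : P ≠ Q) :
    Disjoint (restCopies G A P) (restCopies G A Q) := by
  obtain ⟨I, p⟩ := P
  obtain ⟨J, q⟩ := Q
  rw [Finset.disjoint_left]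
  intro ψ h1 h2
  simp only [restCopies, mem_filter, mem_univ, true_and] at h1 h2 hP hQ
  obtain ⟨-, hI1, -, -, hI4⟩ := h1
  obtain ⟨-, hJ1, hJ2, hJ3, -⟩ := h2
  by_cases hpq : p = q
  · subst hpq
    apply hPQ
    congr 1
    ext x
    by_cases hx : x = p
    · subst hx; simp [hP, hQ]
    · have := (hI1 x).trans (hJ1 x).symm
      simpa [hx] using this
  · have hq : q ∉ I := fun h => (mem_restSet.1 hJ2).2 ((hI1 q).1 ⟨h, Ne.symm hpq⟩)
    obtain ⟨i, hi, hip, hadj⟩ := hI4 q hq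
    obtain ⟨hi', hiq⟩ := (hJ1 i).2 ((hI1 i).1 ⟨hi, hip⟩)
    exact hJ3 i hi' hiq hadj

/-- The extra 1 is the point. A gap avoiding `p` has both ends in the common neighbourhood of `A`,
so its slot is `A`. The gap starting at `p` has another slot, since the image of `p` is not adjacent
to all of `A`. Unequal slots beat the greedy bound. -/
lemma le_card_restCopies {r m s : ℕ} (hr : 6 ≤ r) (hm : 3 ≤ m)
    (hrm : r ≤ 2 * m + 1) (hs : 2 ≤ s) (hk : r - m ≤ s - 2) {V : Type} [Fintype V]
    {G : SimpleGraph V} (hG : IsSaturated (completeGraph (Fin s)) G)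
    {A : Finset V} (hA : #A = s - 2) (hclique : ∀ x ∈ A, ∀ y ∈ A, x ≠ y → G.Adj x y) {q : ℕ}
    (hqm : m - 1 ≤ q)
    (hq : ∀ w ∈ restSet G A, q ≤ #{u ∈ commonNbrs G A | ¬ G.Adj w u})
    {I : Finset (Fin r)} (hI : I ∈ indepSets r m) {p : Fin r} (hp : p ∈ I) :
    #(restSet G A) * q.descFactorial (m - 1) * ((s - 2).descFactorial (r - m) + 1) ≤
      #(restCopies G A ⟨I, p⟩) := by
  obtain ⟨S, hS, hSA⟩ := exists_isSelector hG hA hclique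
  set U := commonNbrs G A with hU
  set R := restSet G A with hR
  set D := cycleGaps hr hrm hI
  set X : V → {x // x ∈ I} → Finset V := fun w i =>
    if i.1 = p then {w} else {u ∈ U | ¬ G.Adj w u} with hX
  set F : Finset ({x // x ∈ I} → V) := R.biUnion fun w => sdr (X w) with hF
  have hcard : Fintype.card {x // x ∈ I} = m := by
    rw [Fintype.card_coe, (mem_indepSets.1 hI).1]
  have hwU : ∀ w ∈ R, w ∉ U := fun w hw => (mem_restSet.1 hw).2
  have hFcard : #R * q.descFactorial (m - 1) ≤ #F := by
    rw [hF, card_biUnion]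
    · rw [← smul_eq_mul, ← sum_const]
      refine sum_le_sum fun w hw => ?_
      rw [card_sdr_eq_sum (X w) ⟨p, hp⟩]
      have hXp : X w ⟨p, hp⟩ = {w} := by simp [hX]
      rw [hXp, sum_singleton]
      refine descFactorial_le_card_sdr (m - 1) q _ ?_ hqm fun j => ?_
      · rw [card_subtype_ne, hcard]
      · have hj : j.1.1 ≠ p := fun h => j.2 (Subtype.ext h)
        simp only [hX, hj, if_false]
        rw [erase_eq_of_notMem]
        · exact hq w hw
        · exact fun h => hwU w hw (mem_filter.1 h).1
    · intro w _ w' _ hww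
      change Disjoint (sdr (X w)) (sdr (X w'))
      rw [Finset.disjoint_left]
      intro f hf hf'
      have h1 := (mem_sdr.1 hf).1 ⟨p, hp⟩
      have h2 := (mem_sdr.1 hf').1 ⟨p, hp⟩
      simp only [hX, if_true, mem_singleton] at h1 h2
      exact hww (h1.symm.trans h2)
  have hFmem : ∀ f ∈ F, f ⟨p, hp⟩ ∈ R ∧ Injective f ∧
      ∀ i : {x // x ∈ I}, i.1 ≠ p → f i ∈ U ∧ ¬ G.Adj (f ⟨p, hp⟩) (f i) := by
    intro f hf
    obtain ⟨w, hw, hf⟩ := mem_biUnion.1 hf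
    obtain ⟨h1, h2⟩ := mem_sdr.1 hf
    have h3 : f ⟨p, hp⟩ = w := by simpa [hX] using h1 ⟨p, hp⟩
    refine ⟨h3 ▸ hw, h2, fun i hi => ?_⟩
    have := h1 i
    simp only [hX, hi, if_false, mem_filter] at this
    rw [h3]
    exact this
  have hUind : ∀ u ∈ U, ∀ v ∈ U, ¬ G.Adj u v := fun u hu v hv =>
    not_adj_of_mem_commonNbrs hs hG hA hclique hu hv
  have hFind : ∀ f ∈ F, IsIndepTuple G f := by
    intro f hf i j hij
    obtain ⟨h1, h2, h3⟩ := hFmem f hf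
    refine ⟨fun h => hij (h2 h), ?_⟩
    by_cases hi : i.1 = p
    · have hi' : i = ⟨p, hp⟩ := Subtype.ext hi
      rw [hi']
      exact (h3 j fun h => hij (Subtype.ext (hi.trans h.symm))).2
    · by_cases hj : j.1 = p
      · have hj' : j = ⟨p, hp⟩ := Subtype.ext hj
        rw [hj']
        exact fun h => (h3 i hi).2 h.symm
      · exact hUind _ (h3 i hi).1 _ (h3 j hj).1
  have hsdr : ∀ f ∈ F, (s - 2).descFactorial (r - m) + 1 ≤ #(sdr (slots D S f)) := by
    intro f hf
    have hind := hFind f hf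
    obtain ⟨h1, h2, h3⟩ := hFmem f hf
    have hT : ∀ x, #(slots D S f x) = s - 2 := fun x =>
      (hS _ _ (hind _ _ (D.ne x)).1 (hind _ _ (D.ne x)).2).1
    obtain ⟨x, hx⟩ := exists_gap_left hr hrm hI ⟨p, hp⟩
    obtain ⟨y, hy1, hy2⟩ := exists_gap_avoiding hr hm hrm hI ⟨p, hp⟩
    have hM : Fintype.card {x // x ∉ I} = r - m := by
      rw [card_notMem_subtype, (mem_indepSets.1 hI).1]
    have hne : slots D S f x ≠ slots D S f y := by
      have hyA : slots D S f y = A := hSA _ _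
        (mem_commonNbrs.1 (h3 _ fun h => hy1 (Subtype.ext h)).1)
        (mem_commonNbrs.1 (h3 _ fun h => hy2 (Subtype.ext h)).1)
      rw [hyA]
      intro h
      refine hwU _ h1 (mem_commonNbrs.2 fun a ha => ?_)
      have h4 := (hS _ _ (hind _ _ (D.ne x)).1 (hind _ _ (D.ne x)).2).2.1 a
        (by change a ∈ slots D S f x; rwa [h])
      have h5 := h4.1
      rwa [show D.l x = ⟨p, hp⟩ from hx] at h5
    rw [← hM]
    exact descFactorial_lt_card_sdr_of_ne _ (by rw [hM]; exact hk) hT hne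
  have hglue := card_filter_glue I F fun f => sdr (slots D S f)
  calc #R * q.descFactorial (m - 1) * ((s - 2).descFactorial (r - m) + 1)
      ≤ #F * ((s - 2).descFactorial (r - m) + 1) := Nat.mul_le_mul_right _ hFcard
    _ = ∑ f ∈ F, ((s - 2).descFactorial (r - m) + 1) := by rw [sum_const, smul_eq_mul]
    _ ≤ ∑ f ∈ F, #(sdr (slots D S f)) := sum_le_sum hsdr
    _ = _ := hglue.symm
    _ ≤ _ := card_le_card fun ψ hψ => ?_
  rw [mem_filter] at hψ
  obtain ⟨-, hf, hg⟩ := hψ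
  have hind := hFind _ hf
  obtain ⟨h1, h2, h3⟩ := hFmem _ hf
  have hadj : ∀ x ∉ I, ∃ i ∈ I, i ≠ p ∧ G.Adj (ψ x) (ψ i) := by
    intro x hx
    have h4 := (hS _ _ (hind _ _ (D.ne ⟨x, hx⟩)).1 (hind _ _ (D.ne ⟨x, hx⟩)).2).2.1 _
      ((mem_sdr.1 hg).1 ⟨x, hx⟩)
    by_cases hlp : (D.l ⟨x, hx⟩).1 = p
    · refine ⟨D.r ⟨x, hx⟩, (D.r ⟨x, hx⟩).2, fun h => D.ne ⟨x, hx⟩ (Subtype.ext ?_), h4.2.symm⟩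
      rw [hlp, h]
    · exact ⟨D.l ⟨x, hx⟩, (D.l ⟨x, hx⟩).2, hlp, h4.1.symm⟩
  rw [restCopies, mem_filter]
  refine ⟨mem_univ _, mem_cop_of_isIndepTuple D (not_adj_of_mem_indepSets (by omega) hI) hS hind hg,
    fun x => ⟨fun h => (h3 ⟨x, h.1⟩ h.2).1, fun h => ?_⟩, h1, fun i hi hip => (h3 ⟨i, hi⟩ hip).2,
    hadj⟩
  have hxI : x ∈ I := by
    by_contra hx
    obtain ⟨i, hi, hip, hai⟩ := hadj x hx
    exact hUind _ h _ (h3 ⟨i, hi⟩ hip).1 hai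
  refine ⟨hxI, ?_⟩
  rintro rfl
  exact hwU _ h1 h

lemma le_card_cop_meeting {r m s : ℕ} (hr : 6 ≤ r) (hm : 3 ≤ m)
    (hrm : r ≤ 2 * m + 1) (hs : 2 ≤ s) (hk : r - m ≤ s - 2) {V : Type} [Fintype V]
    {G : SimpleGraph V} (hG : IsSaturated (completeGraph (Fin s)) G)
    {A : Finset V} (hA : #A = s - 2) (hclique : ∀ x ∈ A, ∀ y ∈ A, x ≠ y → G.Adj x y) {q : ℕ}
    (hqm : m - 1 ≤ q)
    (hq : ∀ w ∈ restSet G A, q ≤ #{u ∈ commonNbrs G A | ¬ G.Adj w u}) :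
    #(indepSets r m) * (m *
      (#(restSet G A) * q.descFactorial (m - 1) * ((s - 2).descFactorial (r - m) + 1))) ≤
      #{ψ ∈ cop (cycleGraph r) G | ∃ x, ψ x ∈ restSet G A} := by
  set N := #(restSet G A) * q.descFactorial (m - 1) * ((s - 2).descFactorial (r - m) + 1)
  calc #(indepSets r m) * (m * N) = ∑ P ∈ (indepSets r m).sigma fun I => I, N := by
        rw [sum_const, card_sigma, smul_eq_mul,
          sum_congr rfl fun I hI => (mem_indepSets.1 hI).1, sum_const, smul_eq_mul, mul_assoc]
    _ ≤ ∑ P ∈ (indepSets r m).sigma fun I => I, #(restCopies G A P) := by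
        refine sum_le_sum fun P hP => ?_
        rw [mem_sigma] at hP
        exact le_card_restCopies hr hm hrm hs hk hG hA hclique hqm hq hP.1 hP.2
    _ = #(((indepSets r m).sigma fun I => I).biUnion (restCopies G A)) := by
        rw [card_biUnion]
        intro P hP Q hQ hPQ
        exact restCopies_disjoint G A (mem_sigma.1 hP).2 (mem_sigma.1 hQ).2 hPQ
    _ ≤ _ := by
        refine card_le_card fun ψ hψ => ?_
        obtain ⟨P, -, hψ⟩ := mem_biUnion.1 hψ
        rw [restCopies, mem_filter] at hψ
        exact mem_filter.2 ⟨hψ.2.1, P.2, hψ.2.2.2.1⟩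

/-- On `A` together with its common neighbours, every pair meeting `A` is already an edge of `G`. -/
lemma card_cop_avoiding_le {r : ℕ} {V : Type*} [Fintype V] {G : SimpleGraph V} {A : Finset V}
    (hclique : ∀ x ∈ A, ∀ y ∈ A, x ≠ y → G.Adj x y) :
    #{ψ ∈ cop (cycleGraph r) (hubGraph A) | ¬ ∃ x, ψ x ∈ restSet G A} ≤
      #{ψ ∈ cop (cycleGraph r) G | ¬ ∃ x, ψ x ∈ restSet G A} := by
  refine card_le_card fun ψ hψ => ?_
  rw [mem_filter, mem_cop] at hψ ⊢
  obtain ⟨⟨h1, h2⟩, h3⟩ := hψ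
  have h4 : ∀ x, ψ x ∈ A ∨ ψ x ∈ commonNbrs G A := fun x => by
    by_contra h
    push Not at h
    exact h3 ⟨x, mem_restSet.2 h⟩
  have key : ∀ x y, ψ x ≠ ψ y → ψ x ∈ A → G.Adj (ψ x) (ψ y) := by
    intro x y hxy hx
    rcases h4 y with hy | hy
    · exact hclique _ hx _ hy hxy
    · exact (mem_commonNbrs.1 hy _ hx).symm
  refine ⟨⟨h1, fun x y hxy => ?_⟩, h3⟩
  obtain ⟨h5, h6 | h6⟩ := h2 x y hxy
  · exact key x y h5 h6
  · exact (key y x h5.symm h6).symm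

set_option maxHeartbeats 800000 in
/-- A saturated graph close to the extremal one, but different from it, has more cycles. -/
theorem exists_card_cop_hubGraph_lt {r m s : ℕ} (hr : 6 ≤ r) (hm : 3 ≤ m)
    (hrm : r ≤ 2 * m + 1) (hrm' : 2 * m ≤ r) (hs : 3 ≤ s) (hk : r - m ≤ s - 2) :
    ∃ δ : ℝ, 0 < δ ∧ ∃ n₀ : ℕ, ∀ (V : Type) [Fintype V] (G : SimpleGraph V) (A : Finset V),
      n₀ ≤ Fintype.card V → IsSaturated (completeGraph (Fin s)) G → #A = s - 2 →
      (∀ x ∈ A, ∀ y ∈ A, x ≠ y → G.Adj x y) →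
      (1 - δ) * Fintype.card V ≤ #(commonNbrs G A) → (restSet G A).Nonempty →
      #(cop (cycleGraph r) (hubGraph A)) < #(cop (cycleGraph r) G) := by
  set D : ℕ := (s - 2).descFactorial (r - m) with hD
  set P : ℕ := #(indepSets r m) with hP
  have hP1 : 1 ≤ P := card_pos.2 ⟨_, evens_mem_indepSets hrm'⟩
  set C : ℕ := 2 ^ r * (m * (s - 2) ^ r) with hC
  -- With this η the loss 3ηm(D+1) is 3/8, less than half of the gain of one system per tuple.
  set η : ℝ := 1 / (8 * m * (D + 1)) with hη
  have hm0 : (3 : ℝ) ≤ m := by exact_mod_cast hm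
  have hD0 : (0 : ℝ) ≤ D := Nat.cast_nonneg _
  have hη0 : 0 < η := by positivity
  have hηeq : η * (8 * m * (D + 1)) = 1 := by rw [hη]; field_simp
  have hη1 : η * m * (D + 1) = 1 / 8 := by linarith
  have hη2 : η ≤ 1 / 24 := by nlinarith [mul_nonneg (mul_pos hη0 (by linarith : (0:ℝ) < m)).le hD0]
  set C' : ℝ := P * m * D + C with hC'
  have hC'0 : 0 ≤ C' := by positivity
  -- The second entry makes δC'n^m, which bounds the hub graph's cycles through the at most δn
  -- remaining vertices, smaller than the (ηn/2)^m cycles through one vertex with ηn suitable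
  -- neighbours.
  set δ : ℝ := min η ((η / 2) ^ m / (C' + 1)) with hδ
  have hδ0 : 0 < δ := lt_min hη0 (by positivity)
  have hδη : δ ≤ η := min_le_left _ _
  have hδC : δ * C' < (η / 2) ^ m := by
    have h1 : δ ≤ (η / 2) ^ m / (C' + 1) := min_le_right _ _
    rw [le_div_iff₀ (by positivity)] at h1
    nlinarith
  refine ⟨δ, hδ0, ⌈2 * m / η⌉₊ + 2 * C + 1, ?_⟩
  intro V _ G A hn hG hA hclique hU hR
  have : Nonempty V := ⟨hR.choose⟩
  set n : ℕ := Fintype.card V with hn'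
  have hn1 : 2 * m / η ≤ (n : ℝ) := by
    refine (Nat.le_ceil _).trans ?_
    exact_mod_cast (by omega : ⌈2 * m / η⌉₊ ≤ n)
  have hnη : 2 * m ≤ η * n := by
    rw [div_le_iff₀ hη0] at hn1
    linarith
  have hnC : (2 * C : ℝ) < n := by exact_mod_cast (by omega : 2 * C < n)
  have hn0 : (0 : ℝ) < n := by
    have : (0 : ℝ) ≤ C := Nat.cast_nonneg _
    linarith
  have hn1' : (1 : ℝ) ≤ n := by exact_mod_cast (by omega : 1 ≤ n)
  set R := #(restSet G A) with hRdef
  have hR1 : 1 ≤ R := card_pos.2 hR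
  have hRn : (R : ℝ) ≤ δ * n := by
    have h1 : R + #(commonNbrs G A) ≤ n := by
      rw [hRdef, ← card_union_of_disjoint]
      · exact card_le_univ _
      · rw [Finset.disjoint_left]
        exact fun v hv => (mem_restSet.1 hv).2
    have h2 : (R : ℝ) + #(commonNbrs G A) ≤ n := by exact_mod_cast h1
    linarith
  suffices hmeet : #{ψ ∈ cop (cycleGraph r) (hubGraph A) | ∃ x, ψ x ∈ restSet G A} <
      #{ψ ∈ cop (cycleGraph r) G | ∃ x, ψ x ∈ restSet G A} by
    have h1 := card_cop_avoiding_le (r := r) hclique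
    have h2 := card_filter_add_card_filter_not (s := cop (cycleGraph r) (hubGraph A))
      (fun ψ => ∃ x, ψ x ∈ restSet G A)
    have h3 := card_filter_add_card_filter_not (s := cop (cycleGraph r) G)
      (fun ψ => ∃ x, ψ x ∈ restSet G A)
    omega
  have hup := card_cop_meeting_le (r := r) (m := m) (k := s - 2) (by omega) hrm (by omega)
    (E := hubGraph A) (R := restSet G A) hA (fun x y h => h.2) (fun x hx => (mem_restSet.1 hx).1)
  rw [← hP, ← hD, ← hRdef, ← hn'] at hup
  have hup' : (#{ψ ∈ cop (cycleGraph r) (hubGraph A) | ∃ x, ψ x ∈ restSet G A} : ℝ) ≤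
      P * m * D * (R * (n : ℝ) ^ (m - 1)) + C * (R * (n : ℝ) ^ (m - 2)) := by
    have h1 : (#{ψ ∈ cop (cycleGraph r) (hubGraph A) | ∃ x, ψ x ∈ restSet G A} : ℝ) ≤
      ((P * (m * (R * n ^ (m - 1) * D)) +
        2 ^ r * (m * (R * n ^ (m - 2) * (s - 2) ^ r)) : ℕ) : ℝ) := by
      exact_mod_cast hup
    refine h1.trans (le_of_eq ?_)
    rw [hC]
    push_cast
    ring
  have hpow1 : (n : ℝ) ^ (m - 1) = n * (n : ℝ) ^ (m - 2) := by
    rw [← pow_succ']; congr 1; omega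
  have hpow2 : (n : ℝ) ^ m = n * (n : ℝ) ^ (m - 1) := by
    rw [← pow_succ']; congr 1; omega
  have hR0 : (1 : ℝ) ≤ R := by exact_mod_cast hR1
  -- Either one remaining vertex has linearly many neighbours among the common neighbours and alone
  -- carries order n^m cycles, or all have few, and each contributes about (D+1)/D times what it
  -- does in the hub graph.
  by_cases hcase : ∃ w ∈ restSet G A, η * n ≤ #{u ∈ commonNbrs G A | G.Adj w u}
  · obtain ⟨w, hw, hwη⟩ := hcase
    have h1 := descFactorial_le_card_cop_meeting hr hm hrm hrm' hk hA hclique hw le_rfl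
    have h2 := sub_pow_le_descFactorial (m := m) (by linarith) hwη
    have h3 : (η / 2 * n) ^ m ≤ (η * n - m) ^ m := by
      apply pow_le_pow_left₀ (by positivity)
      linarith
    have h4 : P * m * D * (R * (n : ℝ) ^ (m - 1)) + C * (R * (n : ℝ) ^ (m - 2)) ≤
        δ * C' * (n : ℝ) ^ m := by
      have h5 : (n : ℝ) ^ (m - 2) ≤ (n : ℝ) ^ (m - 1) := pow_le_pow_right₀ hn1' (by omega)
      calc _ ≤ P * m * D * (R * (n : ℝ) ^ (m - 1)) + C * (R * (n : ℝ) ^ (m - 1)) := by gcongr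
        _ = C' * (R * (n : ℝ) ^ (m - 1)) := by rw [hC']; ring
        _ ≤ C' * (δ * n * (n : ℝ) ^ (m - 1)) := by gcongr
        _ = _ := by rw [hpow2]; ring
    have h5 : δ * C' * (n : ℝ) ^ m < (η / 2 * n) ^ m := by
      rw [mul_pow]
      exact mul_lt_mul_of_pos_right hδC (by positivity)
    have h6 : ((#{u ∈ commonNbrs G A | G.Adj w u}).descFactorial m : ℝ) ≤
      #{ψ ∈ cop (cycleGraph r) G | ∃ x, ψ x ∈ restSet G A} := by exact_mod_cast h1
    exact_mod_cast (by linarith :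
      (#{ψ ∈ cop (cycleGraph r) (hubGraph A) | ∃ x, ψ x ∈ restSet G A} : ℝ) <
      #{ψ ∈ cop (cycleGraph r) G | ∃ x, ψ x ∈ restSet G A})
  · push Not at hcase
    have hq : ∀ w ∈ restSet G A,
        ⌈(1 - 2 * η) * n⌉₊ ≤ #{u ∈ commonNbrs G A | ¬ G.Adj w u} := by
      intro w hw
      rw [Nat.ceil_le]
      have h1 := hcase w hw
      have h2 := card_filter_add_card_filter_not (s := commonNbrs G A) (fun u => G.Adj w u)
      have h3 : (#{u ∈ commonNbrs G A | G.Adj w u} : ℝ) +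
        #{u ∈ commonNbrs G A | ¬ G.Adj w u} = #(commonNbrs G A) := by exact_mod_cast h2
      have h4 : δ * n ≤ η * n := mul_le_mul_of_nonneg_right hδη hn0.le
      linarith
    have hηn : η * n ≤ 1 / 24 * n := mul_le_mul_of_nonneg_right hη2 hn0.le
    have hm1 : ((m - 1 : ℕ) : ℝ) = m - 1 := by
      rw [Nat.cast_sub (by omega)]; simp
    have hmq : ((m - 1 : ℕ) : ℝ) ≤ (1 - 2 * η) * n := by
      rw [hm1]; linarith
    have h1 := le_card_cop_meeting hr hm hrm (by omega) hk hG hA hclique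
      (by exact_mod_cast hmq.trans (Nat.le_ceil _)) hq
    rw [← hP, ← hD, ← hRdef] at h1
    have h2 := sub_pow_le_descFactorial hmq (Nat.le_ceil _)
    have h3 : ((1 - 3 * η) * n) ^ (m - 1) ≤ ((1 - 2 * η) * n - (m - 1 : ℕ)) ^ (m - 1) := by
      apply pow_le_pow_left₀
      · apply mul_nonneg (by linarith) hn0.le
      · rw [hm1]; linarith
    have h4 : 1 - 3 * η * m ≤ (1 - 3 * η) ^ (m - 1) := by
      have := one_add_mul_le_pow (show (-2 : ℝ) ≤ -(3 * η) by linarith) (m - 1)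
      rw [hm1] at this
      have h5 : (1 - 3 * η) ^ (m - 1) = (1 + -(3 * η)) ^ (m - 1) := by ring
      rw [h5]
      linarith
    set Q : ℝ := ((⌈(1 - 2 * η) * n⌉₊).descFactorial (m - 1) : ℝ) with hQ
    have h5 : (1 - 3 * η * m) * (n : ℝ) ^ (m - 1) ≤ Q := by
      refine le_trans ?_ (h3.trans h2)
      rw [mul_pow]
      gcongr
    have h6 : (D + 1 / 2) * (n : ℝ) ^ (m - 1) ≤ Q * (D + 1) := by
      calc (D + 1 / 2) * (n : ℝ) ^ (m - 1)
          ≤ ((1 - 3 * η * m) * (n : ℝ) ^ (m - 1)) * (D + 1) := by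
            have h7 : (D + 1 / 2 : ℝ) ≤ (1 - 3 * η * m) * (D + 1) := by linarith
            have h8 : (0 : ℝ) ≤ (n : ℝ) ^ (m - 1) := by positivity
            nlinarith
        _ ≤ _ := by gcongr
    have h7 : (P : ℝ) * (m * (R * Q * (D + 1))) ≤
        #{ψ ∈ cop (cycleGraph r) G | ∃ x, ψ x ∈ restSet G A} := by
      rw [hQ]; exact_mod_cast h1
    have h8 : (P : ℝ) * m * R * ((D + 1 / 2) * (n : ℝ) ^ (m - 1)) ≤
        (P : ℝ) * (m * (R * Q * (D + 1))) := by
      calc (P : ℝ) * m * R * ((D + 1 / 2) * (n : ℝ) ^ (m - 1))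
          ≤ (P : ℝ) * m * R * (Q * (D + 1)) := by gcongr
        _ = _ := by ring
    have hP0 : (1 : ℝ) ≤ P := by exact_mod_cast hP1
    have h9 : C * (R * (n : ℝ) ^ (m - 2)) < P * m * R * (1 / 2 * (n : ℝ) ^ (m - 1)) := by
      have h10 : (1 : ℝ) ≤ P * m := by nlinarith
      have h11 : (0 : ℝ) < R * (n : ℝ) ^ (m - 2) := by positivity
      rw [hpow1]
      calc (C : ℝ) * (R * (n : ℝ) ^ (m - 2)) < (n / 2) * (R * (n : ℝ) ^ (m - 2)) := by
            apply mul_lt_mul_of_pos_right _ h11; linarith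
        _ = 1 * ((n / 2) * (R * (n : ℝ) ^ (m - 2))) := by ring
        _ ≤ (P * m) * ((n / 2) * (R * (n : ℝ) ^ (m - 2))) := by gcongr
        _ = _ := by ring
    have h10 : (P : ℝ) * m * R * ((D + 1 / 2) * (n : ℝ) ^ (m - 1)) =
        P * m * D * (R * (n : ℝ) ^ (m - 1)) + P * m * R * (1 / 2 * (n : ℝ) ^ (m - 1)) := by ring
    exact_mod_cast (by linarith :
      (#{ψ ∈ cop (cycleGraph r) (hubGraph A) | ∃ x, ψ x ∈ restSet G A} : ℝ) <
      #{ψ ∈ cop (cycleGraph r) G | ∃ x, ψ x ∈ restSet G A})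

/-! ### Many vertices of linear degree force many cycles. -/

lemma sub_le_cast_tsub (a b : ℕ) : (a : ℝ) - b ≤ ((a - b : ℕ) : ℝ) := by
  rcases le_total b a with h | h
  · rw [Nat.cast_sub h]
  · rw [Nat.sub_eq_zero_of_le h]
    have : (a : ℝ) ≤ b := by exact_mod_cast h
    simpa using this

/-- Power mean inequality after bounding the descending factorial below by (d - p)^p; the surplus `p
* #s` in the hypothesis pays for the shift. -/
lemma pow_div_le_sum_descFactorial {X : Type*} (s : Finset X) (d : X → ℕ) {p : ℕ} (hp : 1 ≤ p)
    {T N : ℝ} (hT : 0 ≤ T) (hTd : T + p * #s ≤ ∑ i ∈ s, (d i : ℝ)) (hsN : (#s : ℝ) ≤ N) :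
    T ^ p / N ^ (p - 1) ≤ ∑ i ∈ s, ((d i).descFactorial p : ℝ) := by
  rcases s.eq_empty_or_nonempty with rfl | hs
  · simp only [card_empty, Nat.cast_zero, mul_zero, add_zero, sum_empty] at hTd ⊢
    have : T = 0 := le_antisymm hTd hT
    rw [this, zero_pow (by omega), zero_div]
  have hs0 : (0 : ℝ) < #s := by exact_mod_cast card_pos.2 hs
  obtain ⟨q, rfl⟩ : ∃ q, p = q + 1 := ⟨p - 1, by omega⟩
  have h1 : T ≤ ∑ i ∈ s, ((d i - (q + 1) : ℕ) : ℝ) := by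
    calc T ≤ ∑ i ∈ s, ((d i : ℝ) - (q + 1 : ℕ)) := by
          rw [sum_sub_distrib, sum_const, nsmul_eq_mul]
          linarith
      _ ≤ _ := sum_le_sum fun i _ => sub_le_cast_tsub _ _
  have h2 := pow_sum_div_card_le_sum_pow (s := s) (f := fun i => ((d i - (q + 1) : ℕ) : ℝ))
    (fun i _ => Nat.cast_nonneg _) q
  calc T ^ (q + 1) / N ^ (q + 1 - 1) ≤ T ^ (q + 1) / (#s : ℝ) ^ q := by
        rw [Nat.add_sub_cancel]
        gcongr
    _ ≤ (∑ i ∈ s, ((d i - (q + 1) : ℕ) : ℝ)) ^ (q + 1) / (#s : ℝ) ^ q := by gcongr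
    _ ≤ ∑ i ∈ s, ((d i - (q + 1) : ℕ) : ℝ) ^ (q + 1) := h2
    _ ≤ _ := sum_le_sum fun i _ => by
      have h3 : (d i - (q + 1)) ^ (q + 1) ≤ (d i).descFactorial (q + 1) :=
        (Nat.pow_le_pow_left (by omega) _).trans (Nat.pow_sub_le_descFactorial (d i) (q + 1))
      exact_mod_cast h3

/-- The vertices of degree at least `ε n`. -/
noncomputable def bigSet {V : Type*} [Fintype V] (G : SimpleGraph V) (ε : ℝ) : Finset V :=
  {v | ε * Fintype.card V ≤ #{b | G.Adj v b}}

lemma mem_bigSet {V : Type*} [Fintype V] {G : SimpleGraph V} {ε : ℝ} {v : V} :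
    v ∈ bigSet G ε ↔ ε * Fintype.card V ≤ #{b | G.Adj v b} := by
  simp [bigSet]

/-- Injective functions mapping `I` into `B`, and mapping all pairs between `I` and its
complement to edges. -/
noncomputable def bicliques {r : ℕ} {V : Type*} [Fintype V] (G : SimpleGraph V) (B : Finset V)
    (I : Finset (Fin r)) : Finset (Fin r → V) :=
  {h | (fun x : {x // x ∈ I} => h x) ∈ sdr (fun _ : {x // x ∈ I} => B) ∧
    (fun x : {x // x ∉ I} => h x) ∈
      sdr (fun _ : {x // x ∉ I} => ({v | ∀ i : {x // x ∈ I}, G.Adj (h i) v} : Finset V))}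

lemma mem_bicliques {r : ℕ} {V : Type*} [Fintype V] {G : SimpleGraph V} {B : Finset V}
    {I : Finset (Fin r)} {h : Fin r → V} (hh : h ∈ bicliques G B I) :
    Injective h ∧ (∀ x ∈ I, h x ∈ B) ∧ ∀ x ∈ I, ∀ y ∉ I, G.Adj (h x) (h y) := by
  rw [bicliques, mem_filter, mem_sdr, mem_sdr] at hh
  obtain ⟨-, ⟨h1, h2⟩, h3, h4⟩ := hh
  have h5 : ∀ x ∈ I, ∀ y ∉ I, G.Adj (h x) (h y) := fun x hx y hy => by
    have := h3 ⟨y, hy⟩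
    rw [mem_filter] at this
    exact this.2 ⟨x, hx⟩
  refine ⟨fun x y hxy => ?_, fun x hx => h1 ⟨x, hx⟩, h5⟩
  by_cases hx : x ∈ I <;> by_cases hy : y ∈ I
  · exact congrArg Subtype.val (@h2 ⟨x, hx⟩ ⟨y, hy⟩ hxy)
  · exact absurd hxy (h5 x hx y hy).ne
  · exact absurd hxy.symm (h5 y hy x hx).ne
  · exact congrArg Subtype.val (@h4 ⟨x, hx⟩ ⟨y, hy⟩ hxy)

/-- Kővári–Sós–Turán counting with two uses of convexity: over vertices, to find many `m`-tuples of
`B` with a common neighbour, then over these tuples, to find many `M`-tuples of common neighbours.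
Keeping the power of `#B` explicit lets a large `B` beat any constant. -/
lemma le_card_bicliques {r m M : ℕ} (hm : 1 ≤ m) (hM : 1 ≤ M) {ε : ℝ} (hε : 0 < ε) {V : Type*}
    [Fintype V] [Nonempty V] (G : SimpleGraph V) {B : Finset V} (hB : B ⊆ bigSet G ε)
    {I : Finset (Fin r)} (hI : #I = m) (hIM : r - #I = M) (hBm : 2 * m ≤ #B * ε)
    (hn : 2 * M ≤ (ε / 2) ^ m * Fintype.card V) :
    ((ε / 2) ^ m / 2) ^ M * (#B : ℝ) ^ m * (Fintype.card V : ℝ) ^ M ≤ #(bicliques G B I) := by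
  set n := Fintype.card V with hn'
  have hn0 : (0 : ℝ) < n := by exact_mod_cast Fintype.card_pos
  have hm0 : (1 : ℝ) ≤ m := by exact_mod_cast hm
  set K := #B with hK
  have hK0 : (0 : ℝ) < K := by
    by_contra h
    have : (K : ℝ) * ε ≤ 0 := mul_nonpos_of_nonpos_of_nonneg (by linarith) hε.le
    linarith
  have hcα : Fintype.card {x // x ∈ I} = m := by rw [Fintype.card_coe, hI]
  have hcβ : Fintype.card {x // x ∉ I} = M := by rw [card_notMem_subtype, hIM]
  have hglue := card_filter_glue I (sdr fun _ : {x // x ∈ I} => B)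
    (fun f => sdr (fun _ : {x // x ∉ I} => ({v | ∀ i, G.Adj (f i) v} : Finset V)))
  have hΩ : (#(bicliques G B I) : ℝ) = ∑ f ∈ sdr (fun _ : {x // x ∈ I} => B),
      ((#{v | ∀ i, G.Adj (f i) v}).descFactorial M : ℝ) := by
    rw [bicliques, hglue]
    push_cast
    refine sum_congr rfl fun f _ => ?_
    rw [card_sdr_const, hcβ]
  have hdeg : (K * (ε * n) : ℝ) ≤ ∑ v : V, (#{b ∈ B | G.Adj b v} : ℝ) := by
    have h1 : ∑ v : V, #{b ∈ B | G.Adj b v} = ∑ b ∈ B, #{v | G.Adj b v} :=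
      (sum_card_bipartiteAbove_eq_sum_card_bipartiteBelow (fun (v : V) (b : V) => G.Adj b v))
    have h2 : ∑ v : V, (#{b ∈ B | G.Adj b v} : ℝ) = ∑ b ∈ B, (#{v | G.Adj b v} : ℝ) := by
      exact_mod_cast h1
    rw [h2, hK, ← nsmul_eq_mul, ← sum_const]
    exact sum_le_sum fun b hb => mem_bigSet.1 (hB hb)
  have hfirst := pow_div_le_sum_descFactorial (univ : Finset V) (fun v => #{b ∈ B | G.Adj b v})
    hm (T := K * ε / 2 * n) (N := n) (by positivity) (by
      refine le_trans ?_ hdeg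
      rw [card_univ, ← hn']
      nlinarith) (by rw [card_univ])
  have hswap : ∑ v : V, (#{b ∈ B | G.Adj b v}).descFactorial m =
      ∑ f ∈ sdr (fun _ : {x // x ∈ I} => B), #{v | ∀ i, G.Adj (f i) v} := by
    have h1 := sum_card_bipartiteAbove_eq_sum_card_bipartiteBelow (s := (univ : Finset V))
      (t := sdr (fun _ : {x // x ∈ I} => B)) (fun v f => ∀ i, G.Adj (f i) v)
    simp only [bipartiteAbove, bipartiteBelow] at h1
    rw [← h1]
    refine sum_congr rfl fun v _ => ?_
    rw [← hcα, ← card_sdr_const]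
    congr 1
    ext f
    simp only [mem_filter, mem_sdr]
    exact ⟨fun h => ⟨⟨fun i => (h.1 i).1, h.2⟩, fun i => (h.1 i).2⟩,
      fun h => ⟨fun i => ⟨h.1.1 i, h.2 i⟩, h.1.2⟩⟩
  have hpown : (n : ℝ) ^ m = n * (n : ℝ) ^ (m - 1) := by
    rw [← pow_succ']; congr 1; omega
  have hpowK : ((K : ℝ) ^ m) ^ M = (K : ℝ) ^ m * ((K : ℝ) ^ m) ^ (M - 1) := by
    rw [← pow_succ']; congr 1; omega
  have hsum : (K : ℝ) ^ m * (ε / 2) ^ m * n ≤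
      ∑ f ∈ sdr (fun _ : {x // x ∈ I} => B), (#{v | ∀ i, G.Adj (f i) v} : ℝ) := by
    have h1 : ((∑ v : V, (#{b ∈ B | G.Adj b v}).descFactorial m : ℕ) : ℝ) =
      ((∑ f ∈ sdr (fun _ : {x // x ∈ I} => B), #{v | ∀ i, G.Adj (f i) v} : ℕ) : ℝ) := by
      rw [hswap]
    push_cast at h1
    rw [← h1]
    refine le_trans (le_of_eq ?_) hfirst
    rw [mul_pow (K * ε / 2 : ℝ), hpown, mul_div_assoc (K : ℝ), mul_pow (K : ℝ)]
    field_simp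
  have hcard : (#(sdr (fun _ : {x // x ∈ I} => B)) : ℝ) ≤ (K : ℝ) ^ m := by
    rw [card_sdr_const, hcα]
    exact_mod_cast Nat.descFactorial_le_pow _ _
  have hsecond := pow_div_le_sum_descFactorial (sdr (fun _ : {x // x ∈ I} => B))
    (fun f => #{v | ∀ i, G.Adj (f i) v}) hM (T := (K : ℝ) ^ m * ((ε / 2) ^ m / 2) * n)
    (N := (K : ℝ) ^ m) (by positivity) (by
      refine le_trans ?_ hsum
      have h1 : (M : ℝ) * #(sdr (fun _ : {x // x ∈ I} => B)) ≤
          (ε / 2) ^ m * n / 2 * (K : ℝ) ^ m := by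
        gcongr
        linarith
      linarith) hcard
  rw [hΩ]
  refine le_trans (le_of_eq ?_) hsecond
  rw [mul_pow, mul_pow, hpowK]
  field_simp

lemma bicliques_subset_cop_of_even {r m : ℕ} (hr : 6 ≤ r) (hrm : r ≤ 2 * m) {V : Type*}
    [Fintype V] {G : SimpleGraph V} {B : Finset V} {I : Finset (Fin r)}
    (hI : I ∈ indepSets r m) : bicliques G B I ⊆ cop (cycleGraph r) G := by
  intro h hh
  obtain ⟨h1, -, h3⟩ := mem_bicliques hh
  rw [mem_cop]
  refine ⟨h1, fun x y hxy => ?_⟩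
  by_cases hx : x ∈ I
  · exact h3 x hx y fun hy => not_adj_of_mem_indepSets (by omega) hI x hx y hy hxy
  · by_cases hy : y ∈ I
    · exact (h3 y hy x hx).symm
    · rcases (cycleGraph_adj_iff (by omega)).1 hxy with h | h
      · exact absurd (h ▸ cnext_mem_of_even hrm hI hx) hy
      · exact absurd (h ▸ cnext_mem_of_even hrm hI hy) hx

/-- The only edge of the odd cycle not crossing the bipartition joins the last two positions. -/
lemma biclique_mem_cop_of_adj {m : ℕ} (hm : 3 ≤ m) {V : Type*}
    [Fintype V] {G : SimpleGraph V} {B : Finset V} {h : Fin (2 * m + 1) → V}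
    (hh : h ∈ bicliques G B (evens (2 * m + 1) m)) {a b : Fin (2 * m + 1)}
    (ha : a.val = 2 * m - 1) (hb : b.val = 2 * m)
    (hab : G.Adj (h a) (h b)) : h ∈ cop (cycleGraph (2 * m + 1)) G := by
  obtain ⟨h1, -, h3⟩ := mem_bicliques hh
  rw [mem_cop]
  have key : ∀ x, G.Adj (h x) (h (cnext x)) := by
    intro x
    have hx := cnext_val x
    by_cases hxa : x = a
    · have : cnext x = b := by ext; rw [hxa] at hx ⊢; omega
      rw [this, hxa]
      exact hab
    · have hxa' : x.val ≠ a.val := fun h => hxa (Fin.ext h)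
      by_cases hxI : x ∈ evens (2 * m + 1) m
      · refine h3 x hxI _ fun h4 => ?_
        rw [mem_evens] at hxI h4
        omega
      · refine (h3 _ ?_ x hxI).symm
        rw [mem_evens] at hxI ⊢
        omega
  refine ⟨h1, fun x y hxy => ?_⟩
  rcases (cycleGraph_adj_iff (by omega)).1 hxy with h | h
  · rw [h]; exact key x
  · rw [h]; exact (key y).symm

/-- Rerouting a biclique function through a common edge of the two vertices at the end. -/
lemma exists_reroute {m k : ℕ} (hm : 3 ≤ m) (hk : m + 1 ≤ k) {V : Type*}
    [Fintype V] {G : SimpleGraph V} {S : V → V → Finset V} (hS : IsSelector G k S)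
    {B : Finset V} {h : Fin (2 * m + 1) → V}
    (hh : h ∈ bicliques G B (evens (2 * m + 1) m)) {a b : Fin (2 * m + 1)}
    (ha : a.val = 2 * m - 1) (hb : b.val = 2 * m) (hab : ¬ G.Adj (h a) (h b))
    (hex : ∀ x ∉ evens (2 * m + 1) m, h x ∉ S (h a) (h b)) :
    ∃ ψ ∈ cop (cycleGraph (2 * m + 1)) G, ∀ x : Fin (2 * m + 1), 2 ≤ x.val →
      h x = if x.val = 2 * m then ψ ⟨1, by omega⟩ else ψ x := by
  obtain ⟨h1, -, h3⟩ := mem_bicliques hh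
  have hne : h a ≠ h b := fun h' => by have := h1 h'; rw [this] at ha; omega
  obtain ⟨hScard, hSadj, hScl⟩ := hS _ _ hne hab
  set I := evens (2 * m + 1) m with hI
  let z : Fin (2 * m + 1) := ⟨0, by omega⟩
  have hzI : z ∈ I := by rw [hI, mem_evens]; simp [z]; omega
  have hIm : #I = m := (mem_indepSets.1 (evens_mem_indepSets (by omega))).1
  -- Position 0 is going to be overwritten, so only `m - 1` values on `I` must be avoided; `m + 1 ≤
  -- k` then leaves two vertices.
  have hcard : 2 ≤ #(S (h a) (h b) \ (I.erase z).image h) := by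
    have h4 : #((I.erase z).image h) ≤ m - 1 := by
      refine card_image_le.trans ?_
      rw [card_erase_of_mem hzI, hIm]
    have h5 := le_card_sdiff ((I.erase z).image h) (S (h a) (h b))
    omega
  obtain ⟨c, hc, c', hc', hcc⟩ := one_lt_card.1
    (by omega : 1 < #(S (h a) (h b) \ (I.erase z).image h))
  have hnot : ∀ d ∈ S (h a) (h b) \ (I.erase z).image h, ∀ x : Fin (2 * m + 1), 2 ≤ x.val →
      h x ≠ d := by
    intro d hd x hx hxd
    rw [mem_sdiff] at hd
    by_cases hxI : x ∈ I
    · refine hd.2 (mem_image.2 ⟨x, mem_erase.2 ⟨?_, hxI⟩, hxd⟩)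
      rintro rfl
      simp [z] at hx
    · exact hex x hxI (hxd ▸ hd.1)
  have hbnd : ∀ x : Fin (2 * m + 1), x.val < 2 * m + 1 := fun x => x.2
  -- The cycle leaves `h a` through `c` and `c'` to `h b`, now at position 1, and continues with `h`
  -- at position 2. Only the values of `h` at 0 and 1 are forgotten.
  set ψ : Fin (2 * m + 1) → V := fun x =>
    if x.val = 0 then c' else if x.val = 2 * m then c else if x.val = 1 then h b else h x with hψ
  have hψ0 : ∀ x : Fin (2 * m + 1), x.val = 0 → ψ x = c' := fun x hx => by
    simp only [hψ]; rw [if_pos hx]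
  have hψb : ∀ x : Fin (2 * m + 1), x.val = 2 * m → ψ x = c := fun x hx => by
    simp only [hψ]; rw [if_neg (by omega), if_pos hx]
  have hψ1 : ∀ x : Fin (2 * m + 1), x.val = 1 → ψ x = h b := fun x hx => by
    simp only [hψ]; rw [if_neg (by omega), if_neg (by omega), if_pos hx]
  have hψx : ∀ x : Fin (2 * m + 1), 2 ≤ x.val → x.val < 2 * m → ψ x = h x := fun x hx hx' => by
    simp only [hψ]; rw [if_neg (by omega), if_neg (by omega), if_neg (by omega)]
  have hcS := (mem_sdiff.1 hc).1
  have hcS' := (mem_sdiff.1 hc').1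
  have key : ∀ x, G.Adj (ψ x) (ψ (cnext x)) := by
    intro x
    have hx := cnext_val x
    have hxb := hbnd x
    by_cases h0 : x.val = 0
    · rw [hψ0 x h0, hψ1 _ (by omega)]
      exact (hSadj c' hcS').2.symm
    by_cases h1' : x.val = 1
    · rw [hψ1 x h1', hψx _ (by omega) (by omega)]
      refine (h3 _ ?_ b ?_).symm <;> rw [hI, mem_evens] <;> omega
    by_cases h2 : x.val = 2 * m
    · rw [hψb x h2, hψ0 _ (by omega)]
      exact hScl c hcS c' hcS' hcc
    by_cases h4 : x.val = 2 * m - 1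
    · rw [hψx x (by omega) (by omega), hψb _ (by omega)]
      have : x = a := by ext; omega
      rw [this]
      exact (hSadj c hcS).1
    · rw [hψx x (by omega) (by omega), hψx _ (by omega) (by omega)]
      by_cases hpar : x.val % 2 = 0
      · exact h3 x (by rw [hI, mem_evens]; omega) _ (by rw [hI, mem_evens]; omega)
      · exact (h3 _ (by rw [hI, mem_evens]; omega) x (by rw [hI, mem_evens]; omega)).symm
  refine ⟨ψ, ?_, ?_⟩
  · rw [mem_cop]
    constructor
    · have main : ∀ x y : Fin (2 * m + 1), x.val < y.val → ψ x ≠ ψ y := by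
        intro x y hxy
        have hyb := hbnd y
        by_cases h0 : x.val = 0
        · rw [hψ0 x h0]
          by_cases h2 : y.val = 2 * m
          · rw [hψb y h2]; exact hcc.symm
          by_cases h4 : y.val = 1
          · rw [hψ1 y h4]; exact (hnot c' hc' b (by omega)).symm
          · rw [hψx y (by omega) (by omega)]; exact (hnot c' hc' y (by omega)).symm
        by_cases h1' : x.val = 1
        · rw [hψ1 x h1']
          by_cases h2 : y.val = 2 * m
          · rw [hψb y h2]; exact hnot c hc b (by omega)
          · rw [hψx y (by omega) (by omega)]
            intro h'
            have := h1 h'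
            rw [← this] at h2
            exact h2 hb
        · rw [hψx x (by omega) (by omega)]
          by_cases h2 : y.val = 2 * m
          · rw [hψb y h2]; exact hnot c hc x (by omega)
          · rw [hψx y (by omega) (by omega)]
            intro h'
            have := h1 h'
            rw [this] at hxy
            omega
      intro x y hxy
      rcases lt_trichotomy x.val y.val with h4 | h4 | h4
      · exact absurd hxy (main x y h4)
      · exact Fin.ext h4
      · exact absurd hxy.symm (main y x h4)
    · intro x y hxy
      rcases (cycleGraph_adj_iff (by omega)).1 hxy with h | h
      · rw [h]; exact key x
      · rw [h]; exact (key y).symm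
  · intro x hx
    have hxb := hbnd x
    split_ifs with h2
    · rw [hψ1 _ rfl]
      congr 1
      ext; omega
    · rw [hψx x hx (by omega)]

/-- Tuples hitting a selected set at some third coordinate are rare. -/
lemma card_bicliques_hitting_le {r m M k : ℕ} {V : Type*} [Fintype V] {G : SimpleGraph V}
    {S : V → V → Finset V} (hS : IsSelector G k S) {B : Finset V} {I : Finset (Fin r)}
    (hI : #I = m) (hIM : r - #I = M) {a b : {x // x ∉ I}} (hab : a ≠ b) :
    #{h ∈ bicliques G B I | ¬ G.Adj (h a) (h b) ∧ ¬ ∀ x ∉ I, h x ∉ S (h a) (h b)} ≤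
      M * (#B ^ m * (Fintype.card V ^ (M - 1) * k)) := by
  set n := Fintype.card V with hn
  have hcβ : Fintype.card {x // x ∉ I} = M := by rw [card_notMem_subtype, hIM]
  set X : {x // x ∉ I} → Finset (Fin r → V) := fun x =>
    {h | (fun y : {y // y ∈ I} => h y) ∈ sdr (fun _ : {y // y ∈ I} => B) ∧
      (fun y : {y // y ∉ I} => h y) ∈ ({g | g a ≠ g b ∧ ¬ G.Adj (g a) (g b) ∧
        g x ∈ S (g a) (g b)} : Finset ({y // y ∉ I} → V))} with hX
  have hXcard : ∀ x, x ≠ a → x ≠ b → #(X x) ≤ #B ^ m * (n ^ (M - 1) * k) := by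
    intro x hxa hxb
    have h1 := card_filter_glue I (sdr (fun _ : {y // y ∈ I} => B)) fun _ =>
      ({g | g a ≠ g b ∧ ¬ G.Adj (g a) (g b) ∧ g x ∈ S (g a) (g b)} :
        Finset ({y // y ∉ I} → V))
    simp only [hX]
    rw [h1, sum_const, smul_eq_mul, card_sdr_const, Fintype.card_coe, hI]
    have h2 := card_tuple_three (V := V) (i := a) (j := b) (l := x) hab (Ne.symm hxa)
      (Ne.symm hxb) (fun u v w => u ≠ v ∧ ¬ G.Adj u v ∧ w ∈ S u v)
    rw [h2, hcβ, ← hn]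
    have hM3 : 3 ≤ M := by
      rw [← hcβ, ← card_univ]
      have : #({a, b, x} : Finset {x // x ∉ I}) = 3 := by
        rw [card_eq_three]
        exact ⟨a, b, x, hab, Ne.symm hxa, Ne.symm hxb, rfl⟩
      rw [← this]
      exact card_le_univ _
    have h3 : ∑ u : V, ∑ v : V, #{w | u ≠ v ∧ ¬ G.Adj u v ∧ w ∈ S u v} ≤ n * (n * k) := by
      calc _ ≤ ∑ u : V, ∑ v : V, k := by
            refine sum_le_sum fun u _ => sum_le_sum fun v _ => ?_
            by_cases huv : u ≠ v ∧ ¬ G.Adj u v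
            · rw [← (hS u v huv.1 huv.2).1]
              refine card_le_card fun w hw => ?_
              rw [mem_filter] at hw
              exact hw.2.2.2
            · refine le_trans (le_of_eq ?_) (Nat.zero_le _)
              rw [card_eq_zero]
              refine eq_empty_of_forall_notMem fun w hw => ?_
              rw [mem_filter] at hw
              exact huv ⟨hw.2.1, hw.2.2.1⟩
        _ = _ := by simp [hn]
    refine Nat.mul_le_mul (Nat.descFactorial_le_pow _ _) ?_
    calc _ ≤ n ^ (M - 3) * (n * (n * k)) := Nat.mul_le_mul_left _ h3
      _ = n ^ (M - 3 + 2) * k := by ring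
      _ = _ := by congr 2; omega
  have hsub : {h ∈ bicliques G B I | ¬ G.Adj (h a) (h b) ∧ ¬ ∀ x ∉ I, h x ∉ S (h a) (h b)} ⊆
      (univ.filter fun x => x ≠ a ∧ x ≠ b).biUnion X := by
    intro h hh
    rw [mem_filter] at hh
    obtain ⟨hh, hnadj, hex⟩ := hh
    push Not at hex
    obtain ⟨x, hx, hxS⟩ := hex
    obtain ⟨h1, -, -⟩ := mem_bicliques hh
    have hne : h a ≠ h b := fun h' => hab (Subtype.ext (h1 h'))
    have h2 := (hS _ _ hne hnadj).2.1 _ hxS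
    rw [mem_biUnion]
    refine ⟨⟨x, hx⟩, ?_, ?_⟩
    · rw [mem_filter]
      refine ⟨mem_univ _, ?_, ?_⟩
      · intro h'
        have : x = a := congrArg Subtype.val h'
        rw [this] at h2
        exact h2.1.ne rfl
      · intro h'
        have : x = b := congrArg Subtype.val h'
        rw [this] at h2
        exact h2.2.ne rfl
    · rw [bicliques, mem_filter] at hh
      simp only [hX]
      rw [mem_filter, mem_filter]
      exact ⟨mem_univ _, hh.2.1, mem_univ _, hne, hnadj, hxS⟩
  calc _ ≤ ∑ x ∈ univ.filter fun x => x ≠ a ∧ x ≠ b, #(X x) :=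
        (card_le_card hsub).trans card_biUnion_le
    _ ≤ ∑ x ∈ univ.filter fun x : {x // x ∉ I} => x ≠ a ∧ x ≠ b, #B ^ m * (n ^ (M - 1) * k) :=
        sum_le_sum fun x hx => by
          rw [mem_filter] at hx
          exact hXcard x hx.2.1 hx.2.2
    _ ≤ _ := by
        rw [sum_const, smul_eq_mul]
        refine Nat.mul_le_mul_right _ ((card_filter_le _ _).trans ?_)
        rw [card_univ, hcβ]

/-- Bicliques with `m` vertices on each side contain the even cycle, and the factor K^m exceeds any
prescribed constant. -/
lemma card_cop_gt_of_many_big_even {m s : ℕ} (hm : 3 ≤ m) {ε : ℝ} (hε : 0 < ε) {C : ℝ} :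
    ∃ K n₀ : ℕ, ∀ (V : Type) [Fintype V] (G : SimpleGraph V), n₀ ≤ Fintype.card V →
      IsSaturated (completeGraph (Fin s)) G → K ≤ #(bigSet G ε) →
      C * (Fintype.card V : ℝ) ^ m < #(cop (cycleGraph (2 * m)) G) := by
  set c : ℝ := ((ε / 2) ^ m / 2) ^ m with hc
  have hc0 : 0 < c := by positivity
  set K : ℕ := ⌈2 * m / ε⌉₊ + ⌈C / c⌉₊ + 1 with hK
  refine ⟨K, ⌈2 * m / (ε / 2) ^ m⌉₊ + 1, ?_⟩
  intro V _ G hn hG hbig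
  set n := Fintype.card V with hn'
  have : Nonempty V := Fintype.card_pos_iff.1 (by omega)
  have hn0 : (0 : ℝ) < n := by exact_mod_cast Fintype.card_pos
  obtain ⟨B, hB, hBK⟩ := exists_subset_card_eq hbig
  have hI : evens (2 * m) m ∈ indepSets (2 * m) m := evens_mem_indepSets le_rfl
  have hIm := (mem_indepSets.1 hI).1
  have hK1 : 2 * m / ε ≤ (K : ℝ) := (Nat.le_ceil _).trans (Nat.cast_le.2 (by omega))
  have hK2 : C / c < (K : ℝ) := lt_of_le_of_lt (Nat.le_ceil _) (Nat.cast_lt.2 (by omega))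
  have hK3 : (1 : ℝ) ≤ K := by exact_mod_cast (by omega : 1 ≤ K)
  have hn1 : 2 * m / (ε / 2) ^ m ≤ (n : ℝ) :=
    (Nat.le_ceil _).trans (Nat.cast_le.2 (by omega))
  have h1 := le_card_bicliques (M := m) (by omega) (by omega) hε G hB hIm (by omega)
    (by rw [hBK]; rwa [div_le_iff₀ hε] at hK1)
    (by rw [div_le_iff₀ (by positivity)] at hn1; rw [← hn']; linarith)
  rw [hBK, ← hc, ← hn'] at h1
  have h2 : (#(bicliques G B (evens (2 * m) m)) : ℝ) ≤ #(cop (cycleGraph (2 * m)) G) := by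
    exact_mod_cast card_le_card
      (bicliques_subset_cop_of_even (G := G) (B := B) (by omega) le_rfl hI)
  rw [div_lt_iff₀ hc0] at hK2
  have h3 : (K : ℝ) ≤ (K : ℝ) ^ m := le_self_pow₀ hK3 (by omega)
  have h4 : C * (n : ℝ) ^ m < c * (K : ℝ) ^ m * (n : ℝ) ^ m := by
    apply mul_lt_mul_of_pos_right _ (by positivity)
    calc C < K * c := hK2
      _ ≤ (K : ℝ) ^ m * c := by gcongr
      _ = _ := mul_comm _ _
  linarith

/-- The rerouted cycle determines the biclique up to its values at position 0, in `B`, and position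
1, arbitrary. -/
lemma card_rerouted_le {m k : ℕ} (hm : 3 ≤ m) (hk : m + 1 ≤ k) {V : Type}
    [Fintype V] {G : SimpleGraph V} {S : V → V → Finset V} (hS : IsSelector G k S)
    (B : Finset V) {a b : Fin (2 * m + 1)}
    (ha : a.val = 2 * m - 1) (hb : b.val = 2 * m) :
    #{h ∈ bicliques G B (evens (2 * m + 1) m) | ¬ G.Adj (h a) (h b) ∧
        ∀ x ∉ evens (2 * m + 1) m, h x ∉ S (h a) (h b)} ≤
      #B * Fintype.card V * #(cop (cycleGraph (2 * m + 1)) G) := by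
  set Ω := {h ∈ bicliques G B (evens (2 * m + 1) m) | ¬ G.Adj (h a) (h b) ∧
        ∀ x ∉ evens (2 * m + 1) m, h x ∉ S (h a) (h b)} with hΩ
  have hex : ∀ h ∈ Ω, ∃ ψ ∈ cop (cycleGraph (2 * m + 1)) G, ∀ x : Fin (2 * m + 1), 2 ≤ x.val →
      h x = if x.val = 2 * m then ψ ⟨1, by omega⟩ else ψ x := fun h hh => by
    rw [hΩ, mem_filter] at hh
    exact exists_reroute hm hk hS hh.1 ha hb hh.2.1 hh.2.2
  choose! φ hφ1 hφ2 using hex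
  let z : Fin (2 * m + 1) := ⟨0, by omega⟩
  let o : Fin (2 * m + 1) := ⟨1, by omega⟩
  have hzI : z ∈ evens (2 * m + 1) m := by rw [mem_evens]; simp [z]; omega
  calc #Ω ≤ #((B ×ˢ (univ : Finset V)) ×ˢ cop (cycleGraph (2 * m + 1)) G) := by
        refine card_le_card_of_injOn (fun h => ((h z, h o), φ h)) ?_ ?_
        · intro h hh
          have hh' : h ∈ Ω := hh
          have h1 := (mem_bicliques (mem_filter.1 hh').1).2.1 z hzI
          simp [h1, hφ1 h hh']
        · intro h hh h' hh' heq
          simp only [Prod.mk.injEq] at heq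
          obtain ⟨⟨h1, h2⟩, h3⟩ := heq
          funext x
          by_cases hx0 : x.val = 0
          · have : x = z := Fin.ext hx0
            rw [this, h1]
          by_cases hx1 : x.val = 1
          · have : x = o := Fin.ext hx1
            rw [this, h2]
          · rw [hφ2 h hh x (by omega), hφ2 h' hh' x (by omega), h3]
    _ = _ := by rw [card_product, card_product, card_univ]

/-- There are of order K^m n^(m+1) bicliques with sides `m` and `m + 1`. Each closes directly into
an odd cycle, can be rerouted into one with multiplicity at most Kn, or is one of the rare functions
hitting the selected clique. -/
lemma card_cop_gt_of_many_big_odd {m s : ℕ} (hm : 3 ≤ m) (hk : m + 1 ≤ s - 2) {ε : ℝ}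
    (hε : 0 < ε) {C : ℝ} :
    ∃ K n₀ : ℕ, ∀ (V : Type) [Fintype V] (G : SimpleGraph V), n₀ ≤ Fintype.card V →
      IsSaturated (completeGraph (Fin s)) G → K ≤ #(bigSet G ε) →
      C * (Fintype.card V : ℝ) ^ m < #(cop (cycleGraph (2 * m + 1)) G) := by
  set c : ℝ := ((ε / 2) ^ m / 2) ^ (m + 1) with hc
  have hc0 : 0 < c := by positivity
  set K : ℕ := ⌈2 * m / ε⌉₊ + ⌈4 * C / c⌉₊ + 1 with hK
  set E : ℕ := (m + 1) * (s - 2) with hE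
  refine ⟨K, ⌈2 * (m + 1 : ℕ) / (ε / 2) ^ m⌉₊ + ⌈4 * C / c⌉₊ + ⌈4 * E / c⌉₊ + 1, ?_⟩
  intro V _ G hn hG hbig
  obtain ⟨S, hS⟩ := exists_isSelector' hG
  set n := Fintype.card V with hn'
  have : Nonempty V := Fintype.card_pos_iff.1 (by omega)
  have hn0 : (0 : ℝ) < n := by exact_mod_cast Fintype.card_pos
  obtain ⟨B, hB, hBK⟩ := exists_subset_card_eq hbig
  set I := evens (2 * m + 1) m with hIdef
  have hI : I ∈ indepSets (2 * m + 1) m := evens_mem_indepSets (by omega)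
  have hIm := (mem_indepSets.1 hI).1
  have hK1 : 2 * m / ε ≤ (K : ℝ) := (Nat.le_ceil _).trans (Nat.cast_le.2 (by omega))
  have hK2 : 4 * C / c < (K : ℝ) := lt_of_le_of_lt (Nat.le_ceil _) (Nat.cast_lt.2 (by omega))
  have hK3 : (1 : ℝ) ≤ K := by exact_mod_cast (by omega : 1 ≤ K)
  have hn1 : 2 * (m + 1 : ℕ) / (ε / 2) ^ m ≤ (n : ℝ) :=
    (Nat.le_ceil _).trans (Nat.cast_le.2 (by omega))
  have hn2 : 4 * C / c < (n : ℝ) := lt_of_le_of_lt (Nat.le_ceil _) (Nat.cast_lt.2 (by omega))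
  have hn3 : 4 * E / c ≤ (n : ℝ) := (Nat.le_ceil _).trans (Nat.cast_le.2 (by omega))
  rw [div_lt_iff₀ hc0] at hK2 hn2
  rw [div_le_iff₀ hc0] at hn3
  have h1 := le_card_bicliques (M := m + 1) (by omega) (by omega) hε G hB hIm (by omega)
    (by rw [hBK]; rwa [div_le_iff₀ hε] at hK1)
    (by rw [div_le_iff₀ (by positivity)] at hn1; rw [← hn']; linarith)
  rw [hBK, ← hc, ← hn'] at h1
  let a : Fin (2 * m + 1) := ⟨2 * m - 1, by omega⟩
  let b : Fin (2 * m + 1) := ⟨2 * m, by omega⟩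
  have haI : a ∉ I := by rw [hIdef, mem_evens]; simp only [a]; omega
  have hbI : b ∉ I := by rw [hIdef, mem_evens]; simp only [b]; omega
  have hab : a ≠ b := by rw [Ne, Fin.ext_iff]; simp only [a, b]; omega
  set Ω := bicliques G B I with hΩ
  have hsplit1 := card_filter_add_card_filter_not (s := Ω) (fun h => G.Adj (h a) (h b))
  have hsplit2 := card_filter_add_card_filter_not (s := {h ∈ Ω | ¬ G.Adj (h a) (h b)})
    (fun h => ∀ x ∉ I, h x ∉ S (h a) (h b))
  rw [filter_filter, filter_filter] at hsplit2
  have hA : #{h ∈ Ω | G.Adj (h a) (h b)} ≤ #(cop (cycleGraph (2 * m + 1)) G) := by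
    refine card_le_card fun h hh => ?_
    rw [mem_filter] at hh
    exact biclique_mem_cop_of_adj hm hh.1 rfl rfl hh.2
  have hR := card_rerouted_le hm hk hS B (a := a) (b := b) rfl rfl
  have hH := card_bicliques_hitting_le hS (B := B) hIm (M := m + 1) (by omega)
    (a := ⟨a, haI⟩) (b := ⟨b, hbI⟩) (by simpa using hab)
  rw [← hIdef, ← hΩ, hBK, ← hn'] at hR
  rw [← hΩ, hBK, ← hn', Nat.add_sub_cancel] at hH
  set L := #(cop (cycleGraph (2 * m + 1)) G) with hL
  have htot : (#Ω : ℝ) ≤ L + (K * n * L + (m + 1 : ℕ) * (K ^ m * (n ^ m * (s - 2 : ℕ)))) := by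
    have : #Ω ≤ L + (K * n * L + (m + 1) * (K ^ m * (n ^ m * (s - 2)))) := by
      refine le_trans (le_of_eq ?_)
        (Nat.add_le_add hA (Nat.add_le_add hR hH))
      rw [← hsplit1, ← hsplit2]
    exact_mod_cast this
  -- If there were at most C n^m cycles, each of the three classes would be at most a quarter of the
  -- guaranteed number of bicliques (`e1`, `e2`, `e3`). Rerouting costs a factor K, hence the use of
  -- K² ≤ K^m.
  by_contra! hlt
  have hKm : (1 : ℝ) ≤ (K : ℝ) ^ m := one_le_pow₀ hK3
  have hKm' : (K : ℝ) * K ≤ (K : ℝ) ^ m := by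
    rw [← sq]; exact pow_le_pow_right₀ hK3 (by omega)
  set N := (n : ℝ) ^ m with hN
  have hN0 : 0 < N := by positivity
  have hpos : 0 < (K : ℝ) ^ m * n * N := by positivity
  have e1 : (L : ℝ) * 4 ≤ c * ((K : ℝ) ^ m * n * N) := by
    calc (L : ℝ) * 4 ≤ (4 * C) * N := by linarith
      _ ≤ (n * c) * N := by gcongr
      _ = 1 * (n * c * N) := by ring
      _ ≤ (K : ℝ) ^ m * (n * c * N) := by gcongr
      _ = _ := by ring
  have e2 : (K * n * L : ℝ) * 4 ≤ c * ((K : ℝ) ^ m * n * N) := by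
    calc (K * n * L : ℝ) * 4 ≤ (K * n * (C * N)) * 4 := by gcongr
      _ = K * (4 * C) * (n * N) := by ring
      _ ≤ K * (K * c) * (n * N) := by gcongr
      _ = (K * K : ℝ) * (c * n * N) := by ring
      _ ≤ (K : ℝ) ^ m * (c * n * N) := by gcongr
      _ = _ := by ring
  have e3 : ((m + 1 : ℕ) * (K ^ m * (N * (s - 2 : ℕ))) : ℝ) * 4 ≤ c * ((K : ℝ) ^ m * n * N) := by
    have : ((m + 1 : ℕ) * (K ^ m * (N * (s - 2 : ℕ))) : ℝ) * 4 = (K : ℝ) ^ m * N * (4 * E) := by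
      rw [hE]; push_cast; ring
    rw [this]
    calc (K : ℝ) ^ m * N * (4 * E) ≤ (K : ℝ) ^ m * N * (n * c) := by gcongr
      _ = _ := by ring
  have e4 : c * ((K : ℝ) ^ m * n * N) ≤ #Ω := by
    refine le_trans (le_of_eq ?_) h1
    rw [pow_succ (n : ℝ) m]
    ring
  have : 0 < c * ((K : ℝ) ^ m * n * N) := by positivity
  linarith

/-- Many vertices of linear degree force many cycles. -/
theorem exists_card_cop_gt_of_many_big {r m s : ℕ} (hm : 3 ≤ m) (hrm : r = 2 * m ∨ r = 2 * m + 1)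
    (hk : r - m ≤ s - 2) {ε : ℝ} (hε : 0 < ε) (C : ℝ) :
    ∃ K n₀ : ℕ, ∀ (V : Type) [Fintype V] (G : SimpleGraph V), n₀ ≤ Fintype.card V →
      IsSaturated (completeGraph (Fin s)) G → K ≤ #(bigSet G ε) →
      C * (Fintype.card V : ℝ) ^ m < #(cop (cycleGraph r) G) := by
  rcases hrm with rfl | rfl
  · exact card_cop_gt_of_many_big_even hm hε
  · exact card_cop_gt_of_many_big_odd hm (by omega) hε

/-! ### Sparse graphs: most tuples are independent, and near-equality gives a common clique. -/

/-- The at most `K` big vertices have at most n neighbours each, which is negligible against n²; all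
others have fewer than εn. -/
lemma adjPairs_le {V : Type*} [Fintype V] (G : SimpleGraph V) {ε : ℝ} (hε : 0 < ε) {K : ℕ}
    (hK : #(bigSet G ε) ≤ K) (hn : (K + 1 : ℝ) ≤ ε * Fintype.card V) :
    (adjPairs G + Fintype.card V : ℝ) ≤ 2 * ε * (Fintype.card V : ℝ) ^ 2 := by
  set n := Fintype.card V with hn'
  have h1 : (adjPairs G : ℝ) ≤ ∑ a : V, ((if a ∈ bigSet G ε then (n : ℝ) else 0) + ε * n) := by
    rw [adjPairs]
    push_cast
    refine sum_le_sum fun a _ => ?_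
    split_ifs with h
    · have : (#{b | G.Adj a b} : ℝ) ≤ n := by exact_mod_cast card_le_univ _
      have : 0 ≤ ε * n := by positivity
      linarith
    · rw [mem_bigSet, not_le] at h
      linarith
  rw [sum_add_distrib, sum_const, card_univ, ← hn', nsmul_eq_mul, ← sum_filter, sum_const,
    nsmul_eq_mul, filter_mem_eq_inter, univ_inter] at h1
  have h2 : (#(bigSet G ε) : ℝ) * n ≤ K * n := by gcongr
  have h3 : (K + 1 : ℝ) * n ≤ ε * n * n := by gcongr
  nlinarith

lemma card_not_isIndepTuple_le' {α V : Type*} [Fintype α] [DecidableEq α] [Fintype V]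
    (G : SimpleGraph V) {ε : ℝ} (hε : 0 < ε) {K : ℕ}
    (hK : #(bigSet G ε) ≤ K) (hn : (K + 1 : ℝ) ≤ ε * Fintype.card V) {m : ℕ}
    (hm : Fintype.card α = m) (hm2 : 2 ≤ m) :
    (#{f : α → V | ¬ IsIndepTuple G f} : ℝ) ≤ 2 * m ^ 2 * ε * (Fintype.card V : ℝ) ^ m := by
  have h1 := card_not_isIndepTuple_le (α := α) G
  rw [hm] at h1
  have h2 := adjPairs_le G hε hK hn
  set n := Fintype.card V
  calc (#{f : α → V | ¬ IsIndepTuple G f} : ℝ)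
      ≤ m ^ 2 * ((n : ℝ) ^ (m - 2) * (adjPairs G + n)) := by exact_mod_cast h1
    _ ≤ m ^ 2 * ((n : ℝ) ^ (m - 2) * (2 * ε * (n : ℝ) ^ 2)) := by gcongr
    _ = 2 * m ^ 2 * ε * ((n : ℝ) ^ (m - 2) * (n : ℝ) ^ 2) := by ring
    _ = _ := by rw [← pow_add]; congr 2; omega

lemma card_hitting_le {α V : Type*} [Fintype α] [DecidableEq α] [Fintype V]
    {B : Finset V} {ε : ℝ} {K : ℕ}
    (hK : #B ≤ K) (hn : (K + 1 : ℝ) ≤ ε * Fintype.card V) {m : ℕ}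
    (hm : Fintype.card α = m) (hm2 : 2 ≤ m) :
    (#{f : α → V | ∃ i, f i ∈ B} : ℝ) ≤ m * ε * (Fintype.card V : ℝ) ^ m := by
  set n := Fintype.card V
  have h1 : #{f : α → V | ∃ i, f i ∈ B} ≤ m * (n ^ (m - 1) * K) := by
    calc _ ≤ #((univ : Finset α).biUnion fun i => {f : α → V | f i ∈ B}) := by
          refine card_le_card fun f hf => ?_
          simpa using hf
      _ ≤ ∑ i : α, #{f : α → V | f i ∈ B} := card_biUnion_le
      _ ≤ ∑ i : α, n ^ (m - 1) * K := by
          refine sum_le_sum fun i _ => ?_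
          rw [card_tuple_one i (fun a => a ∈ B), hm, filter_mem_eq_inter, univ_inter]
          gcongr
      _ = _ := by rw [sum_const, card_univ, hm, smul_eq_mul]
  calc (#{f : α → V | ∃ i, f i ∈ B} : ℝ) ≤ m * ((n : ℝ) ^ (m - 1) * K) := by exact_mod_cast h1
    _ ≤ m * ((n : ℝ) ^ (m - 1) * (ε * n)) := by gcongr; linarith
    _ = m * ε * ((n : ℝ) ^ (m - 1) * n) := by ring
    _ = _ := by rw [← pow_succ]; congr 2; omega

/-- If the tuples carry enough weight then some pair has a selected clique with many common
neighbours. -/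
lemma exists_clique_of_weights {r m k : ℕ} (hr : 6 ≤ r) (hm : 3 ≤ m) (hrm : r ≤ 2 * m + 1)
    (hrm' : 2 * m ≤ r) {V : Type*} [Fintype V] [Nonempty V] {G : SimpleGraph V}
    {S : V → V → Finset V} (hS : IsSelector G k S)
    (F : ∀ I : {I // I ∈ indepSets r m}, Finset ({x // x ∈ I.1} → V))
    (W : ∀ I : {I // I ∈ indepSets r m}, ({x // x ∈ I.1} → V) → ℝ) {D c ζ δ e : ℝ}
    (hD : 0 ≤ D) (hc : 0 < c) (hF : ∀ I, ∀ f ∈ F I, IsIndepTuple G f)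
    (hFcard : ∀ I, (1 - ζ) * (Fintype.card V : ℝ) ^ m ≤ #(F I))
    (hW : ∀ I, ∀ f ∈ F I, D ≤ W I f)
    (hW' : ∀ I, ∀ f ∈ F I, (∃ x y, slots (cycleGaps hr hrm I.2) S f x ≠
      slots (cycleGaps hr hrm I.2) S f y) → D + c ≤ W I f)
    (hsum : ∑ I, ∑ f ∈ F I, W I f ≤ (#(indepSets r m) * D + e) * (Fintype.card V : ℝ) ^ m)
    (hδ1 : δ ≤ 1)
    (hδ : #(indepSets r m) * D * ζ + e < c * (δ - ζ)) :
    ∃ a b, a ≠ b ∧ ¬ G.Adj a b ∧ (1 - δ) * Fintype.card V ≤ #(commonNbrs G (S a b)) := by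
  by_contra! hno
  set n := Fintype.card V with hn
  have hn0 : (0 : ℝ) < n := by exact_mod_cast Fintype.card_pos
  let I₀ : {I // I ∈ indepSets r m} := ⟨evens r m, evens_mem_indepSets hrm'⟩
  set g := cycleGaps hr hrm I₀.2 with hg
  have hIm : Fintype.card {x // x ∈ I₀.1} = m := by
    rw [Fintype.card_coe, (mem_indepSets.1 I₀.2).1]
  obtain ⟨i⟩ : Nonempty {x // x ∈ I₀.1} := Fintype.card_pos_iff.1 (by omega)
  obtain ⟨x, hx⟩ := exists_gap_left hr hrm I₀.2 i
  set j := g.r x with hj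
  have hij : i ≠ j := fun h => g.ne x (hx.trans h)
  obtain ⟨q, hq⟩ : ∃ q, q ∉ ({i, j} : Finset {x // x ∈ I₀.1}) := by
    by_contra! h
    have h1 : #(univ : Finset {x // x ∈ I₀.1}) ≤ #({i, j} : Finset {x // x ∈ I₀.1}) :=
      card_le_card fun x _ => h x
    rw [card_univ, hIm] at h1
    have := card_le_two (a := i) (b := j)
    omega
  simp only [mem_insert, mem_singleton, not_or] at hq
  obtain ⟨y, hy⟩ := exists_gap_left hr hrm I₀.2 q
  -- If the slots of gaps `x` and `y` agree, then the clique selected for coordinates `i`, `j` is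
  -- adjacent to the third coordinate `q`, which is thus a common neighbour of it. By assumption
  -- each pair `i`, `j` allows fewer than (1-δ)n such values.
  have hconst : (#{f ∈ F I₀ | slots g S f x = slots g S f y} : ℝ) ≤ (1 - δ) * (n : ℝ) ^ m := by
    have h1 : #{f ∈ F I₀ | slots g S f x = slots g S f y} ≤
        n ^ (m - 3) * ∑ a, ∑ b, #{c | (a ≠ b ∧ ¬ G.Adj a b) ∧ c ∈ commonNbrs G (S a b)} := by
      have h2 := card_tuple_three (V := V) hij (Ne.symm hq.1) (Ne.symm hq.2)
        (fun a b c => (a ≠ b ∧ ¬ G.Adj a b) ∧ c ∈ commonNbrs G (S a b))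
      rw [hIm] at h2
      rw [← h2]
      refine card_le_card fun f hf => ?_
      rw [mem_filter] at hf ⊢
      have hind := hF I₀ f hf.1
      refine ⟨mem_univ _, hind i j hij, mem_commonNbrs.2 fun z hz => ?_⟩
      have h3 : z ∈ slots g S f y := by
        rw [← hf.2, slots, show g.l x = i from hx]
        exact hz
      have h4 := ((hS _ _ (hind _ _ (g.ne y)).1 (hind _ _ (g.ne y)).2).2.1 z h3).1
      rwa [show g.l y = q from hy] at h4
    have hpair : ∀ a b, (#{c | (a ≠ b ∧ ¬ G.Adj a b) ∧ c ∈ commonNbrs G (S a b)} : ℝ) ≤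
        (1 - δ) * n := by
      intro a b
      by_cases hab : a ≠ b ∧ ¬ G.Adj a b
      · have h3 : ({c | (a ≠ b ∧ ¬ G.Adj a b) ∧ c ∈ commonNbrs G (S a b)} : Finset V) =
            commonNbrs G (S a b) := by ext; simp [hab]
        rw [h3]
        exact (hno a b hab.1 hab.2).le
      · have h3 : ({c | (a ≠ b ∧ ¬ G.Adj a b) ∧ c ∈ commonNbrs G (S a b)} : Finset V) = ∅ := by
          refine eq_empty_of_forall_notMem fun c hc => ?_
          rw [mem_filter] at hc
          exact hab hc.2.1
        rw [h3, card_empty, Nat.cast_zero]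
        exact mul_nonneg (by linarith) hn0.le
    have h5 : (#{f ∈ F I₀ | slots g S f x = slots g S f y} : ℝ) ≤ (n : ℝ) ^ (m - 3) *
        ∑ a, ∑ b, (#{c | (a ≠ b ∧ ¬ G.Adj a b) ∧ c ∈ commonNbrs G (S a b)} : ℝ) := by
      exact_mod_cast h1
    refine h5.trans ?_
    calc _ ≤ (n : ℝ) ^ (m - 3) * ∑ a : V, ∑ b : V, (1 - δ) * n := by
          gcongr with a _ b _
          exact hpair a b
      _ = (1 - δ) * ((n : ℝ) ^ (m - 3) * n ^ 3) := by
          rw [sum_const, sum_const, card_univ, ← hn, nsmul_eq_mul, nsmul_eq_mul]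
          ring
      _ = _ := by rw [← pow_add]; congr 2; omega
  have hlow : ∀ I, (1 - ζ) * (n : ℝ) ^ m * D ≤ ∑ f ∈ F I, W I f := by
    intro I
    calc (1 - ζ) * (n : ℝ) ^ m * D ≤ #(F I) * D := by gcongr; exact hFcard I
      _ = ∑ f ∈ F I, D := by rw [sum_const, nsmul_eq_mul]
      _ ≤ _ := sum_le_sum fun f hf => hW I f hf
  -- At least a fraction δ - ζ of all tuples therefore have two different slots and gain `c`. This
  -- gain for the single set `I₀` already contradicts the total.
  have hlow₀ : (1 - ζ) * (n : ℝ) ^ m * D + c * ((δ - ζ) * (n : ℝ) ^ m) ≤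
      ∑ f ∈ F I₀, W I₀ f := by
    have h1 : (#{f ∈ F I₀ | slots g S f x = slots g S f y} : ℝ) +
        #{f ∈ F I₀ | ¬ slots g S f x = slots g S f y} = #(F I₀) := by
      exact_mod_cast card_filter_add_card_filter_not (s := F I₀) _
    have h2 := hFcard I₀
    calc _ ≤ #(F I₀) * D + c * #{f ∈ F I₀ | ¬ slots g S f x = slots g S f y} := by
          gcongr
          linarith
      _ = ∑ f ∈ F I₀, (D + if ¬ slots g S f x = slots g S f y then c else 0) := by
          rw [sum_add_distrib, ← sum_filter, sum_const, sum_const, nsmul_eq_mul, nsmul_eq_mul,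
            mul_comm c]
      _ ≤ _ := sum_le_sum fun f hf => by
          split_ifs with h
          · rw [add_zero]; exact hW I₀ f hf
          · exact hW' I₀ f hf ⟨x, y, h⟩
  have htot : #(indepSets r m) * ((1 - ζ) * (n : ℝ) ^ m * D) + c * ((δ - ζ) * (n : ℝ) ^ m) ≤
      ∑ I, ∑ f ∈ F I, W I f := by
    have hcI : Fintype.card {I // I ∈ indepSets r m} = #(indepSets r m) := Fintype.card_coe _
    calc _ = ∑ I : {I // I ∈ indepSets r m}, ((1 - ζ) * (n : ℝ) ^ m * D +
          if I = I₀ then c * ((δ - ζ) * (n : ℝ) ^ m) else 0) := by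
          rw [sum_add_distrib, sum_const, card_univ, hcI, nsmul_eq_mul,
            sum_ite_eq' univ I₀ fun _ => c * ((δ - ζ) * (n : ℝ) ^ m), if_pos (mem_univ _)]
      _ ≤ _ := sum_le_sum fun I _ => by
          split_ifs with h
          · rw [h]; exact hlow₀
          · rw [add_zero]; exact hlow I
  have hn1 : 0 < (n : ℝ) ^ m := by positivity
  have h1 := htot.trans hsum
  have h2 : (#(indepSets r m) * D * ζ + e) * (n : ℝ) ^ m < c * (δ - ζ) * (n : ℝ) ^ m :=
    mul_lt_mul_of_pos_right hδ hn1
  linarith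

/-! ### Even cycles: counting with weights. -/

/-- Independent tuples avoiding `B`, whose slots meet only in `B`. -/
noncomputable def evenTuples {r m : ℕ} (hr : 6 ≤ r) (hrm : r ≤ 2 * m + 1) {V : Type*}
    [Fintype V] (G : SimpleGraph V) (S : V → V → Finset V) (B : Finset V)
    (I : {I // I ∈ indepSets r m}) : Finset ({x // x ∈ I.1} → V) :=
  {f | IsIndepTuple G f ∧ (¬ ∃ i, f i ∈ B) ∧ ∀ x y, x ≠ y →
    slots (cycleGaps hr hrm I.2) S f x ∩ slots (cycleGaps hr hrm I.2) S f y ⊆ B}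

lemma card_filter_small_nbr_le {V : Type*} [Fintype V] {G : SimpleGraph V} {ε : ℝ}
    (hε : 0 ≤ ε) (T : Finset V) :
    (#{c | ∃ z ∈ T, z ∉ bigSet G ε ∧ G.Adj z c} : ℝ) ≤ #T * (ε * Fintype.card V) := by
  have h1 : #{c | ∃ z ∈ T, z ∉ bigSet G ε ∧ G.Adj z c} ≤
      ∑ z ∈ T.filter fun z => z ∉ bigSet G ε, #{c | G.Adj z c} := by
    refine le_trans (card_le_card fun c hc => ?_) card_biUnion_le
    rw [mem_filter] at hc
    obtain ⟨-, z, hz, hzB, hzc⟩ := hc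
    exact mem_biUnion.2 ⟨z, mem_filter.2 ⟨hz, hzB⟩, mem_filter.2 ⟨mem_univ _, hzc⟩⟩
  calc (#{c | ∃ z ∈ T, z ∉ bigSet G ε ∧ G.Adj z c} : ℝ)
      ≤ ∑ z ∈ T.filter fun z => z ∉ bigSet G ε, (#{c | G.Adj z c} : ℝ) := by exact_mod_cast h1
    _ ≤ ∑ z ∈ T.filter fun z => z ∉ bigSet G ε, ε * Fintype.card V := by
        refine sum_le_sum fun z hz => ?_
        rw [mem_filter, mem_bigSet, not_le] at hz
        exact hz.2.le
    _ ≤ _ := by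
        rw [sum_const, nsmul_eq_mul]
        gcongr
        exact filter_subset _ _

/-- If the slots of `x` and `y` share some `z ∉ B`, then a gap end of `y` that is not an end of the
gap of `x` is mapped to a neighbour of `z`. For given ends of `x` there are at most `k` such `z`,
each with fewer than εn neighbours. -/
lemma le_card_evenTuples {r m k : ℕ} (hr : 6 ≤ r) (hm : 3 ≤ m) (hrm : r ≤ 2 * m) {V : Type*}
    [Fintype V] {G : SimpleGraph V} {S : V → V → Finset V} (hS : IsSelector G k S) {ε : ℝ}
    (hε : 0 < ε) {K : ℕ} (hK : #(bigSet G ε) ≤ K) (hn : (K + 1 : ℝ) ≤ ε * Fintype.card V)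
    (I : {I // I ∈ indepSets r m}) :
    (1 - (2 * m ^ 2 + m + r ^ 2 * k) * ε) * (Fintype.card V : ℝ) ^ m ≤
      #(evenTuples hr (by omega) G S (bigSet G ε) I) := by
  set n := Fintype.card V with hn'
  set B := bigSet G ε with hB
  set g := cycleGaps hr (by omega : r ≤ 2 * m + 1) I.2 with hg
  have hIm : Fintype.card {x // x ∈ I.1} = m := by
    rw [Fintype.card_coe, (mem_indepSets.1 I.2).1]
  have h1 := card_not_isIndepTuple_le' (α := {x // x ∈ I.1}) G hε hK hn hIm (by omega)
  have h2 := card_hitting_le (α := {x // x ∈ I.1}) (B := B) (ε := ε) hK hn hIm (by omega)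
  rw [← hn'] at h1 h2
  set X : {x // x ∉ I.1} × {x // x ∉ I.1} → Finset ({x // x ∈ I.1} → V) := fun p =>
    {f | IsIndepTuple G f ∧ p.1 ≠ p.2 ∧ ¬ slots g S f p.1 ∩ slots g S f p.2 ⊆ B} with hX
  have hXcard : ∀ p, (#(X p) : ℝ) ≤ k * ε * (n : ℝ) ^ m := by
    rintro ⟨x, y⟩
    by_cases hxy : x = y
    · have : X (x, y) = ∅ := by
        refine eq_empty_of_forall_notMem fun f hf => ?_
        simp only [hX] at hf
        rw [mem_filter] at hf
        exact hf.2.2.1 hxy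
      rw [this, card_empty, Nat.cast_zero]
      positivity
    obtain ⟨q, hq, hql, hqr⟩ := gap_ends_differ hr hrm I.2 hxy
    have h3 := card_tuple_three (V := V) (g.ne x) (Ne.symm hql) (Ne.symm hqr)
      (fun a b c => (a ≠ b ∧ ¬ G.Adj a b) ∧ ∃ z ∈ S a b, z ∉ B ∧ G.Adj z c)
    rw [hIm, ← hn'] at h3
    have h4 : #(X (x, y)) ≤ n ^ (m - 3) * ∑ a, ∑ b, #{c | (a ≠ b ∧ ¬ G.Adj a b) ∧
        ∃ z ∈ S a b, z ∉ B ∧ G.Adj z c} := by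
      rw [← h3]
      refine card_le_card fun f hf => ?_
      simp only [hX] at hf
      rw [mem_filter] at hf ⊢
      obtain ⟨-, hind, -, hsub⟩ := hf
      obtain ⟨z, hz, hzB⟩ := not_subset.1 hsub
      rw [mem_inter] at hz
      have h5 := (hS _ _ (hind _ _ (g.ne y)).1 (hind _ _ (g.ne y)).2).2.1 z hz.2
      refine ⟨mem_univ _, hind _ _ (g.ne x), z, hz.1, hzB, ?_⟩
      rcases hq with rfl | rfl
      · exact h5.1.symm
      · exact h5.2.symm
    have h5 : (#(X (x, y)) : ℝ) ≤ (n : ℝ) ^ (m - 3) * ∑ a, ∑ b,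
        (#{c | (a ≠ b ∧ ¬ G.Adj a b) ∧ ∃ z ∈ S a b, z ∉ B ∧ G.Adj z c} : ℝ) := by
      exact_mod_cast h4
    refine h5.trans ?_
    calc _ ≤ (n : ℝ) ^ (m - 3) * ∑ a : V, ∑ b : V, k * (ε * n) := by
          gcongr with a _ b _
          by_cases hab : a ≠ b ∧ ¬ G.Adj a b
          · rw [← (hS a b hab.1 hab.2).1]
            refine le_trans ?_ (card_filter_small_nbr_le (G := G) hε.le (S a b))
            exact_mod_cast card_le_card fun c hc => by
              rw [mem_filter] at hc ⊢
              exact ⟨hc.1, hc.2.2⟩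
          · have : ({c | (a ≠ b ∧ ¬ G.Adj a b) ∧ ∃ z ∈ S a b, z ∉ B ∧ G.Adj z c} :
                Finset V) = ∅ := by
              refine eq_empty_of_forall_notMem fun c hc => ?_
              rw [mem_filter] at hc
              exact hab hc.2.1
            rw [this, card_empty, Nat.cast_zero]
            positivity
      _ = k * ε * ((n : ℝ) ^ (m - 3) * n ^ 3) := by
          rw [sum_const, sum_const, card_univ, ← hn', nsmul_eq_mul, nsmul_eq_mul]
          ring
      _ = _ := by rw [← pow_add]; congr 2; omega
  have hcover : (univ : Finset ({x // x ∈ I.1} → V)) ⊆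
      evenTuples hr (by omega) G S B I ∪
        (({f | ¬ IsIndepTuple G f} : Finset ({x // x ∈ I.1} → V)) ∪
        (({f | ∃ i, f i ∈ B} : Finset ({x // x ∈ I.1} → V)) ∪ univ.biUnion X)) := by
    intro f _
    by_contra hf
    simp only [mem_union, not_or] at hf
    obtain ⟨hf1, hf2, hf3, hf4⟩ := hf
    rw [mem_filter] at hf2 hf3
    have hind : IsIndepTuple G f := by
      by_contra h; exact hf2 ⟨mem_univ _, h⟩
    refine hf1 ?_
    rw [evenTuples, mem_filter]
    refine ⟨mem_univ _, hind, fun h => hf3 ⟨mem_univ _, h⟩, fun x y hxy => ?_⟩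
    by_contra h
    refine hf4 (mem_biUnion.2 ⟨(x, y), mem_univ _, ?_⟩)
    simp only [hX]
    rw [mem_filter]
    exact ⟨mem_univ _, hind, hxy, h⟩
  have hcount := (card_le_card hcover).trans ((card_union_le _ _).trans (Nat.add_le_add_left
    ((card_union_le _ _).trans (Nat.add_le_add_left ((card_union_le _ _).trans
      (Nat.add_le_add_left card_biUnion_le _)) _)) _))
  rw [card_univ, Fintype.card_fun, hIm, ← hn'] at hcount
  have hcount' : (n : ℝ) ^ m ≤ #(evenTuples hr (by omega) G S B I) +
      (#{f : {x // x ∈ I.1} → V | ¬ IsIndepTuple G f} + (#{f : {x // x ∈ I.1} → V | ∃ i, f i ∈ B} +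
        ∑ p, (#(X p) : ℝ))) := by exact_mod_cast hcount
  have hXsum : ∑ p, (#(X p) : ℝ) ≤ r ^ 2 * k * ε * (n : ℝ) ^ m := by
    refine (sum_le_sum fun p _ => hXcard p).trans ?_
    rw [sum_const, card_univ, Fintype.card_prod, card_notMem_subtype, nsmul_eq_mul]
    have h6 : ((r - #I.1 : ℕ) : ℝ) ≤ r := by exact_mod_cast Nat.sub_le _ _
    have h7 : (0 : ℝ) ≤ k * ε * (n : ℝ) ^ m := by positivity
    calc _ ≤ ((r : ℝ) * r) * (k * ε * (n : ℝ) ^ m) := by push_cast; gcongr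
      _ = _ := by ring
  linarith

/-- Tuples avoid `B`, so a copy meeting `B` shows a position outside `I`, which determines `I`: it
is counted once, with weight 2. A copy missing `B` may be counted for both independent sets, with
weight 1 each. -/
lemma sum_even_weights_le {r m k : ℕ} (hr : 6 ≤ r) (hrm : r ≤ 2 * m) {V : Type*}
    [Fintype V] {G : SimpleGraph V} {S : V → V → Finset V} (hS : IsSelector G k S)
    (B : Finset V) :
    ∑ I : {I // I ∈ indepSets r m}, ∑ f ∈ evenTuples hr (by omega) G S B I,
      (2 * #{g ∈ sdr (slots (cycleGaps hr (by omega) I.2) S f) | ∃ x, g x ∈ B} +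
        #{g ∈ sdr (slots (cycleGaps hr (by omega) I.2) S f) | ¬ ∃ x, g x ∈ B}) ≤
      2 * #(cop (cycleGraph r) G) := by
  have hrm1 : r ≤ 2 * m + 1 := by omega
  set F := evenTuples hr hrm1 G S B with hF
  set big : {I // I ∈ indepSets r m} → Finset (Fin r → V) := fun I =>
    {ψ | (fun x : {x // x ∈ I.1} => ψ x) ∈ F I ∧ (fun x : {x // x ∉ I.1} => ψ x) ∈
      (sdr (slots (cycleGaps hr hrm1 I.2) S fun x : {x // x ∈ I.1} => ψ x)).filter
        fun g => ∃ x, g x ∈ B} with hbig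
  set small : {I // I ∈ indepSets r m} → Finset (Fin r → V) := fun I =>
    {ψ | (fun x : {x // x ∈ I.1} => ψ x) ∈ F I ∧ (fun x : {x // x ∉ I.1} => ψ x) ∈
      (sdr (slots (cycleGaps hr hrm1 I.2) S fun x : {x // x ∈ I.1} => ψ x)).filter
        fun g => ¬ ∃ x, g x ∈ B} with hsmall
  have hbigc : ∀ I, #(big I) = ∑ f ∈ F I,
      #{g ∈ sdr (slots (cycleGaps hr hrm1 I.2) S f) | ∃ x, g x ∈ B} := fun I =>
    card_filter_glue I.1 (F I) fun f =>
      (sdr (slots (cycleGaps hr hrm1 I.2) S f)).filter fun g => ∃ x, g x ∈ B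
  have hsmallc : ∀ I, #(small I) = ∑ f ∈ F I,
      #{g ∈ sdr (slots (cycleGaps hr hrm1 I.2) S f) | ¬ ∃ x, g x ∈ B} := fun I =>
    card_filter_glue I.1 (F I) fun f =>
      (sdr (slots (cycleGaps hr hrm1 I.2) S f)).filter fun g => ¬ ∃ x, g x ∈ B
  have hcop : ∀ (I : {I // I ∈ indepSets r m}) (ψ : Fin r → V),
      (fun x : {x // x ∈ I.1} => ψ x) ∈ F I → (fun x : {x // x ∉ I.1} => ψ x) ∈
      sdr (slots (cycleGaps hr hrm1 I.2) S fun x : {x // x ∈ I.1} => ψ x) →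
      ψ ∈ cop (cycleGraph r) G := by
    intro I ψ h1 h2
    rw [hF, evenTuples, mem_filter] at h1
    exact mem_cop_of_isIndepTuple _ (not_adj_of_mem_indepSets (by omega) I.2) hS h1.2.1 h2
  have hbigm : ∀ I, ∀ ψ ∈ big I, ψ ∈ cop (cycleGraph r) G ∧ (∀ x ∈ I.1, ψ x ∉ B) ∧
      ∃ x, x ∉ I.1 ∧ ψ x ∈ B := by
    intro I ψ hψ
    simp only [hbig] at hψ
    rw [mem_filter, mem_filter] at hψ
    obtain ⟨-, h1, h2, x, hx⟩ := hψ
    refine ⟨hcop I ψ h1 h2, fun y hy hyB => ?_, x, x.2, hx⟩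
    rw [hF, evenTuples, mem_filter] at h1
    exact h1.2.2.1 ⟨⟨y, hy⟩, hyB⟩
  have hsmallm : ∀ I, ∀ ψ ∈ small I, ψ ∈ cop (cycleGraph r) G ∧ ∀ x, ψ x ∉ B := by
    intro I ψ hψ
    simp only [hsmall] at hψ
    rw [mem_filter, mem_filter] at hψ
    obtain ⟨-, h1, h2, h3⟩ := hψ
    refine ⟨hcop I ψ h1 h2, fun y hyB => ?_⟩
    rw [hF, evenTuples, mem_filter] at h1
    by_cases hy : y ∈ I.1
    · exact h1.2.2.1 ⟨⟨y, hy⟩, hyB⟩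
    · exact h3 ⟨⟨y, hy⟩, hyB⟩
  have hb : ∑ I, #(big I) = #(univ.biUnion big) := by
    rw [card_biUnion]
    intro I _ J _ hIJ
    change Disjoint (big I) (big J)
    rw [Finset.disjoint_left]
    intro ψ h1 h2
    obtain ⟨-, -, x, hx, hxB⟩ := hbigm I ψ h1
    obtain ⟨-, h3, -⟩ := hbigm J ψ h2
    have hxJ : x ∉ J.1 := fun h => h3 x h hxB
    exact hIJ (Subtype.ext (eq_of_mem_indepSets (x := x) hrm I.2 J.2 (by simp [hx, hxJ])))
  have hs : ∑ I, #(small I) ≤ 2 * #(univ.biUnion small) := by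
    calc ∑ I, #(small I) ≤ ∑ I : {I // I ∈ indepSets r m}, #(univ.biUnion small) :=
          sum_le_sum fun I _ => card_le_card (subset_biUnion_of_mem small (mem_univ I))
      _ ≤ _ := by
          rw [sum_const, smul_eq_mul, card_univ, Fintype.card_coe]
          exact Nat.mul_le_mul_right _ (card_indepSets_le_two (by omega) hrm)
  have hdis : Disjoint (univ.biUnion big) (univ.biUnion small) := by
    rw [Finset.disjoint_left]
    intro ψ h1 h2
    obtain ⟨I, -, h1⟩ := mem_biUnion.1 h1
    obtain ⟨J, -, h2⟩ := mem_biUnion.1 h2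
    obtain ⟨-, -, x, -, hx⟩ := hbigm I ψ h1
    exact (hsmallm J ψ h2).2 x hx
  have hle : #(univ.biUnion big) + #(univ.biUnion small) ≤ #(cop (cycleGraph r) G) := by
    rw [← card_union_of_disjoint hdis]
    refine card_le_card fun ψ hψ => ?_
    rcases mem_union.1 hψ with h | h
    · obtain ⟨I, -, h⟩ := mem_biUnion.1 h
      exact (hbigm I ψ h).1
    · obtain ⟨I, -, h⟩ := mem_biUnion.1 h
      exact (hsmallm I ψ h).1
  calc _ = 2 * ∑ I, #(big I) + ∑ I, #(small I) := by
        rw [mul_sum, ← sum_add_distrib]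
        refine sum_congr rfl fun I _ => ?_
        rw [hbigc, hsmallc, mul_sum, ← sum_add_distrib]
    _ ≤ _ := by omega

/-! ### Odd cycles: edges to small-degree vertices. -/

/-- The even positions of the cycle of length `2 * m + 1`, two of which are adjacent. -/
noncomputable def allEvens (m : ℕ) : Finset (Fin (2 * m + 1)) := {x | x.val % 2 = 0}

lemma mem_allEvens {m : ℕ} {x : Fin (2 * m + 1)} : x ∈ allEvens m ↔ x.val % 2 = 0 := by
  simp [allEvens]

/-- The gaps between the even positions. -/
noncomputable def oddGaps {m : ℕ} (hm : 3 ≤ m) :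
    GapMaps (cycleGraph (2 * m + 1)) (allEvens m) where
  l x := ⟨cprev x.1, by
    have h := x.2
    have h1 := cprev_val x.1
    rw [mem_allEvens] at h ⊢
    omega⟩
  r x := ⟨cnext x.1, by
    have h := x.2
    have h1 := cnext_val x.1
    rw [mem_allEvens] at h ⊢
    omega⟩
  ne x := by
    rw [Ne, Subtype.mk.injEq, Fin.ext_iff]
    have h1 := cprev_val x.1
    have h2 := cnext_val x.1
    omega
  nbr x y h := by
    rcases (cycleGraph_adj_iff (by omega)).1 h with h | h
    · right; ext1; exact h
    · left; ext1; change y.1 = cprev x.1; rw [h, cprev_cnext]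
  same x y h := by
    exfalso
    have hx := x.2
    have hy := y.2
    have h1 := cnext_val x.1
    have h2 := cnext_val y.1
    have := x.1.2
    have := y.1.2
    rw [mem_allEvens] at hx hy
    rcases (cycleGraph_adj_iff (by omega)).1 h with h | h
    · rw [← h] at h1; omega
    · rw [← h] at h2; omega

lemma card_not_allEvens (m : ℕ) : Fintype.card {x // x ∉ allEvens m} ≤ m := by
  have h : Fintype.card {x // x ∉ allEvens m} ≤ Fintype.card (Fin m) := by
    refine Fintype.card_le_of_injective (fun x => ⟨x.1.val / 2, by
      have := x.2; have := x.1.2; rw [mem_allEvens] at *; omega⟩) fun x y hxy => ?_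
    have hx := x.2
    have hy := y.2
    rw [mem_allEvens] at hx hy
    simp only [Fin.mk.injEq] at hxy
    ext
    omega
  rwa [Fintype.card_fin] at h

/-- Put `w` at position 2m, next to position 0 on the cycle. The odd positions form `m`
single-vertex gaps whose ends are never the adjacent pair 0, 2m, so their slots exist and have `k ≥
m` elements. A slot vertex equal to a tuple value would be adjacent to both ends of its gap, but the
edge at `w` is the only one among these values. -/
lemma exists_cop_of_edge {m k : ℕ} (hm : 3 ≤ m) (hk : m ≤ k) {V : Type*} [Fintype V]
    {G : SimpleGraph V} {S : V → V → Finset V} (hS : IsSelector G k S)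
    {I : Finset (Fin (2 * m + 1))}
    (hI : I = evens (2 * m + 1) m) {f : {x // x ∈ I} → V} (hf : IsIndepTuple G f)
    {z : {x // x ∈ I}} (hz : z.1.val = 0) {w : V} (hw : G.Adj (f z) w)
    (hw' : ∀ i, i ≠ z → ¬ G.Adj w (f i)) :
    ∃ ψ ∈ cop (cycleGraph (2 * m + 1)) G, (∀ i, ψ i.1 = f i) ∧ ψ ⟨2 * m, by omega⟩ = w := by
  have hIe : ∀ x : Fin (2 * m + 1), x ∈ I ↔ x.val % 2 = 0 ∧ x.val < 2 * m := fun x => by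
    rw [hI, mem_evens]
  let b : Fin (2 * m + 1) := ⟨2 * m, by omega⟩
  have hbI : b ∉ I := by rw [hIe]; simp [b]
  set F : {x // x ∈ allEvens m} → V := fun x => if h : x.1 ∈ I then f ⟨x, h⟩ else w with hF
  have hFI : ∀ (x : {x // x ∈ allEvens m}) (h : x.1 ∈ I), F x = f ⟨x, h⟩ := fun x h => by
    simp [hF, h]
  have hFb : ∀ x : {x // x ∈ allEvens m}, x.1 ∉ I → F x = w := fun x h => by
    simp [hF, h]
  have hnb : ∀ x : {x // x ∈ allEvens m}, x.1 ∉ I → x.1.val = 2 * m := fun x h => by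
    have h1 := x.2
    have := x.1.2
    rw [mem_allEvens] at h1
    rw [hIe] at h
    omega
  have hpair : ∀ x y : {x // x ∈ allEvens m}, x ≠ y → F x ≠ F y ∧
      (G.Adj (F x) (F y) → (x.1.val = 0 ∧ y.1.val = 2 * m) ∨ (x.1.val = 2 * m ∧ y.1.val = 0)) := by
    have key : ∀ (i : {x // x ∈ I}), f i ≠ w ∧ (G.Adj (f i) w → i.1.val = 0) := by
      intro i
      by_cases hiz : i = z
      · rw [hiz]; exact ⟨hw.ne, fun _ => hz⟩
      · refine ⟨fun h => (hf z i (Ne.symm hiz)).2 (by rw [h]; exact hw),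
          fun h => absurd h.symm (hw' i hiz)⟩
    intro x y hxy
    by_cases hx : x.1 ∈ I <;> by_cases hy : y.1 ∈ I
    · rw [hFI x hx, hFI y hy]
      have := hf ⟨x, hx⟩ ⟨y, hy⟩ (fun h => hxy (Subtype.ext (Subtype.mk.inj h)))
      exact ⟨this.1, fun h => absurd h this.2⟩
    · rw [hFI x hx, hFb y hy]
      exact ⟨(key _).1, fun h => Or.inl ⟨(key _).2 h, hnb y hy⟩⟩
    · rw [hFI y hy, hFb x hx]
      exact ⟨(key _).1.symm, fun h => Or.inr ⟨hnb x hx, (key _).2 h.symm⟩⟩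
    · exact absurd (Subtype.ext (Fin.ext ((hnb x hx).trans (hnb y hy).symm))) hxy
  set D := oddGaps hm with hD
  have hDl : ∀ x, (D.l x).1 = cprev x.1 := fun x => rfl
  have hDr : ∀ x, (D.r x).1 = cnext x.1 := fun x => rfl
  have hgap : ∀ x, ¬ G.Adj (F (D.l x)) (F (D.r x)) := by
    intro x h
    have h1 := (hpair _ _ (D.ne x)).2 h
    rw [hDl, hDr] at h1
    have h2 := cprev_val x.1
    have h3 := cnext_val x.1
    omega
  have hSx := fun x => hS _ _ (hpair _ _ (D.ne x)).1 (hgap x)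
  obtain ⟨g, hg⟩ : (sdr (slots D S F)).Nonempty := by
    rw [← card_pos]
    refine lt_of_lt_of_le (Nat.descFactorial_pos.2 ?_)
      (descFactorial_le_card_sdr _ k (slots D S F) rfl ?_ fun x => (hSx x).1.ge)
    · exact (card_not_allEvens m).trans hk
    · exact (card_not_allEvens m).trans hk
  set ψ : Fin (2 * m + 1) → V := fun x => if h : x ∈ allEvens m then F ⟨x, h⟩ else g ⟨x, h⟩ with hψ
  have hψF : ∀ x : {x // x ∈ allEvens m}, ψ x = F x := fun x => by simp [hψ, x.2]
  have hψg : ∀ x : {x // x ∉ allEvens m}, ψ x = g x := fun x => by simp [hψ, x.2]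
  have hIall : ∀ x ∈ I, x ∈ allEvens m := fun x hx => mem_allEvens.2 ((hIe x).1 hx).1
  refine ⟨ψ, ?_, fun i => ?_, ?_⟩
  · refine mem_cop_of_gapMaps D hS (fun x y hxy => ?_) (fun x y hxy => ?_) (fun x => ?_) ?_ ?_
    · rw [hψF, hψF]; exact (hpair x y hxy).1
    · rw [hψF, hψF]
      have key : ∀ x y : {x // x ∈ allEvens m}, y.1 = cnext x.1 → G.Adj (F x) (F y) := by
        intro x y h
        have hx := mem_allEvens.1 x.2
        have hy := mem_allEvens.1 y.2
        have h1 := cnext_val x.1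
        rw [← h] at h1
        have hxI : x.1 ∉ I := by rw [hIe]; omega
        have hyI : y.1 ∈ I := by rw [hIe]; omega
        rw [hFb x hxI, hFI y hyI]
        have : (⟨y.1, hyI⟩ : {x // x ∈ I}) = z := by ext; simp only; omega
        rw [this]
        exact hw.symm
      rcases (cycleGraph_adj_iff (by omega)).1 hxy with h | h
      · exact key x y h
      · exact (key y x h).symm
    · rw [hψF, hψF]; exact hgap x
    · have h1 : (fun x : {x // x ∉ allEvens m} => ψ x) = g := funext hψg
      have h2 : (fun x : {x // x ∈ allEvens m} => ψ x) = F := funext hψF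
      rw [h1, h2]
      exact hg
    · intro x y
      rw [hψg, hψF]
      intro h
      have h1 := (hSx x).2.1 _ ((mem_sdr.1 hg).1 x)
      rw [h] at h1
      have h2 : y ≠ D.l x := fun h => h1.1.ne (by rw [h])
      have h3 : y ≠ D.r x := fun h => h1.2.ne (by rw [h])
      have h4 := (hpair _ _ (Ne.symm h2)).2 h1.1
      have h5 := (hpair _ _ (Ne.symm h3)).2 h1.2
      refine D.ne x (Subtype.ext (Fin.ext ?_))
      omega
  · have := hψF ⟨i.1, hIall _ i.2⟩
    rw [this, hFI _ i.2]
  · have hb : b ∈ allEvens m := mem_allEvens.2 (by simp [b])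
    have := hψF ⟨b, hb⟩
    rw [hFb _ hbI] at this
    exact this

/-- Vertices with many neighbours of small degree yield many odd cycles. -/
lemma mul_card_le_card_cop {m k : ℕ} (hm : 3 ≤ m) (hk : m ≤ k) {V : Type*} [Fintype V]
    [Nonempty V]
    {G : SimpleGraph V} {S : V → V → Finset V} (hS : IsSelector G k S) {ε : ℝ}
    (hε : 0 < ε) {K : ℕ} (hK : #(bigSet G ε) ≤ K) (hn : (K + 1 : ℝ) ≤ ε * Fintype.card V)
    {d : ℕ} {Γ : Finset V} {N : V → Finset V} (hN : ∀ a ∈ Γ, #(N a) = d)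
    (hN' : ∀ a ∈ Γ, ∀ w ∈ N a, G.Adj a w ∧ w ∉ bigSet G ε) :
    (#Γ * d : ℝ) * (Fintype.card V : ℝ) ^ (m - 1) ≤
      #(cop (cycleGraph (2 * m + 1)) G) +
        d * ((2 * m ^ 2 + m) * ε * (Fintype.card V : ℝ) ^ m) := by
  set n := Fintype.card V with hn'
  set I := evens (2 * m + 1) m with hI
  have hIm : Fintype.card {x // x ∈ I} = m := by
    rw [Fintype.card_coe, (mem_indepSets.1 (evens_mem_indepSets (by omega))).1]
  let z : {x // x ∈ I} := ⟨⟨0, by omega⟩, by rw [hI, mem_evens]; simp; omega⟩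
  set N' : V → Finset V := fun a => if a ∈ Γ then N a else ∅ with hNdef
  have hN'card : ∀ a, #(N' a) = if a ∈ Γ then d else 0 := fun a => by
    simp only [hNdef]
    split_ifs with h
    · exact hN a h
    · exact card_empty
  have hN'le : ∀ a, #(N' a) ≤ d := fun a => by rw [hN'card]; split_ifs <;> omega
  have hN'mem : ∀ a, ∀ w ∈ N' a, G.Adj a w ∧ w ∉ bigSet G ε := fun a w hw => by
    simp only [hNdef] at hw
    split_ifs at hw with h
    · exact hN' a h w hw
    · exact absurd hw (notMem_empty w)
  -- Pairs of a tuple and an extra vertex `w` to which `exists_cop_of_edge` applies; the resulting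
  -- cycle returns both, so the map to cycles is injective.
  set P : Finset (Σ _ : {x // x ∈ I} → V, V) :=
    (univ : Finset ({x // x ∈ I} → V)).sigma fun f =>
      {w ∈ N' (f z) | IsIndepTuple G f ∧ ∀ i, i ≠ z → ¬ G.Adj w (f i)} with hP
  have hPcop : #P ≤ #(cop (cycleGraph (2 * m + 1)) G) := by
    have hex : ∀ p ∈ P, ∃ ψ ∈ cop (cycleGraph (2 * m + 1)) G,
        (∀ i, ψ i.1 = p.1 i) ∧ ψ ⟨2 * m, by omega⟩ = p.2 := by
      intro p hp
      rw [hP, mem_sigma, mem_filter] at hp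
      obtain ⟨-, hp1, hp2, hp3⟩ := hp
      exact exists_cop_of_edge hm hk hS hI hp2 (z := z) rfl (hN'mem _ _ hp1).1 hp3
    choose! φ hφ1 hφ2 hφ3 using hex
    refine card_le_card_of_injOn φ hφ1 fun p hp q hq hpq => ?_
    have h1 : p.1 = q.1 := funext fun i => by rw [← hφ2 p hp, ← hφ2 q hq, hpq]
    have h2 : p.2 = q.2 := by rw [← hφ3 p hp, ← hφ3 q hq, hpq]
    obtain ⟨p1, p2⟩ := p
    obtain ⟨q1, q2⟩ := q
    simp only at h1 h2
    rw [h1, h2]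
  have hPc : #P = ∑ f : {x // x ∈ I} → V,
      #{w ∈ N' (f z) | IsIndepTuple G f ∧ ∀ i, i ≠ z → ¬ G.Adj w (f i)} := card_sigma _ _
  -- A choice of `w` is spoilt only if the tuple is not independent or `w` is adjacent to another
  -- coordinate; the latter is rare because `w` has small degree.
  have hpoint : ∀ f : {x // x ∈ I} → V, #(N' (f z)) ≤
      #{w ∈ N' (f z) | IsIndepTuple G f ∧ ∀ i, i ≠ z → ¬ G.Adj w (f i)} +
      ((if ¬ IsIndepTuple G f then d else 0) +
        ∑ i ∈ univ.erase z, #{w ∈ N' (f z) | G.Adj w (f i)}) := by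
    intro f
    by_cases hf : IsIndepTuple G f
    · have h1 : N' (f z) ⊆ {w ∈ N' (f z) | IsIndepTuple G f ∧ ∀ i, i ≠ z → ¬ G.Adj w (f i)} ∪
          (univ.erase z).biUnion fun i => {w ∈ N' (f z) | G.Adj w (f i)} := by
        intro w hw
        by_cases h : ∀ i, i ≠ z → ¬ G.Adj w (f i)
        · exact mem_union_left _ (mem_filter.2 ⟨hw, hf, h⟩)
        · push Not at h
          obtain ⟨i, hi, hwi⟩ := h
          exact mem_union_right _ (mem_biUnion.2
            ⟨i, mem_erase.2 ⟨hi, mem_univ _⟩, mem_filter.2 ⟨hw, hwi⟩⟩)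
      refine (card_le_card h1).trans ((card_union_le _ _).trans (Nat.add_le_add_left ?_ _))
      exact card_biUnion_le.trans (Nat.le_add_left _ _)
    · rw [if_pos hf]
      have := hN'le (f z)
      omega
  have hsum := sum_le_sum fun f (_ : f ∈ (univ : Finset ({x // x ∈ I} → V))) => hpoint f
  rw [sum_add_distrib, sum_add_distrib, ← hPc, sum_tuple_one z (fun a => #(N' a)),
    hIm, ← hn', sum_comm, ← sum_filter, sum_const, smul_eq_mul] at hsum
  have hNsum : ∑ a, #(N' a) = #Γ * d := by
    simp_rw [hN'card]
    rw [← sum_filter, sum_const, smul_eq_mul, filter_mem_eq_inter, univ_inter]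
  rw [hNsum] at hsum
  have hi : ∀ i ∈ univ.erase z, (∑ f : {x // x ∈ I} → V, #{w ∈ N' (f z) | G.Adj w (f i)} : ℝ) ≤
      d * (ε * (n : ℝ) ^ m) := by
    intro i hi
    rw [mem_erase] at hi
    have h1 := sum_tuple_two (V := V) (Ne.symm hi.1) (fun a b => #{w ∈ N' a | G.Adj w b})
    rw [hIm, ← hn'] at h1
    have h2 : ∀ a, (∑ b, (#{w ∈ N' a | G.Adj w b} : ℝ)) ≤ d * (ε * n) := by
      intro a
      have h3 : ∑ b, #{w ∈ N' a | G.Adj w b} = ∑ w ∈ N' a, #{b | G.Adj w b} :=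
        sum_card_bipartiteAbove_eq_sum_card_bipartiteBelow (fun (b w : V) => G.Adj w b)
      have h4 : (∑ b, (#{w ∈ N' a | G.Adj w b} : ℝ)) = ∑ w ∈ N' a, (#{b | G.Adj w b} : ℝ) := by
        exact_mod_cast h3
      rw [h4]
      calc _ ≤ ∑ w ∈ N' a, ε * n := by
            refine sum_le_sum fun w hw => ?_
            have h5 := (hN'mem a w hw).2
            rw [mem_bigSet, not_le] at h5
            exact h5.le
        _ = #(N' a) * (ε * n) := by rw [sum_const, nsmul_eq_mul]
        _ ≤ _ := by
            gcongr
            exact hN'le a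
    have h3 : (∑ f : {x // x ∈ I} → V, #{w ∈ N' (f z) | G.Adj w (f i)} : ℝ) =
        (n : ℝ) ^ (m - 2) * ∑ a, ∑ b, (#{w ∈ N' a | G.Adj w b} : ℝ) := by exact_mod_cast h1
    rw [h3]
    calc _ ≤ (n : ℝ) ^ (m - 2) * ∑ a : V, d * (ε * n) := by
          gcongr with a _
          exact h2 a
      _ = d * (ε * ((n : ℝ) ^ (m - 2) * n ^ 2)) := by
          rw [sum_const, card_univ, ← hn', nsmul_eq_mul]; ring
      _ = _ := by rw [← pow_add]; congr 3; omega
  have hni := card_not_isIndepTuple_le' (α := {x // x ∈ I}) G hε hK hn hIm (by omega)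
  rw [← hn'] at hni
  have hsum' : (n : ℝ) ^ (m - 1) * (#Γ * d) ≤ #P +
      (#{f : {x // x ∈ I} → V | ¬ IsIndepTuple G f} * d +
      ∑ i ∈ univ.erase z, ∑ f : {x // x ∈ I} → V, (#{w ∈ N' (f z) | G.Adj w (f i)} : ℝ)) := by
    exact_mod_cast hsum
  have hPcop' : (#P : ℝ) ≤ #(cop (cycleGraph (2 * m + 1)) G) := by exact_mod_cast hPcop
  have h1 := sum_le_sum hi
  rw [sum_const, card_erase_of_mem (mem_univ _), card_univ, hIm, nsmul_eq_mul] at h1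
  have h2 : ((m - 1 : ℕ) : ℝ) * (d * (ε * (n : ℝ) ^ m)) ≤ m * (d * (ε * (n : ℝ) ^ m)) := by
    gcongr
    omega
  have h3 : (#{f : {x // x ∈ I} → V | ¬ IsIndepTuple G f} : ℝ) * d ≤
      2 * m ^ 2 * ε * (n : ℝ) ^ m * d := by gcongr
  linarith

/-- Independent tuples avoiding `B`, whose slots are contained in `B`. -/
noncomputable def oddTuples {r m : ℕ} (hr : 6 ≤ r) (hrm : r ≤ 2 * m + 1) {V : Type*}
    [Fintype V] (G : SimpleGraph V) (S : V → V → Finset V) (B : Finset V)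
    (I : {I // I ∈ indepSets r m}) : Finset ({x // x ∈ I.1} → V) :=
  {f | IsIndepTuple G f ∧ (¬ ∃ i, f i ∈ B) ∧ ∀ x, slots (cycleGaps hr hrm I.2) S f x ⊆ B}

/-- A slot not inside `B` contains a small-degree vertex adjacent to both ends of its gap. Unless
the left end is one of the at most γn exceptional vertices, it has fewer than `d` small-degree
neighbours, which leave at most dεn values for the right end. -/
lemma le_card_oddTuples {r m k : ℕ} (hr : 6 ≤ r) (hm : 3 ≤ m) (hrm : r ≤ 2 * m + 1) {V : Type*}
    [Fintype V] {G : SimpleGraph V} {S : V → V → Finset V} (hS : IsSelector G k S) {ε γ : ℝ}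
    (hε : 0 < ε) {K d : ℕ} (hK : #(bigSet G ε) ≤ K) (hn : (K + 1 : ℝ) ≤ ε * Fintype.card V)
    (hΓ : (#{v | d ≤ #{w | G.Adj v w ∧ w ∉ bigSet G ε}} : ℝ) ≤ γ * Fintype.card V)
    (I : {I // I ∈ indepSets r m}) :
    (1 - ((2 * m ^ 2 + m) * ε + r * (γ + d * ε))) * (Fintype.card V : ℝ) ^ m ≤
      #(oddTuples hr hrm G S (bigSet G ε) I) := by
  set n := Fintype.card V with hn'
  set B := bigSet G ε with hB
  set g := cycleGaps hr hrm I.2 with hg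
  set Γ : Finset V := {v | d ≤ #{w | G.Adj v w ∧ w ∉ B}} with hΓdef
  have hIm : Fintype.card {x // x ∈ I.1} = m := by
    rw [Fintype.card_coe, (mem_indepSets.1 I.2).1]
  have h1 := card_not_isIndepTuple_le' (α := {x // x ∈ I.1}) G hε hK hn hIm (by omega)
  have h2 := card_hitting_le (α := {x // x ∈ I.1}) (B := B) (ε := ε) hK hn hIm (by omega)
  rw [← hn'] at h1 h2
  set X : {x // x ∉ I.1} → Finset ({x // x ∈ I.1} → V) := fun x =>
    {f | IsIndepTuple G f ∧ ¬ slots g S f x ⊆ B} with hX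
  have hpair : ∀ a, (#{b | (a ≠ b ∧ ¬ G.Adj a b) ∧ ¬ S a b ⊆ B} : ℝ) ≤
      (if a ∈ Γ then (n : ℝ) else 0) + d * (ε * n) := by
    intro a
    split_ifs with ha
    · have : (#{b | (a ≠ b ∧ ¬ G.Adj a b) ∧ ¬ S a b ⊆ B} : ℝ) ≤ n := by
        exact_mod_cast card_le_univ _
      have : 0 ≤ d * (ε * n) := by positivity
      linarith
    · rw [zero_add]
      set T : Finset V := {w | G.Adj a w ∧ w ∉ B} with hT
      have hTd : #T ≤ d := by
        simp only [hΓdef, mem_filter, mem_univ, true_and, not_le] at ha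
        exact ha.le
      calc (#{b | (a ≠ b ∧ ¬ G.Adj a b) ∧ ¬ S a b ⊆ B} : ℝ)
          ≤ #{b | ∃ z ∈ T, z ∉ bigSet G ε ∧ G.Adj z b} := by
            norm_cast
            refine card_le_card fun b hb => ?_
            rw [mem_filter] at hb ⊢
            obtain ⟨-, hab, hsub⟩ := hb
            obtain ⟨z, hz, hzB⟩ := not_subset.1 hsub
            have h3 := (hS a b hab.1 hab.2).2.1 z hz
            exact ⟨mem_univ _, z, mem_filter.2 ⟨mem_univ _, h3.1, hzB⟩, hzB, h3.2.symm⟩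
        _ ≤ #T * (ε * n) := card_filter_small_nbr_le hε.le T
        _ ≤ _ := by gcongr
  have hXcard : ∀ x, (#(X x) : ℝ) ≤ (γ + d * ε) * (n : ℝ) ^ m := by
    intro x
    have h3 := card_tuple_two (V := V) (g.ne x)
      (fun a b => (a ≠ b ∧ ¬ G.Adj a b) ∧ ¬ S a b ⊆ B)
    rw [hIm, ← hn'] at h3
    have h4 : #(X x) ≤ n ^ (m - 2) * ∑ a, #{b | (a ≠ b ∧ ¬ G.Adj a b) ∧ ¬ S a b ⊆ B} := by
      rw [← h3]
      refine card_le_card fun f hf => ?_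
      simp only [hX] at hf
      rw [mem_filter] at hf ⊢
      exact ⟨mem_univ _, hf.2.1 _ _ (g.ne x), hf.2.2⟩
    have h5 : (#(X x) : ℝ) ≤ (n : ℝ) ^ (m - 2) *
        ∑ a, (#{b | (a ≠ b ∧ ¬ G.Adj a b) ∧ ¬ S a b ⊆ B} : ℝ) := by exact_mod_cast h4
    refine h5.trans ?_
    calc _ ≤ (n : ℝ) ^ (m - 2) * ∑ a : V, ((if a ∈ Γ then (n : ℝ) else 0) + d * (ε * n)) := by
          gcongr with a _
          exact hpair a
      _ = (n : ℝ) ^ (m - 2) * (#Γ * n + n * (d * (ε * n))) := by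
          rw [sum_add_distrib, ← sum_filter, sum_const, sum_const, card_univ, ← hn',
            nsmul_eq_mul, nsmul_eq_mul, filter_mem_eq_inter, univ_inter]
      _ ≤ (n : ℝ) ^ (m - 2) * (γ * n * n + n * (d * (ε * n))) := by gcongr
      _ = (γ + d * ε) * ((n : ℝ) ^ (m - 2) * n ^ 2) := by ring
      _ = _ := by rw [← pow_add]; congr 2; omega
  have hcover : (univ : Finset ({x // x ∈ I.1} → V)) ⊆
      oddTuples hr hrm G S B I ∪
        (({f | ¬ IsIndepTuple G f} : Finset ({x // x ∈ I.1} → V)) ∪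
        (({f | ∃ i, f i ∈ B} : Finset ({x // x ∈ I.1} → V)) ∪ univ.biUnion X)) := by
    intro f _
    by_contra hf
    simp only [mem_union, not_or] at hf
    obtain ⟨hf1, hf2, hf3, hf4⟩ := hf
    rw [mem_filter] at hf2 hf3
    simp only [mem_univ, true_and, not_not] at hf2 hf3
    refine hf1 (mem_filter.2 ⟨mem_univ _, hf2, hf3, fun x => ?_⟩)
    by_contra hsub
    exact hf4 (mem_biUnion.2 ⟨x, mem_univ _, mem_filter.2 ⟨mem_univ _, hf2, hsub⟩⟩)
  have h3 := card_le_card hcover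
  have h4 := h3.trans ((card_union_le _ _).trans (Nat.add_le_add_left ((card_union_le _ _).trans
    (Nat.add_le_add_left ((card_union_le _ _).trans (Nat.add_le_add_left card_biUnion_le _)) _)) _))
  rw [card_univ, Fintype.card_fun, hIm, ← hn'] at h4
  have h5 : ((n : ℝ)) ^ m ≤ #(oddTuples hr hrm G S B I) +
      (#({f | ¬ IsIndepTuple G f} : Finset ({x // x ∈ I.1} → V)) +
      (#({f | ∃ i, f i ∈ B} : Finset ({x // x ∈ I.1} → V)) + ∑ x, (#(X x) : ℝ))) := by
    exact_mod_cast h4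
  have h0 : 0 ≤ γ * n := (Nat.cast_nonneg _).trans hΓ
  have hpos : 0 ≤ (γ + d * ε) * (n : ℝ) ^ m := by
    have : (γ + d * ε) * (n : ℝ) ^ m = (γ * n + d * ε * n) * (n : ℝ) ^ (m - 1) := by
      rw [← add_mul, mul_assoc, ← pow_succ', Nat.sub_add_cancel (by omega)]
    rw [this]
    positivity
  have h6 : (∑ x, (#(X x) : ℝ)) ≤ r * ((γ + d * ε) * (n : ℝ) ^ m) := by
    refine (sum_le_sum fun x _ => hXcard x).trans ?_
    rw [sum_const, card_univ, card_notMem_subtype, nsmul_eq_mul]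
    have h6 : ((r - #I.1 : ℕ) : ℝ) ≤ r := by exact_mod_cast Nat.sub_le _ _
    gcongr
  linarith

/-- Here the positions mapped outside `B` are exactly those of `I`, so no cycle is counted for two
sets `I`. -/
lemma sum_odd_weights_le {r m k : ℕ} (hr : 6 ≤ r) (hrm : r ≤ 2 * m + 1) {V : Type*}
    [Fintype V] {G : SimpleGraph V} {S : V → V → Finset V} (hS : IsSelector G k S)
    (B : Finset V) :
    ∑ I : {I // I ∈ indepSets r m}, ∑ f ∈ oddTuples hr hrm G S B I,
      #(sdr (slots (cycleGaps hr hrm I.2) S f)) ≤ #(cop (cycleGraph r) G) := by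
  set F := oddTuples hr hrm G S B with hF
  set Ψ : {I // I ∈ indepSets r m} → Finset (Fin r → V) := fun I =>
    {ψ | (fun x : {x // x ∈ I.1} => ψ x) ∈ F I ∧ (fun x : {x // x ∉ I.1} => ψ x) ∈
      sdr (slots (cycleGaps hr hrm I.2) S fun x : {x // x ∈ I.1} => ψ x)} with hΨ
  have hΨc : ∀ I, #(Ψ I) = ∑ f ∈ F I, #(sdr (slots (cycleGaps hr hrm I.2) S f)) := fun I =>
    card_filter_glue I.1 (F I) fun f => sdr (slots (cycleGaps hr hrm I.2) S f)
  have hmem : ∀ I, ∀ ψ ∈ Ψ I, ψ ∈ cop (cycleGraph r) G ∧ ∀ x, x ∈ I.1 ↔ ψ x ∉ B := by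
    intro I ψ hψ
    simp only [hΨ] at hψ
    rw [mem_filter] at hψ
    obtain ⟨-, h1, h2⟩ := hψ
    rw [hF, oddTuples, mem_filter] at h1
    refine ⟨mem_cop_of_isIndepTuple _ (not_adj_of_mem_indepSets (by omega) I.2) hS h1.2.1 h2,
      fun x => ⟨fun hx hxB => h1.2.2.1 ⟨⟨x, hx⟩, hxB⟩, fun hx => ?_⟩⟩
    by_contra hxI
    exact hx (h1.2.2.2 ⟨x, hxI⟩ ((mem_sdr.1 h2).1 ⟨x, hxI⟩))
  simp_rw [← hΨc]
  rw [← card_biUnion]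
  · refine card_le_card fun ψ hψ => ?_
    obtain ⟨I, -, h⟩ := mem_biUnion.1 hψ
    exact (hmem I ψ h).1
  · intro I _ J _ hIJ
    change Disjoint (Ψ I) (Ψ J)
    rw [Finset.disjoint_left]
    intro ψ h1 h2
    refine hIJ (Subtype.ext (Finset.ext fun x => ?_))
    rw [(hmem I ψ h1).2, (hmem J ψ h2).2]

/-! ### Few cycles force a clique with almost all vertices as common neighbours. -/

lemma stability_constants {P D c δ : ℝ} (hP : 0 ≤ P) (hD : 0 ≤ D) (hc : 0 < c) (hδ : 0 < δ) :
    0 < c * δ / (4 * (P * D + c)) ∧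
      P * D * (c * δ / (4 * (P * D + c))) + c * δ / 4 < c * (δ - c * δ / (4 * (P * D + c))) := by
  have h1 : 0 < P * D + c := by positivity
  refine ⟨by positivity, ?_⟩
  have h2 : (P * D + c) * (c * δ / (4 * (P * D + c))) = c * δ / 4 := by field_simp
  have h3 : 0 < c * δ := by positivity
  linarith

lemma add_mul_pow_le {n P C e : ℝ} {m : ℕ} (hm : 1 ≤ m) (hn : 0 < n) (he : 0 < e)
    (h : C / e ≤ n) : P * n ^ m + C * n ^ (m - 1) ≤ (P + e) * n ^ m := by
  rw [div_le_iff₀ he] at h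
  have h1 : n ^ m = n * n ^ (m - 1) := by rw [← pow_succ', Nat.sub_add_cancel hm]
  have h2 : C * n ^ (m - 1) ≤ n * e * n ^ (m - 1) := by gcongr
  rw [h1]
  linarith

/-- Saturated graphs with few cycles of even length `2 * m` have a clique with many common
neighbours. -/
theorem exists_clique_of_few_even_cycles {m s : ℕ} (hm : 3 ≤ m) (hk : m ≤ s - 2)
    (hkm : 4 * (s - 2) ≤ m ^ 2) {δ : ℝ} (hδ : 0 < δ) (hδ1 : δ ≤ 1) {C₀ : ℝ} (hC₀ : 0 ≤ C₀) :
    ∃ n₀ : ℕ, ∀ (V : Type) [Fintype V] (G : SimpleGraph V), n₀ ≤ Fintype.card V →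
      IsSaturated (completeGraph (Fin s)) G →
      (#(cop (cycleGraph (2 * m)) G) : ℝ) ≤ #(indepSets (2 * m) m) * (s - 2).descFactorial m *
        (Fintype.card V : ℝ) ^ m + C₀ * (Fintype.card V : ℝ) ^ (m - 1) →
      ∃ A : Finset V, #A = s - 2 ∧ (∀ x ∈ A, ∀ y ∈ A, x ≠ y → G.Adj x y) ∧
        (1 - δ) * Fintype.card V ≤ #(commonNbrs G A) := by
  set k := s - 2 with hkdef
  set D : ℝ := (k.descFactorial m : ℝ) with hD
  set P : ℝ := (#(indepSets (2 * m) m) : ℝ) with hP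
  have hk0 : (0 : ℝ) < (k : ℝ) ^ m := by
    have : (0 : ℝ) < k := by exact_mod_cast (by omega : 0 < k)
    positivity
  -- The unit gain of `descFactorial_le_weight_sdr`, after dividing its inequality by 2k^m.
  set c : ℝ := 1 / (2 * (k : ℝ) ^ m) with hc
  have hc0 : 0 < c := by positivity
  have hD0 : 0 ≤ D := Nat.cast_nonneg _
  have hP0 : 0 ≤ P := Nat.cast_nonneg _
  obtain ⟨hζ, hδζ⟩ := stability_constants hP0 hD0 hc0 hδ
  set ζ := c * δ / (4 * (P * D + c))
  set e := c * δ / 4 with he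
  have he0 : 0 < e := by positivity
  set q : ℝ := 2 * m ^ 2 + m + (2 * m : ℕ) ^ 2 * k with hq
  have hq0 : 0 < q := by
    have : (0 : ℝ) < m := by exact_mod_cast (by omega : 0 < m)
    positivity
  -- The tuples discarded by `le_card_evenTuples` then form a fraction qε = ζ.
  set ε := ζ / q with hε
  have hε0 : 0 < ε := by positivity
  obtain ⟨K, n₁, hn₁⟩ := exists_card_cop_gt_of_many_big (s := s) hm (Or.inl rfl : 2 * m = 2 * m ∨ _)
    (by omega) hε0 (P * D + C₀)
  refine ⟨n₁ + ⌈(K + 1) / ε⌉₊ + ⌈C₀ / e⌉₊ + 1, fun V _ G hn hG hcop => ?_⟩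
  set n := Fintype.card V with hn'
  have hV : Nonempty V := Fintype.card_pos_iff.1 (by omega)
  have hn0 : (1 : ℝ) ≤ n := by exact_mod_cast (by omega : 1 ≤ n)
  have hn2 : (K + 1 : ℝ) ≤ ε * n := by
    have h1 : (⌈(K + 1) / ε⌉₊ : ℝ) ≤ n := Nat.cast_le.2 (by omega)
    have h2 := (Nat.le_ceil _).trans h1
    rw [div_le_iff₀ hε0] at h2
    linarith
  have hn3 : C₀ / e ≤ n := by
    have h1 : (⌈C₀ / e⌉₊ : ℝ) ≤ n := Nat.cast_le.2 (by omega)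
    exact (Nat.le_ceil _).trans h1
  have hcop1 : (#(cop (cycleGraph (2 * m)) G) : ℝ) ≤ (P * D + e) * (n : ℝ) ^ m :=
    hcop.trans (add_mul_pow_le (by omega) (by linarith) he0 hn3)
  have hK : #(bigSet G ε) ≤ K := by
    by_contra! h
    have h1 := hn₁ V G (by omega) hG h.le
    have h2 : (n : ℝ) ^ (m - 1) ≤ (n : ℝ) ^ m := pow_le_pow_right₀ hn0 (by omega)
    have h3 : C₀ * (n : ℝ) ^ (m - 1) ≤ C₀ * (n : ℝ) ^ m := by gcongr
    rw [← hn'] at h1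
    linarith
  obtain ⟨S, hS⟩ := exists_isSelector' hG
  have hr : 6 ≤ 2 * m := by omega
  have hrm : 2 * m ≤ 2 * m + 1 := by omega
  set B := bigSet G ε with hB
  have hweight : ∀ I : {I // I ∈ indepSets (2 * m) m}, ∀ f ∈ evenTuples hr hrm G S B I, ∀ c : ℕ,
      (c = 0 ∨ c = 1 ∧ ∃ x y, slots (cycleGaps hr hrm I.2) S f x ≠
        slots (cycleGaps hr hrm I.2) S f y) →
      D + c * (1 / (2 * (k : ℝ) ^ m)) ≤
        (#{g ∈ sdr (slots (cycleGaps hr hrm I.2) S f) | ∃ x, g x ∈ B} : ℝ) +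
        #{g ∈ sdr (slots (cycleGaps hr hrm I.2) S f) | ¬ ∃ x, g x ∈ B} / 2 := by
    intro I f hf c hc
    rw [evenTuples, mem_filter] at hf
    have hM : Fintype.card {x // x ∉ I.1} = m := by
      rw [card_notMem_subtype, (mem_indepSets.1 I.2).1]; omega
    have h1 := descFactorial_le_weight_sdr B (slots (cycleGaps hr hrm I.2) S f) (k := k)
      (by rw [hM]; exact hk)
      (fun x => (hS _ _ (hf.2.1 _ _ (GapMaps.ne _ x)).1 (hf.2.1 _ _ (GapMaps.ne _ x)).2).1)
      hf.2.2.2 (by rw [hM]; exact two_mul_descFactorial_lt hm hk hkm) c hc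
    rw [hM] at h1
    have h2 : 2 * (k : ℝ) ^ m * D + c ≤ (k : ℝ) ^ m *
        (2 * #{g ∈ sdr (slots (cycleGaps hr hrm I.2) S f) | ∃ x, g x ∈ B} +
        #{g ∈ sdr (slots (cycleGaps hr hrm I.2) S f) | ¬ ∃ x, g x ∈ B}) := by
      rw [hD]
      exact_mod_cast h1
    refine le_of_mul_le_mul_left ?_ (by positivity : 0 < 2 * (k : ℝ) ^ m)
    have h3 : 2 * (k : ℝ) ^ m * (D + c * (1 / (2 * (k : ℝ) ^ m))) = 2 * (k : ℝ) ^ m * D + c := by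
      field_simp
    rw [h3]
    linarith
  obtain ⟨a, b, hab, hadj, hcommon⟩ := exists_clique_of_weights hr hm hrm le_rfl hS
    (evenTuples hr hrm G S B)
    (fun I f => (#{g ∈ sdr (slots (cycleGaps hr hrm I.2) S f) | ∃ x, g x ∈ B} : ℝ) +
      #{g ∈ sdr (slots (cycleGaps hr hrm I.2) S f) | ¬ ∃ x, g x ∈ B} / 2)
    (D := D) (c := c) (ζ := ζ) (δ := δ) (e := e) hD0 hc0
    (fun I f hf => by rw [evenTuples, mem_filter] at hf; exact hf.2.1)
    (fun I => by
      have h1 := le_card_evenTuples hr hm le_rfl hS hε0 hK hn2 I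
      have h2 : q * ε = ζ := by rw [hε]; field_simp
      rw [← hq, h2] at h1
      exact h1)
    (fun I f hf => by
      have := hweight I f hf 0 (Or.inl rfl)
      simpa using this)
    (fun I f hf hxy => by
      have := hweight I f hf 1 (Or.inr ⟨rfl, hxy⟩)
      simpa [hc] using this)
    (by
      have h1 := sum_even_weights_le hr le_rfl hS B
      have h2 : (∑ I : {I // I ∈ indepSets (2 * m) m}, ∑ f ∈ evenTuples hr hrm G S B I,
        (2 * (#{g ∈ sdr (slots (cycleGaps hr hrm I.2) S f) | ∃ x, g x ∈ B} : ℝ) +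
        #{g ∈ sdr (slots (cycleGaps hr hrm I.2) S f) | ¬ ∃ x, g x ∈ B})) ≤
        2 * #(cop (cycleGraph (2 * m)) G) := by exact_mod_cast h1
      refine le_trans ?_ hcop1
      refine le_of_mul_le_mul_left (le_trans (le_of_eq ?_) h2) two_pos
      rw [mul_sum]
      refine sum_congr rfl fun I _ => ?_
      rw [mul_sum]
      refine sum_congr rfl fun f _ => ?_
      ring)
    hδ1 hδζ
  exact ⟨S a b, (hS a b hab hadj).1, (hS a b hab hadj).2.2, hcommon⟩

/-- Saturated graphs with few cycles of odd length `2 * m + 1` have a clique with many common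
neighbours. -/
theorem exists_clique_of_few_odd_cycles {m s : ℕ} (hm : 3 ≤ m) (hk : m + 1 ≤ s - 2)
    {δ : ℝ} (hδ : 0 < δ) (hδ1 : δ ≤ 1) {C₀ : ℝ} (hC₀ : 0 ≤ C₀) :
    ∃ n₀ : ℕ, ∀ (V : Type) [Fintype V] (G : SimpleGraph V), n₀ ≤ Fintype.card V →
      IsSaturated (completeGraph (Fin s)) G →
      (#(cop (cycleGraph (2 * m + 1)) G) : ℝ) ≤
        #(indepSets (2 * m + 1) m) * (s - 2).descFactorial (m + 1) *
        (Fintype.card V : ℝ) ^ m + C₀ * (Fintype.card V : ℝ) ^ (m - 1) →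
      ∃ A : Finset V, #A = s - 2 ∧ (∀ x ∈ A, ∀ y ∈ A, x ≠ y → G.Adj x y) ∧
        (1 - δ) * Fintype.card V ≤ #(commonNbrs G A) := by
  set k := s - 2 with hkdef
  set D : ℝ := (k.descFactorial (m + 1) : ℝ) with hD
  set P : ℝ := (#(indepSets (2 * m + 1) m) : ℝ) with hP
  have hD0 : 0 ≤ D := Nat.cast_nonneg _
  have hP0 : 0 ≤ P := Nat.cast_nonneg _
  obtain ⟨hζ, hδζ⟩ := stability_constants hP0 hD0 one_pos hδ
  set ζ := 1 * δ / (4 * (P * D + 1))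
  set e := 1 * δ / 4 with he
  have he0 : 0 < e := by positivity
  set r := 2 * m + 1 with hrdef
  have hr0 : (1 : ℝ) ≤ r := by exact_mod_cast (by omega : 1 ≤ r)
  set γ : ℝ := ζ / (4 * r) with hγ
  have hγ0 : 0 < γ := by positivity
  set C := P * D + C₀ with hC
  -- If more than γn vertices had `d` neighbours of small degree, there would be about γd n^m
  -- cycles. Since γd > 2C, this beats the C n^m allowed even after losing half.
  obtain ⟨d, hd⟩ := exists_nat_gt (2 * C / γ)
  rw [div_lt_iff₀ hγ0] at hd
  -- Chosen after `d`: it keeps the error in `mul_card_le_card_cop` within half of the main term and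
  -- the exceptional fraction in `le_card_oddTuples` below ζ.
  set ε := γ / (2 * (2 * m ^ 2 + m + d)) with hε
  have hm0 : (0 : ℝ) < m := by exact_mod_cast (by omega : 0 < m)
  have hε0 : 0 < ε := by positivity
  have hεγ : (2 * m ^ 2 + m) * ε + d * ε = γ / 2 := by rw [hε]; field_simp
  have hdε : 0 ≤ d * ε := by positivity
  have hmε : 0 ≤ (2 * m ^ 2 + m) * ε := by positivity
  obtain ⟨K, n₁, hn₁⟩ := exists_card_cop_gt_of_many_big (s := s) hm
    (Or.inr rfl : r = 2 * m ∨ r = 2 * m + 1) (by omega) hε0 C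
  refine ⟨n₁ + ⌈(K + 1) / ε⌉₊ + ⌈C₀ / e⌉₊ + 1, fun V _ G hn hG hcop => ?_⟩
  set n := Fintype.card V with hn'
  have hV : Nonempty V := Fintype.card_pos_iff.1 (by omega)
  have hn0 : (1 : ℝ) ≤ n := by exact_mod_cast (by omega : 1 ≤ n)
  have hn2 : (K + 1 : ℝ) ≤ ε * n := by
    have h1 : (⌈(K + 1) / ε⌉₊ : ℝ) ≤ n := Nat.cast_le.2 (by omega)
    have h2 := (Nat.le_ceil _).trans h1
    rw [div_le_iff₀ hε0] at h2
    linarith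
  have hn3 : C₀ / e ≤ n := by
    have h1 : (⌈C₀ / e⌉₊ : ℝ) ≤ n := Nat.cast_le.2 (by omega)
    exact (Nat.le_ceil _).trans h1
  have hcop1 : (#(cop (cycleGraph r) G) : ℝ) ≤ (P * D + e) * (n : ℝ) ^ m :=
    hcop.trans (add_mul_pow_le (by omega) (by linarith) he0 hn3)
  have hcop2 : (#(cop (cycleGraph r) G) : ℝ) ≤ C * (n : ℝ) ^ m := by
    have h2 : (n : ℝ) ^ (m - 1) ≤ (n : ℝ) ^ m := pow_le_pow_right₀ hn0 (by omega)
    have h3 : C₀ * (n : ℝ) ^ (m - 1) ≤ C₀ * (n : ℝ) ^ m := by gcongr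
    rw [hC]
    linarith
  have hK : #(bigSet G ε) ≤ K := by
    by_contra! h
    exact (hn₁ V G (by omega) hG h.le).not_ge hcop2
  obtain ⟨S, hS⟩ := exists_isSelector' hG
  have hr : 6 ≤ r := by omega
  have hrm : r ≤ 2 * m + 1 := by omega
  set B := bigSet G ε with hB
  have hΓ : (#{v | d ≤ #{w | G.Adj v w ∧ w ∉ B}} : ℝ) ≤ γ * n := by
    by_contra! hlt
    have hex : ∀ v, ∃ N : Finset V, d ≤ #{w | G.Adj v w ∧ w ∉ B} →
        #N = d ∧ ∀ w ∈ N, G.Adj v w ∧ w ∉ B := by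
      intro v
      by_cases h : d ≤ #{w | G.Adj v w ∧ w ∉ B}
      · obtain ⟨N, hN, hNd⟩ := exists_subset_card_eq h
        exact ⟨N, fun _ => ⟨hNd, fun w hw => (mem_filter.1 (hN hw)).2⟩⟩
      · exact ⟨∅, fun h' => absurd h' h⟩
    choose N hN using hex
    set Γ : Finset V := {v | d ≤ #{w | G.Adj v w ∧ w ∉ B}} with hΓdef
    have h1 := mul_card_le_card_cop hm (by omega) hS hε0 hK hn2 (d := d) (Γ := Γ) (N := N)
      (fun a ha => (hN a (mem_filter.1 ha).2).1) (fun a ha => (hN a (mem_filter.1 ha).2).2)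
    rw [← hn'] at h1
    have hn1 : 0 < (n : ℝ) ^ m := by positivity
    have h2 : γ * n * d * (n : ℝ) ^ (m - 1) ≤ #Γ * d * (n : ℝ) ^ (m - 1) := by gcongr
    have h3 : γ * n * d * (n : ℝ) ^ (m - 1) = γ * d * (n : ℝ) ^ m := by
      rw [mul_right_comm γ, mul_assoc, ← pow_succ', Nat.sub_add_cancel (by omega)]
    have h4 : d * ((2 * m ^ 2 + m) * ε * (n : ℝ) ^ m) ≤ d * (γ / 2 * (n : ℝ) ^ m) := by
      gcongr
      linarith
    have h5 : 2 * C * (n : ℝ) ^ m < d * γ * (n : ℝ) ^ m := mul_lt_mul_of_pos_right hd hn1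
    linarith
  have hslots : ∀ I : {I // I ∈ indepSets r m}, ∀ f ∈ oddTuples hr hrm G S B I, ∀ x,
      #(slots (cycleGaps hr hrm I.2) S f x) = k := fun I f hf x => by
    rw [oddTuples, mem_filter] at hf
    exact (hS _ _ (hf.2.1 _ _ (GapMaps.ne _ x)).1 (hf.2.1 _ _ (GapMaps.ne _ x)).2).1
  have hM : ∀ I : {I // I ∈ indepSets r m}, Fintype.card {x // x ∉ I.1} = m + 1 := fun I => by
    rw [card_notMem_subtype, (mem_indepSets.1 I.2).1]; omega
  obtain ⟨a, b, hab, hadj, hcommon⟩ := exists_clique_of_weights hr hm hrm (by omega) hS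
    (oddTuples hr hrm G S B)
    (fun I f => (#(sdr (slots (cycleGaps hr hrm I.2) S f)) : ℝ))
    (D := D) (c := 1) (ζ := ζ) (δ := δ) (e := e) hD0 one_pos
    (fun I f hf => by rw [oddTuples, mem_filter] at hf; exact hf.2.1)
    (fun I => by
      refine le_trans ?_ (le_card_oddTuples hr hm hrm hS hε0 hK hn2 hΓ I)
      have h1 : r * γ * 4 = ζ := by rw [hγ]; field_simp
      have h2 : γ ≤ r * γ := le_mul_of_one_le_left hγ0.le hr0
      have h3 : r * (d * ε) ≤ r * γ := by gcongr; linarith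
      gcongr
      linarith)
    (fun I f hf => by
      have h1 := descFactorial_le_card_sdr (m + 1) k (slots (cycleGaps hr hrm I.2) S f) (hM I) hk
        (fun x => (hslots I f hf x).ge)
      rw [hD]
      exact_mod_cast h1)
    (fun I f hf ⟨x, y, hxy⟩ => by
      have h1 := descFactorial_lt_card_sdr_of_ne (slots (cycleGaps hr hrm I.2) S f)
        (by rw [hM]; exact hk) (hslots I f hf) hxy
      rw [hM] at h1
      rw [hD]
      exact_mod_cast h1)
    (by
      refine le_trans ?_ hcop1
      exact_mod_cast sum_odd_weights_le hr hrm hS B)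
    hδ1 hδζ
  exact ⟨S a b, (hS a b hab hadj).1, (hS a b hab hadj).2.2, hcommon⟩

/-! ### The extremal graph and the conclusion. -/

/-- A clique has at most one vertex outside `A`, hence at most s - 1 vertices; a new edge lies
outside `A` and together with `A` forms a K_s. -/
lemma hubGraph_isSaturated {V : Type*} {s : ℕ} (hs : 2 ≤ s) {A : Finset V} (hA : #A = s - 2) :
    IsSaturated (completeGraph (Fin s)) (hubGraph A) := by
  constructor
  · rintro ⟨φ⟩
    have h1 : #{i : Fin s | φ i ∉ A} ≤ 1 := by
      refine card_le_one.2 fun i hi j hj => ?_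
      rw [mem_filter] at hi hj
      by_contra hij
      have h2 : (completeGraph (Fin s)).Adj i j := by rwa [top_adj]
      rcases (φ.toHom.map_adj h2).2 with h | h
      · exact hi.2 h
      · exact hj.2 h
    have h2 : #{i : Fin s | φ i ∈ A} ≤ #A := card_le_card_of_injOn φ
      (fun i hi => (mem_filter.1 hi).2) φ.injective.injOn
    have h3 := card_filter_add_card_filter_not (s := (univ : Finset (Fin s))) fun i => φ i ∈ A
    rw [card_univ, Fintype.card_fin] at h3
    omega
  · intro u v huv hadj
    change ¬ (u ≠ v ∧ (u ∈ A ∨ v ∈ A)) at hadj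
    simp only [not_and, not_or] at hadj
    obtain ⟨hu, hv⟩ := hadj huv
    have hcl : (hubGraph A ⊔ edge u v).IsNClique s (insert u (insert v A)) := by
      have h1 : (hubGraph A ⊔ edge u v).IsNClique (s - 2) A :=
        ⟨fun x hx y _ hxy => Or.inl ⟨hxy, Or.inl hx⟩, hA⟩
      have h2 := (h1.insert (a := v) fun b hb =>
        Or.inl ⟨fun h => hv (h ▸ hb), Or.inr hb⟩).insert (a := u) (by
          intro b hb
          rcases mem_insert.1 hb with rfl | hb
          · exact Or.inr ((edge_adj _ _ _ _).2 ⟨Or.inl ⟨rfl, rfl⟩, huv⟩)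
          · exact Or.inl ⟨fun h => hu (h ▸ hb), Or.inr hb⟩)
      convert h2 using 1
      omega
    have h3 : ¬ (hubGraph A ⊔ edge u v).CliqueFree s := fun h4 => h4 _ hcl
    rwa [not_cliqueFree_iff_top_isContained] at h3

lemma nonempty_hubGraph_iso {V V' : Type*} [Fintype V] [Fintype V'] {A : Finset V}
    {A' : Finset V'} (hA : #A = #A') (hV : Fintype.card V = Fintype.card V') :
    Nonempty (hubGraph A ≃g hubGraph A') := by
  have h1 : Fintype.card {x // x ∈ A} = Fintype.card {x // x ∈ A'} := by
    rwa [Fintype.card_coe, Fintype.card_coe]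
  have h2 : Fintype.card {x // x ∉ A} = Fintype.card {x // x ∉ A'} := by
    rw [Fintype.card_subtype_compl, Fintype.card_subtype_compl, h1, hV]
  let e : V ≃ V' := (Equiv.sumCompl (· ∈ A)).symm.trans
    (((Fintype.equivOfCardEq h1).sumCongr (Fintype.equivOfCardEq h2)).trans
      (Equiv.sumCompl (· ∈ A')))
  have he : ∀ x, e x ∈ A' ↔ x ∈ A := by
    intro x
    by_cases hx : x ∈ A
    · simp [e, hx]
    · have h3 := (Fintype.equivOfCardEq h2 ⟨x, hx⟩).2
      simpa [e, hx] using h3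
  refine ⟨e, fun {x y} => ?_⟩
  change (e x ≠ e y ∧ (e x ∈ A' ∨ e y ∈ A')) ↔ (x ≠ y ∧ (x ∈ A ∨ y ∈ A))
  rw [he, he, e.injective.ne_iff]

lemma extremalGraph_eq_hubGraph (n s : ℕ) :
    extremalGraph n s = hubGraph ((univ : Finset (Fin (s - 2))).map Embedding.inl) := by
  ext x y
  rcases x with x | x <;> rcases y with y | y <;>
    simp [extremalGraph, join, hubGraph]

/-- All vertices outside `A` are now common neighbours of `A`, and these are pairwise nonadjacent by
`not_adj_of_mem_commonNbrs`. -/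
lemma eq_hubGraph_of_restSet_eq_empty {V : Type*} [Fintype V] {G : SimpleGraph V} {s : ℕ}
    (hs : 2 ≤ s) (hG : IsSaturated (completeGraph (Fin s)) G) {A : Finset V} (hA : #A = s - 2)
    (hclique : ∀ x ∈ A, ∀ y ∈ A, x ≠ y → G.Adj x y) (h : restSet G A = ∅) : G = hubGraph A := by
  have hcommon : ∀ x, x ∉ A → x ∈ commonNbrs G A := fun x hx => by
    by_contra hx'
    have := mem_restSet.2 ⟨hx, hx'⟩
    rw [h] at this
    exact notMem_empty x this
  have hadj : ∀ x ∈ A, ∀ y, x ≠ y → G.Adj x y := fun x hx y hxy => by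
    by_cases hy : y ∈ A
    · exact hclique x hx y hy hxy
    · exact (mem_commonNbrs.1 (hcommon y hy) x hx).symm
  ext x y
  change G.Adj x y ↔ x ≠ y ∧ (x ∈ A ∨ y ∈ A)
  constructor
  · refine fun hxy => ⟨hxy.ne, ?_⟩
    by_contra! hno
    exact not_adj_of_mem_commonNbrs hs hG hA hclique (hcommon x hno.1) (hcommon y hno.2) hxy
  · rintro ⟨hne, hx | hy⟩
    · exact hadj x hx y hne
    · exact (hadj y hy x hne.symm).symm

lemma exists_clique_of_few_cycles {r m s : ℕ} (hm : 3 ≤ m) (hrm : r = 2 * m ∨ r = 2 * m + 1)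
    (hk : r - m ≤ s - 2) (hkm : r = 2 * m → 4 * (s - 2) ≤ m ^ 2) {δ : ℝ} (hδ : 0 < δ)
    (hδ1 : δ ≤ 1) {C₀ : ℝ} (hC₀ : 0 ≤ C₀) :
    ∃ n₀ : ℕ, ∀ (V : Type) [Fintype V] (G : SimpleGraph V), n₀ ≤ Fintype.card V →
      IsSaturated (completeGraph (Fin s)) G →
      (#(cop (cycleGraph r) G) : ℝ) ≤ #(indepSets r m) * (s - 2).descFactorial (r - m) *
        (Fintype.card V : ℝ) ^ m + C₀ * (Fintype.card V : ℝ) ^ (m - 1) →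
      ∃ A : Finset V, #A = s - 2 ∧ (∀ x ∈ A, ∀ y ∈ A, x ≠ y → G.Adj x y) ∧
        (1 - δ) * Fintype.card V ≤ #(commonNbrs G A) := by
  rcases hrm with rfl | rfl
  · have h : 2 * m - m = m := by omega
    rw [h] at hk ⊢
    exact exists_clique_of_few_even_cycles hm hk (hkm rfl) hδ hδ1 hC₀
  · have h : 2 * m + 1 - m = m + 1 := by omega
    rw [h] at hk ⊢
    exact exists_clique_of_few_odd_cycles hm hk hδ hδ1 hC₀

/-- A saturated graph with at most as many cycles as the extremal graph is the extremal graph. -/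
theorem nonempty_iso_of_card_cop_le {r m s : ℕ} (hm : 3 ≤ m) (hrm : r = 2 * m ∨ r = 2 * m + 1)
    (hk : r - m ≤ s - 2) (hkm : r = 2 * m → 4 * (s - 2) ≤ m ^ 2) :
    ∃ n₀ : ℕ, ∀ n : ℕ, n₀ ≤ n → ∀ G : SimpleGraph (Fin n),
      IsSaturated (completeGraph (Fin s)) G →
      #(cop (cycleGraph r) G) ≤ #(cop (cycleGraph r) (extremalGraph n s)) →
      Nonempty (G ≃g extremalGraph n s) := by
  obtain ⟨δ, hδ, n₁, hn₁⟩ := exists_card_cop_hubGraph_lt (r := r) (m := m) (s := s) (by omega) hm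
    (by omega) (by omega) (by omega) hk
  -- `C₀` is the coefficient of the lower-order term in `card_cop_le` for the extremal graph.
  obtain ⟨n₂, hn₂⟩ := exists_clique_of_few_cycles hm hrm hk hkm (lt_min hδ one_pos)
    (min_le_right δ 1) (C₀ := 2 ^ r * (s - 2 : ℕ) ^ r) (by positivity)
  refine ⟨n₁ + n₂ + s, fun n hn G hG hle => ?_⟩
  set A₀ : Finset (Fin (s - 2) ⊕ Fin (n - (s - 2))) := univ.map Embedding.inl with hA₀
  have hA₀c : #A₀ = s - 2 := by rw [hA₀, card_map, card_univ, Fintype.card_fin]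
  have hcard : Fintype.card (Fin (s - 2) ⊕ Fin (n - (s - 2))) = n := by
    rw [Fintype.card_sum, Fintype.card_fin, Fintype.card_fin]; omega
  have : Nonempty (Fin (s - 2) ⊕ Fin (n - (s - 2))) := Fintype.card_pos_iff.1 (by omega)
  rw [extremalGraph_eq_hubGraph, ← hA₀] at hle ⊢
  have hup := card_cop_le (r := r) (m := m) (by omega) (by omega) (by omega) hA₀c
    (E := hubGraph A₀) fun x y h => h.2
  rw [hcard] at hup
  obtain ⟨A, hA, hclique, hcommon⟩ := hn₂ (Fin n) G (by rw [Fintype.card_fin]; omega) hG (by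
    have h1 := hle.trans hup
    rw [Fintype.card_fin]
    calc (#(cop (cycleGraph r) G) : ℝ) ≤ #(indepSets r m) * (n ^ m * (s - 2).descFactorial (r - m))
          + 2 ^ r * (n ^ (m - 1) * (s - 2 : ℕ) ^ r) := by exact_mod_cast h1
      _ = _ := by ring)
  obtain ⟨e⟩ := nonempty_hubGraph_iso (A := A) (A' := A₀) (hA.trans hA₀c.symm)
    (by rw [hcard, Fintype.card_fin])
  rcases (restSet G A).eq_empty_or_nonempty with h | h
  · rw [eq_hubGraph_of_restSet_eq_empty (by omega) hG hA hclique h]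
    exact ⟨e⟩
  · have h1 := hn₁ (Fin n) G A (by rw [Fintype.card_fin]; omega) hG hA hclique (by
      refine le_trans ?_ hcommon
      gcongr
      exact min_le_left _ _) h
    rw [card_cop_congr _ e] at h1
    omega

end SatCycle

theorem mainTheorem3 (s r : ℕ) (hs : 4 ≤ s)
    (hr : (Odd r ∧ 7 ≤ r) ∨ (Even r ∧ 4 * Real.sqrt ((s : ℝ) - 2) ≤ (r : ℝ))) :
    ∃ n₀ : ℕ, ∀ n : ℕ, n₀ ≤ n →
      SatCycle.IsMinimizer n (SimpleGraph.cycleGraph r) (SimpleGraph.completeGraph (Fin s))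
        (SatCycle.extremalGraph n s) ∧
      (r + 4 ≤ 2 * s → ∀ G : SimpleGraph (Fin n),
        SatCycle.IsMinimizer n (SimpleGraph.cycleGraph r) (SimpleGraph.completeGraph (Fin s)) G →
        Nonempty (SimpleGraph.Iso G (SatCycle.extremalGraph n s))) := by
  open SatCycle Finset SimpleGraph in
  classical
  have hcard : ∀ n, s ≤ n → Fintype.card (Fin (s - 2) ⊕ Fin (n - (s - 2))) = n := fun n hn => by
    rw [Fintype.card_sum, Fintype.card_fin, Fintype.card_fin]; omega
  have hAc : ∀ n, #((univ : Finset (Fin (s - 2))).map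
      (Function.Embedding.inl : _ ↪ Fin (s - 2) ⊕ Fin (n - (s - 2)))) = s - 2 := fun n => by
    rw [card_map, card_univ, Fintype.card_fin]
  have hsat : ∀ n, IsSaturated (completeGraph (Fin s)) (extremalGraph n s) := fun n => by
    rw [extremalGraph_eq_hubGraph]
    exact hubGraph_isSaturated (by omega) (hAc n)
  -- With r = 2m this becomes 4(s - 2) ≤ m². As s ≥ 4, it also gives r² ≥ 32, hence r ≥ 6.
  have hsqrt : Even r → 16 * (s - 2) ≤ r ^ 2 := by
    rintro ⟨m, hm⟩
    rcases hr with ⟨hodd, -⟩ | ⟨-, h⟩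
    · exact absurd ⟨m, hm⟩ (Nat.not_even_iff_odd.2 hodd)
    · have h1 : (0 : ℝ) ≤ (s : ℝ) - 2 := by
        have : (4 : ℝ) ≤ s := by exact_mod_cast hs
        linarith
      have h2 := pow_le_pow_left₀ (by positivity) h 2
      rw [mul_pow, Real.sq_sqrt h1] at h2
      have h3 : ((16 * (s - 2) : ℕ) : ℝ) ≤ (r ^ 2 : ℕ) := by
        push_cast [Nat.cast_sub (by omega : 2 ≤ s)]
        linarith
      exact_mod_cast h3
  have hr6 : 6 ≤ r := by
    rcases Nat.even_or_odd r with he | ho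
    · have h1 := hsqrt he
      by_contra! h
      have h2 : r ^ 2 ≤ 5 ^ 2 := Nat.pow_le_pow_left (by omega) 2
      omega
    · rcases hr with ⟨-, h⟩ | ⟨h, -⟩
      · omega
      · exact absurd h (Nat.not_even_iff_odd.2 ho)
  -- This is the condition r ≤ 2(s - 2) that the extremal graph has room for an r-cycle.
  by_cases hrs : r + 4 ≤ 2 * s
  · obtain ⟨m, hm⟩ : ∃ m, r = 2 * m ∨ r = 2 * m + 1 := ⟨r / 2, by omega⟩
    have hm3 : 3 ≤ m := by omega
    obtain ⟨n₀, hn₀⟩ := nonempty_iso_of_card_cop_le (r := r) (m := m) (s := s) hm3 hm (by omega)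
      fun h => by
        have h1 := hsqrt (by rw [h]; exact even_two_mul m)
        have h2 : r ^ 2 = 4 * m ^ 2 := by rw [h]; ring
        omega
    refine ⟨n₀ + s, fun n hn => ⟨⟨hcard n (by omega), hsat n, fun G' hG' => ?_⟩,
      fun _ G hG => hn₀ n (by omega) G hG.2.1 ?_⟩⟩
    · rw [copyCount_le_iff]
      by_contra! hlt
      obtain ⟨e⟩ := hn₀ n (by omega) G' hG' hlt.le
      rw [card_cop_congr _ e] at hlt
      omega
    -- Minimality of `G` is tested only against graphs on `Fin n`, so the extremal graph is first
    -- transported to that vertex set.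
    · obtain ⟨A, -, hA⟩ := exists_subset_card_eq (s := (univ : Finset (Fin n))) (n := s - 2)
        (by rw [card_univ, Fintype.card_fin]; omega)
      have h1 := hG.2.2 (hubGraph A) (hubGraph_isSaturated (by omega) hA)
      rw [copyCount_le_iff] at h1
      obtain ⟨e⟩ := nonempty_hubGraph_iso (hA.trans (hAc n).symm)
        ((Fintype.card_fin n).trans (hcard n (by omega)).symm)
      rw [extremalGraph_eq_hubGraph, ← card_cop_congr _ e]
      exact h1
  · refine ⟨s, fun n hn => ⟨⟨hcard n hn, hsat n, fun G' _ => ?_⟩, fun h => absurd h hrs⟩⟩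
    have h1 := cop_eq_empty (r := r) (k := s - 2) (by omega) (by omega) (hAc n)
      (E := hubGraph _) fun x y h => h.2
    rw [copyCount_le_iff, extremalGraph_eq_hubGraph, h1, card_empty]
    exact Nat.zero_le _
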